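/- Throughout, $\otimes$ denotes the minimal (spatial) tensor product of unital $C^*$-algebras. A compact quantum group $(H,\Delta)$ is a unital $C^*$-algebra $H$ together with a unital $*$-homomorphism $\Delta:H\to H\otimes H$ such that $(\Delta\otimes\mathrm{id})\Delta=(\mathrm{id}\otimes\Delta)\Delta$ and the linear spans of $(H\otimes 1)\Delta(H)$ and $(1\otimes H)\Delta(H)$ are dense in $H\otimes H$. A coaction of $(H,\Delta)$ on a unital $C^*$-algebra $A$ is a unital $*$-homomorphism $\delta:A\to A\otimes H$ such that $(\delta\otimes\mathrm{id})\delta=(\mathrm{id}\otimes\Delta)\delta$ and the linear span of $\delta(A)(1\otimes H)$ is dense in $A\otimes H$. It is free if the linear span of $(A\otimes 1)\delta(A)$ is dense in $A\otimes H$. The equivariant join is the unital $C^*$-algebra $$A\circledast_\delta H=\{f\in C([0,1],A\otimes H) : f(0)\in\mathbb{C}\otimes H,\ f(1)\in\delta(A)\},$$ with the coaction $\delta_\Delta$ of $(H,\Delta)$ given by applying $\mathrm{id}\otimes\Delta$ at each $t\in[0,1]$. We say that Type 2 holds for a coaction $\delta$ of $(H,\Delta)$ if there is no unital $*$-homomorphism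 $\psi:H\to A\circledast_\delta H$ that is $(\Delta,\delta_\Delta)$-equivariant, i.e. satisfies $(\psi\otimes\mathrm{id})\circ\Delta=\delta_\Delta\circ\psi$. **Theorem.** Let $(H,\Delta)$ be a compact quantum group, and suppose that there are a compact quantum group $(K,\Delta_K)$ with $1<\dim_{\mathbb{C}}K<\infty$ and an injective unital $*$-homomorphism $\iota:K\to H$ with $\Delta\circ\iota=(\iota\otimes\iota)\circ\Delta_K$. Then Type 2 holds for every free coaction of $(H,\Delta)$ on every nonzero unital $C^*$-algebra $A$. In particular, let $G$ be a compact Hausdorff group with a closed normal subgroup $N$ such that $G/N$ is finite and nontrivial, and let $\Delta$ be the comultiplication of $C(G)$, i.e. $\Delta(f)(x,y)=f(xy)$ under $C(G)\otimes C(G)\cong C(G\times G)$. Then Type 2 holds for every free coaction of $(C(G),\Delta)$ on every nonzero unital $C^*$-algebra. -/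

import Mathlib

open scoped TensorProduct InnerProductSpace

universe u

set_option linter.unusedSectionVars false

noncomputable section

namespace QuantumJoin

/-! ### Representations of `*`-algebras on Hilbert spaces and their tensor products -/

section Representations

/-- The Hilbert space tensor product: the completion of the algebraic tensor product. -/
def HilbertTensor (E F : Type u) [NormedAddCommGroup E] [InnerProductSpace ℂ E]
    [NormedAddCommGroup F] [InnerProductSpace ℂ F] : Type u :=
  UniformSpace.Completion (E ⊗[ℂ] F)

variable {E F G : Type u} [NormedAddCommGroup E] [InnerProductSpace ℂ E]
  [NormedAddCommGroup F] [InnerProductSpace ℂ F]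
  [NormedAddCommGroup G] [InnerProductSpace ℂ G]

instance : NormedAddCommGroup (HilbertTensor E F) :=
  inferInstanceAs (NormedAddCommGroup (UniformSpace.Completion (E ⊗[ℂ] F)))

instance : InnerProductSpace ℂ (HilbertTensor E F) :=
  inferInstanceAs (InnerProductSpace ℂ (UniformSpace.Completion (E ⊗[ℂ] F)))

instance : CompleteSpace (HilbertTensor E F) :=
  inferInstanceAs (CompleteSpace (UniformSpace.Completion (E ⊗[ℂ] F)))

/-- The embedding of the algebraic tensor product into the Hilbert space tensor product. -/
def toHilbert : E ⊗[ℂ] F →ₗᵢ[ℂ] HilbertTensor E F :=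
  (UniformSpace.Completion.toComplₗᵢ : E ⊗[ℂ] F →ₗᵢ[ℂ] UniformSpace.Completion (E ⊗[ℂ] F))

theorem denseRange_toHilbert : DenseRange (toHilbert : E ⊗[ℂ] F → HilbertTensor E F) :=
  UniformSpace.Completion.denseRange_coe

/-- The bounded operator `S ⊗ T` on the Hilbert space tensor product. -/
def opTensor (S : E →L[ℂ] E) (T : F →L[ℂ] F) :
    HilbertTensor E F →L[ℂ] HilbertTensor E F :=
  ((TensorProduct.mapL S T).completion :
    UniformSpace.Completion (E ⊗[ℂ] F) →L[ℂ] UniformSpace.Completion (E ⊗[ℂ] F))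

@[simp]
theorem opTensor_toHilbert (S : E →L[ℂ] E) (T : F →L[ℂ] F) (v : E ⊗[ℂ] F) :
    opTensor S T (toHilbert v) =
      toHilbert (TensorProduct.map S.toLinearMap T.toLinearMap v) :=
  (ContinuousLinearMap.completion_apply_coe (TensorProduct.mapL S T) v).trans
    (congrArg toHilbert (TensorProduct.mapL_apply S T v))

theorem op_ext {S T : HilbertTensor E F →L[ℂ] HilbertTensor E F}
    (h : ∀ (e : E) (f : F), S (toHilbert (e ⊗ₜ[ℂ] f)) = T (toHilbert (e ⊗ₜ[ℂ] f))) : S = T := by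
  ext v
  induction v using denseRange_toHilbert.induction_on with
  | hp => exact isClosed_eq S.continuous T.continuous
  | ih v =>
    induction v using TensorProduct.induction_on with
    | zero => simp
    | tmul e f => exact h e f
    | add x y hx hy => simp only [map_add, hx, hy]

theorem opTensor_one : opTensor (1 : E →L[ℂ] E) (1 : F →L[ℂ] F) = 1 :=
  op_ext fun e f => by simp

theorem opTensor_mul (S S' : E →L[ℂ] E) (T T' : F →L[ℂ] F) :
    opTensor (S * S') (T * T') = opTensor S T * opTensor S' T' :=
  op_ext fun e f => by simp

theorem opTensor_norm_le (S : E →L[ℂ] E) (T : F →L[ℂ] F) : ‖opTensor S T‖ ≤ ‖S‖ * ‖T‖ := by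
  refine ContinuousLinearMap.opNorm_le_bound _ (by positivity) fun v => ?_
  induction v using denseRange_toHilbert.induction_on with
  | hp => exact isClosed_le (opTensor S T).continuous.norm (continuous_const.mul continuous_norm)
  | ih v =>
    have h := (TensorProduct.mapL S T).le_of_opNorm_le (TensorProduct.norm_mapL_le S T) v
    simpa using h

/-- `S ↦ S ⊗ 1`. -/
def ampLeft : (E →L[ℂ] E) →ₐ[ℂ] (HilbertTensor E F →L[ℂ] HilbertTensor E F) where
  toFun S := opTensor S 1
  map_one' := opTensor_one
  map_mul' S S' := by rw [← opTensor_mul, one_mul]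
  map_zero' := op_ext fun e f => by simp
  map_add' S S' := op_ext fun e f => by
    simp [TensorProduct.add_tmul]
  commutes' r := op_ext fun e f => by
    simp [Algebra.algebraMap_eq_smul_one, ← TensorProduct.smul_tmul']

/-- `T ↦ 1 ⊗ T`. -/
def ampRight : (F →L[ℂ] F) →ₐ[ℂ] (HilbertTensor E F →L[ℂ] HilbertTensor E F) where
  toFun T := opTensor 1 T
  map_one' := opTensor_one
  map_mul' S S' := by rw [← opTensor_mul, one_mul]
  map_zero' := op_ext fun e f => by simp
  map_add' S S' := op_ext fun e f => by
    simp [TensorProduct.tmul_add]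
  commutes' r := op_ext fun e f => by
    simp [Algebra.algebraMap_eq_smul_one, TensorProduct.tmul_smul]

theorem amp_commute (S : E →L[ℂ] E) (T : F →L[ℂ] F) :
    Commute (ampLeft (F := F) S) (ampRight (E := E) T) := by
  change opTensor S 1 * opTensor 1 T = opTensor 1 T * opTensor S 1
  simp [← opTensor_mul]

theorem star_opTensor [CompleteSpace E] [CompleteSpace F] (S : E →L[ℂ] E) (T : F →L[ℂ] F) :
    star (opTensor S T) = opTensor (star S) (star T) := by
  rw [eq_comm, ContinuousLinearMap.star_eq_adjoint (opTensor S T),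
    ContinuousLinearMap.eq_adjoint_iff]
  intro v w
  induction v using denseRange_toHilbert.induction_on with
  | hp =>
    exact isClosed_eq ((opTensor (star S) (star T)).continuous.inner (𝕜 := ℂ) continuous_const)
      (continuous_id.inner (𝕜 := ℂ) continuous_const)
  | ih v =>
  induction w using denseRange_toHilbert.induction_on with
  | hp =>
    exact isClosed_eq (continuous_const.inner (𝕜 := ℂ) continuous_id)
      (continuous_const.inner (𝕜 := ℂ) (opTensor S T).continuous)
  | ih w =>
    simp only [opTensor_toHilbert, LinearIsometry.inner_map_map]
    induction v using TensorProduct.induction_on with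
    | zero => simp
    | add x y hx hy => simp [inner_add_left, hx, hy]
    | tmul e f =>
      induction w using TensorProduct.induction_on with
      | zero => simp
      | add x y hx hy => simp only [map_add, inner_add_right, hx, hy]
      | tmul e' f' => simp [ContinuousLinearMap.star_eq_adjoint,
          ContinuousLinearMap.adjoint_inner_left]

end Representations

section RepTensor

variable {X Y Z X' Y' : Type u} [Ring X] [Algebra ℂ X] [StarRing X] [Ring Y] [Algebra ℂ Y]
  [StarRing Y] [Ring Z] [Algebra ℂ Z] [StarRing Z] [Ring X'] [Algebra ℂ X'] [StarRing X']
  [Ring Y'] [Algebra ℂ Y'] [StarRing Y'] [StarModule ℂ X] [StarModule ℂ Y] [StarModule ℂ Z]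
  [StarModule ℂ X'] [StarModule ℂ Y']
  {E F G : Type u} [NormedAddCommGroup E] [InnerProductSpace ℂ E] [CompleteSpace E]
  [NormedAddCommGroup F] [InnerProductSpace ℂ F] [CompleteSpace F]
  [NormedAddCommGroup G] [InnerProductSpace ℂ G] [CompleteSpace G]

/-- The tensor product `π ⊗ ρ` of two representations. -/
def tensorHom (π : X →⋆ₐ[ℂ] (E →L[ℂ] E)) (ρ : Y →⋆ₐ[ℂ] (F →L[ℂ] F)) :
    X ⊗[ℂ] Y →⋆ₐ[ℂ] (HilbertTensor E F →L[ℂ] HilbertTensor E F) :=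
  { Algebra.TensorProduct.lift (ampLeft.comp π.toAlgHom) (ampRight.comp ρ.toAlgHom)
      (fun x y => amp_commute (π x) (ρ y)) with
    map_star' := fun t => by
      change Algebra.TensorProduct.lift _ _ _ (star t) =
        star (Algebra.TensorProduct.lift _ _ _ t)
      induction t using TensorProduct.induction_on with
      | zero => simp
      | add x y hx hy => simp only [star_add, map_add, hx, hy]
      | tmul x y =>
        simp only [TensorProduct.star_tmul]
        change opTensor (π (star x)) 1 * opTensor 1 (ρ (star y)) =
          star (opTensor (π x) 1 * opTensor 1 (ρ y))
        simp [← opTensor_mul, star_opTensor, map_star] }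

@[simp]
theorem tensorHom_tmul (π : X →⋆ₐ[ℂ] (E →L[ℂ] E)) (ρ : Y →⋆ₐ[ℂ] (F →L[ℂ] F)) (x : X) (y : Y) :
    tensorHom π ρ (x ⊗ₜ y) = opTensor (π x) (ρ y) := by
  have h : tensorHom π ρ (x ⊗ₜ y) = opTensor (π x) 1 * opTensor 1 (ρ y) :=
    Algebra.TensorProduct.lift_tmul _ _ (fun x y => amp_commute (π x) (ρ y)) x y
  simp [h, ← opTensor_mul]

/-- The algebraic tensor product of two `*`-homomorphisms. -/
def algMap (f : X →⋆ₐ[ℂ] X') (g : Y →⋆ₐ[ℂ] Y') : X ⊗[ℂ] Y →⋆ₐ[ℂ] X' ⊗[ℂ] Y' :=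
  { Algebra.TensorProduct.map f.toAlgHom g.toAlgHom with
    map_star' := fun t => by
      change Algebra.TensorProduct.map _ _ (star t) = star (Algebra.TensorProduct.map _ _ t)
      induction t using TensorProduct.induction_on with
      | zero => simp
      | add x y hx hy => simp only [star_add, map_add, hx, hy]
      | tmul x y => simp [map_star] }

@[simp]
theorem algMap_tmul (f : X →⋆ₐ[ℂ] X') (g : Y →⋆ₐ[ℂ] Y') (x : X) (y : Y) :
    algMap f g (x ⊗ₜ y) = f x ⊗ₜ g y := rfl

/-- The algebraic embedding `x ↦ x ⊗ 1`. -/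
def algLeft : X →⋆ₐ[ℂ] X ⊗[ℂ] Y :=
  { (Algebra.TensorProduct.includeLeft : X →ₐ[ℂ] X ⊗[ℂ] Y) with
    map_star' := fun x => by
      change (star x) ⊗ₜ[ℂ] (1 : Y) = star (x ⊗ₜ[ℂ] (1 : Y))
      simp }

@[simp]
theorem algLeft_apply (x : X) : (algLeft x : X ⊗[ℂ] Y) = x ⊗ₜ 1 := rfl

/-- The algebraic embedding `y ↦ 1 ⊗ y`. -/
def algRight : Y →⋆ₐ[ℂ] X ⊗[ℂ] Y :=
  { (Algebra.TensorProduct.includeRight : Y →ₐ[ℂ] X ⊗[ℂ] Y) with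
    map_star' := fun y => by
      change (1 : X) ⊗ₜ[ℂ] (star y) = star ((1 : X) ⊗ₜ[ℂ] y)
      simp }

@[simp]
theorem algRight_apply (y : Y) : (algRight y : X ⊗[ℂ] Y) = 1 ⊗ₜ y := rfl

/-- The algebraic associator. -/
def algAssoc : (X ⊗[ℂ] Y) ⊗[ℂ] Z →⋆ₐ[ℂ] X ⊗[ℂ] (Y ⊗[ℂ] Z) :=
  { (Algebra.TensorProduct.assoc ℂ ℂ ℂ X Y Z).toAlgHom with
    map_star' := fun t => by
      change Algebra.TensorProduct.assoc ℂ ℂ ℂ X Y Z (star t) =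
        star (Algebra.TensorProduct.assoc ℂ ℂ ℂ X Y Z t)
      induction t using TensorProduct.induction_on with
      | zero => simp
      | add x y hx hy => simp only [star_add, map_add, hx, hy]
      | tmul t z =>
        induction t using TensorProduct.induction_on with
        | zero => simp
        | add x y hx hy => simp only [star_add, map_add, TensorProduct.add_tmul, hx, hy]
        | tmul x y => simp }

@[simp]
theorem algAssoc_tmul (x : X) (y : Y) (z : Z) :
    algAssoc ((x ⊗ₜ[ℂ] y) ⊗ₜ[ℂ] z) = x ⊗ₜ[ℂ] (y ⊗ₜ[ℂ] z) := rfl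

theorem tensorHom_algMap (π : X' →⋆ₐ[ℂ] (E →L[ℂ] E)) (ρ : Y' →⋆ₐ[ℂ] (F →L[ℂ] F))
    (f : X →⋆ₐ[ℂ] X') (g : Y →⋆ₐ[ℂ] Y') (t : X ⊗[ℂ] Y) :
    tensorHom π ρ (algMap f g t) = tensorHom (π.comp f) (ρ.comp g) t := by
  induction t using TensorProduct.induction_on with
  | zero => simp only [map_zero]
  | add x y hx hy => rw [map_add, map_add, map_add, hx, hy]
  | tmul x y => simp

/-- The isometric embedding of the algebraic triple tensor product, bracketed to the right. -/
def tripleRight : E ⊗[ℂ] (F ⊗[ℂ] G) →ₗᵢ[ℂ] HilbertTensor E (HilbertTensor F G) :=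
  toHilbert.comp (TensorProduct.mapIsometry LinearIsometry.id toHilbert)

theorem tripleRight_zero : (tripleRight (0 : E ⊗[ℂ] (F ⊗[ℂ] G)) : HilbertTensor E (HilbertTensor F G)) = 0 :=
  LinearIsometry.map_zero _

theorem tripleRight_add (v w : E ⊗[ℂ] (F ⊗[ℂ] G)) :
    (tripleRight (v + w) : HilbertTensor E (HilbertTensor F G)) = tripleRight v + tripleRight w :=
  LinearIsometry.map_add _ v w

theorem tripleRight_tmul (e : E) (w : F ⊗[ℂ] G) :
    tripleRight (e ⊗ₜ[ℂ] w) = toHilbert (e ⊗ₜ[ℂ] toHilbert w) := rfl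

/-- The isometric embedding of the algebraic triple tensor product, bracketed to the left. -/
def tripleLeft : E ⊗[ℂ] (F ⊗[ℂ] G) →ₗᵢ[ℂ] HilbertTensor (HilbertTensor E F) G :=
  (toHilbert.comp (TensorProduct.mapIsometry toHilbert LinearIsometry.id)).comp
    (TensorProduct.assocIsometry ℂ E F G).symm.toLinearIsometry

theorem tripleLeft_zero : (tripleLeft (0 : E ⊗[ℂ] (F ⊗[ℂ] G)) : HilbertTensor (HilbertTensor E F) G) = 0 :=
  LinearIsometry.map_zero _

theorem tripleLeft_add (v w : E ⊗[ℂ] (F ⊗[ℂ] G)) :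
    (tripleLeft (v + w) : HilbertTensor (HilbertTensor E F) G) = tripleLeft v + tripleLeft w :=
  LinearIsometry.map_add _ v w

theorem tripleLeft_tmul (e : E) (f : F) (g : G) :
    tripleLeft (e ⊗ₜ[ℂ] (f ⊗ₜ[ℂ] g)) = toHilbert (toHilbert (e ⊗ₜ[ℂ] f) ⊗ₜ[ℂ] g) := rfl

theorem denseRange_tripleRight : DenseRange (tripleRight : E ⊗[ℂ] (F ⊗[ℂ] G) → _) := by
  have h : ∀ v : E ⊗[ℂ] HilbertTensor F G, toHilbert v ∈
      (LinearMap.range (tripleRight (E := E) (F := F) (G := G)).toLinearMap).topologicalClosure := by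
    intro v
    induction v using TensorProduct.induction_on with
    | zero => rw [map_zero]; exact Submodule.zero_mem _
    | add x y hx hy => rw [map_add]; exact Submodule.add_mem _ hx hy
    | tmul e w =>
      induction w using denseRange_toHilbert.induction_on with
      | hp =>
        have hc : Continuous fun w : HilbertTensor F G => toHilbert (e ⊗ₜ[ℂ] w) :=
          toHilbert.continuous.comp (TensorProduct.mkL ℂ E (HilbertTensor F G) e).continuous
        exact (Submodule.isClosed_topologicalClosure _).preimage hc
      | ih w => exact Submodule.le_topologicalClosure _ ⟨e ⊗ₜ w, tripleRight_tmul e w⟩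
  intro v
  induction v using denseRange_toHilbert.induction_on with
  | hp => exact isClosed_closure
  | ih v => exact h v

/-- The two bracketings of a triple tensor product of representations have the same norm. -/
theorem norm_tensorHom_assoc_le (π : X →⋆ₐ[ℂ] (E →L[ℂ] E)) (ρ : Y →⋆ₐ[ℂ] (F →L[ℂ] F))
    (σ : Z →⋆ₐ[ℂ] (G →L[ℂ] G)) (t : (X ⊗[ℂ] Y) ⊗[ℂ] Z) :
    ‖tensorHom π (tensorHom ρ σ) (algAssoc t)‖ ≤ ‖tensorHom (tensorHom π ρ) σ t‖ := by
  have key : ∃ L : E ⊗[ℂ] (F ⊗[ℂ] G) →ₗ[ℂ] E ⊗[ℂ] (F ⊗[ℂ] G),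
      (∀ v, tensorHom π (tensorHom ρ σ) (algAssoc t) (tripleRight v) = tripleRight (L v)) ∧
      (∀ v, tensorHom (tensorHom π ρ) σ t (tripleLeft v) = tripleLeft (L v)) := by
    have hadd : ∀ t s : (X ⊗[ℂ] Y) ⊗[ℂ] Z,
        (∃ L : E ⊗[ℂ] (F ⊗[ℂ] G) →ₗ[ℂ] E ⊗[ℂ] (F ⊗[ℂ] G),
          (∀ v, tensorHom π (tensorHom ρ σ) (algAssoc t) (tripleRight v) = tripleRight (L v)) ∧
          (∀ v, tensorHom (tensorHom π ρ) σ t (tripleLeft v) = tripleLeft (L v))) →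
        (∃ L : E ⊗[ℂ] (F ⊗[ℂ] G) →ₗ[ℂ] E ⊗[ℂ] (F ⊗[ℂ] G),
          (∀ v, tensorHom π (tensorHom ρ σ) (algAssoc s) (tripleRight v) = tripleRight (L v)) ∧
          (∀ v, tensorHom (tensorHom π ρ) σ s (tripleLeft v) = tripleLeft (L v))) →
        (∃ L : E ⊗[ℂ] (F ⊗[ℂ] G) →ₗ[ℂ] E ⊗[ℂ] (F ⊗[ℂ] G),
          (∀ v, tensorHom π (tensorHom ρ σ) (algAssoc (t + s)) (tripleRight v) =
            tripleRight (L v)) ∧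
          (∀ v, tensorHom (tensorHom π ρ) σ (t + s) (tripleLeft v) = tripleLeft (L v))) := by
      rintro t s ⟨L, h1, h2⟩ ⟨M, h3, h4⟩
      refine ⟨L + M, fun v => ?_, fun v => ?_⟩
      · rw [map_add, map_add, _root_.add_apply, h1, h3, LinearMap.add_apply,
          tripleRight_add]
      · rw [map_add, _root_.add_apply, h2, h4, LinearMap.add_apply, tripleLeft_add]
    induction t using TensorProduct.induction_on with
    | zero => exact ⟨0, fun v => by simp [tripleRight_zero],
      fun v => by simp [tripleLeft_zero]⟩
    | add t s ht hs => exact hadd t s ht hs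
    | tmul t z =>
      induction t using TensorProduct.induction_on with
      | zero => exact ⟨0, fun v => by simp [tripleRight_zero],
      fun v => by simp [tripleLeft_zero]⟩
      | add t s ht hs => rw [TensorProduct.add_tmul]; exact hadd _ _ ht hs
      | tmul x y =>
        refine ⟨TensorProduct.map (π x).toLinearMap
          (TensorProduct.map (ρ y).toLinearMap (σ z).toLinearMap), ?_, ?_⟩
        · intro v
          rw [algAssoc_tmul, tensorHom_tmul, tensorHom_tmul]
          induction v using TensorProduct.induction_on with
          | zero => simp [tripleRight_zero]
          | add v w hv hw => simp only [map_add, hv, hw]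
          | tmul e w => simp [tripleRight_tmul]
        · intro v
          rw [tensorHom_tmul, tensorHom_tmul]
          induction v using TensorProduct.induction_on with
          | zero => simp [tripleLeft_zero]
          | add v w hv hw => simp only [map_add, hv, hw]
          | tmul e w =>
            induction w using TensorProduct.induction_on with
            | zero => simp [tripleLeft_zero]
            | add v w hv hw => simp only [TensorProduct.tmul_add, map_add, hv, hw]
            | tmul f g => simp [tripleLeft_tmul]
  obtain ⟨L, h1, h2⟩ := key
  refine ContinuousLinearMap.opNorm_le_bound _ (norm_nonneg _) fun v => ?_
  refine denseRange_tripleRight.induction_on (p := fun v =>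
    ‖tensorHom π (tensorHom ρ σ) (algAssoc t) v‖ ≤ ‖tensorHom (tensorHom π ρ) σ t‖ * ‖v‖) v ?_ ?_
  · exact isClosed_le (tensorHom π (tensorHom ρ σ) (algAssoc t)).continuous.norm
      (continuous_const.mul continuous_norm)
  · intro v
    have h3 := (tensorHom (tensorHom π ρ) σ t).le_opNorm (tripleLeft v)
    rw [h2, LinearIsometry.norm_map, LinearIsometry.norm_map] at h3
    rw [h1, LinearIsometry.norm_map, LinearIsometry.norm_map]
    exact h3

end RepTensor

/-! ### The `C*`-completion defined by a bounded family of representations -/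

section Completion

/-- A unital `*`-representation of a unital complex `*`-algebra on a Hilbert space. -/
structure HilbertRep (X : Type u) [Ring X] [Algebra ℂ X] [StarRing X] : Type (u + 1) where
  space : Type u
  [normed : NormedAddCommGroup space]
  [inner : InnerProductSpace ℂ space]
  [complete : CompleteSpace space]
  hom : X →⋆ₐ[ℂ] (space →L[ℂ] space)

attribute [instance] HilbertRep.normed HilbertRep.inner HilbertRep.complete

/-- A family of `*`-representations that is pointwise bounded in norm. -/
structure RepFamily (X : Type u) [Ring X] [Algebra ℂ X] [StarRing X] : Type (u + 1) where
  carrier : Set (HilbertRep X)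
  bdd : ∀ x, ∃ C : ℝ, ∀ π ∈ carrier, ‖π.hom x‖ ≤ C

namespace RepFamily

variable {X : Type u} [Ring X] [Algebra ℂ X] [StarRing X] (S : RepFamily X)

/-- The `C*`-seminorm `x ↦ sup {‖π x‖ : π ∈ S}`. -/
def seminorm (x : X) : ℝ := ⨆ π : S.carrier, ‖π.1.hom x‖

variable {S}

theorem le_seminorm {π : HilbertRep X} (hπ : π ∈ S.carrier) (x : X) :
    ‖π.hom x‖ ≤ S.seminorm x := by
  obtain ⟨C, hC⟩ := S.bdd x
  exact le_ciSup (f := fun π : S.carrier => ‖π.1.hom x‖)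
    ⟨C, by rintro _ ⟨π, rfl⟩; exact hC π.1 π.2⟩ ⟨π, hπ⟩

theorem seminorm_le {x : X} {c : ℝ} (hc : 0 ≤ c) (h : ∀ π ∈ S.carrier, ‖π.hom x‖ ≤ c) :
    S.seminorm x ≤ c :=
  Real.iSup_le (fun π => h π.1 π.2) hc

theorem seminorm_nonneg (x : X) : 0 ≤ S.seminorm x :=
  Real.iSup_nonneg fun _ => norm_nonneg _

theorem seminorm_mul_le (x y : X) : S.seminorm (x * y) ≤ S.seminorm x * S.seminorm y := by
  refine seminorm_le (mul_nonneg (seminorm_nonneg x) (seminorm_nonneg y)) fun π hπ => ?_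
  rw [map_mul]
  exact (norm_mul_le _ _).trans
    (mul_le_mul (le_seminorm hπ x) (le_seminorm hπ y) (norm_nonneg _) (seminorm_nonneg x))

theorem seminorm_star (x : X) : S.seminorm (star x) = S.seminorm x := by
  unfold seminorm
  congr 1
  ext π
  rw [map_star, norm_star]

theorem seminorm_sq_le (x : X) : S.seminorm x * S.seminorm x ≤ S.seminorm (star x * x) := by
  have h : S.seminorm x ≤ √(S.seminorm (star x * x)) := by
    refine seminorm_le (Real.sqrt_nonneg _) fun π hπ => Real.le_sqrt_of_sq_le ?_
    have h1 := le_seminorm hπ (star x * x)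
    rwa [map_mul, map_star, CStarRing.norm_star_mul_self, ← sq] at h1
  calc S.seminorm x * S.seminorm x ≤ √(S.seminorm (star x * x)) * √(S.seminorm (star x * x)) :=
        mul_self_le_mul_self (seminorm_nonneg x) h
    _ = _ := Real.mul_self_sqrt (seminorm_nonneg _)

variable (S)

/-- A copy of `X`, carrying the seminorm given by `S`. -/
def Pre (_S : RepFamily X) : Type u := X

instance : Ring S.Pre := inferInstanceAs (Ring X)
instance : Algebra ℂ S.Pre := inferInstanceAs (Algebra ℂ X)
instance : StarRing S.Pre := inferInstanceAs (StarRing X)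
instance [StarModule ℂ X] : StarModule ℂ S.Pre := inferInstanceAs (StarModule ℂ X)

/-- The seminorm on the copy of `X`, in bundled form. -/
def preSeminorm : AddGroupSeminorm S.Pre where
  toFun x := S.seminorm (X := X) x
  map_zero' := le_antisymm
    (seminorm_le le_rfl fun π _ => le_of_eq (by
      rw [show π.hom (0 : S.Pre) = 0 from map_zero π.hom, norm_zero]))
    (seminorm_nonneg _)
  add_le' x y := seminorm_le (add_nonneg (seminorm_nonneg _) (seminorm_nonneg _)) fun π hπ => by
    rw [show π.hom (x + y : S.Pre) = π.hom x + π.hom y from map_add π.hom _ _]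
    exact (norm_add_le _ _).trans (add_le_add (le_seminorm hπ _) (le_seminorm hπ _))
  neg' x := by
    unfold seminorm
    congr 1
    ext π
    rw [show π.1.hom (-x : S.Pre) = -π.1.hom x from map_neg π.1.hom _, norm_neg]

instance : SeminormedRing S.Pre where
  __ := (inferInstance : Ring S.Pre)
  __ := S.preSeminorm.toSeminormedAddCommGroup
  norm_mul_le := seminorm_mul_le (S := S)

theorem norm_pre (x : S.Pre) : ‖x‖ = S.seminorm (X := X) x := rfl

instance : NormedAlgebra ℂ S.Pre where
  norm_smul_le r x := by
    rw [norm_pre, norm_pre]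
    refine seminorm_le (mul_nonneg (norm_nonneg _) (seminorm_nonneg _)) fun π hπ => ?_
    rw [show π.hom (r • x : S.Pre) = r • π.hom x from map_smul π.hom _ _, norm_smul]
    exact mul_le_mul_of_nonneg_left (le_seminorm hπ _) (norm_nonneg _)

instance : NormedStarGroup S.Pre where
  norm_star_le x := (seminorm_star (S := S) (X := X) x).le

/-- The (Hausdorff) completion of `X` with respect to the seminorm given by `S`. -/
def Completion (S : RepFamily X) : Type u := UniformSpace.Completion S.Pre

instance : NormedRing S.Completion :=
  inferInstanceAs (NormedRing (UniformSpace.Completion S.Pre))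

instance : CompleteSpace S.Completion :=
  inferInstanceAs (CompleteSpace (UniformSpace.Completion S.Pre))

instance : T2Space S.Completion :=
  inferInstanceAs (T2Space (UniformSpace.Completion S.Pre))

instance : Algebra ℂ S.Completion :=
  inferInstanceAs (Algebra ℂ (UniformSpace.Completion S.Pre))

instance : NormedAlgebra ℂ S.Completion where
  norm_smul_le r x := norm_smul_le (β := UniformSpace.Completion S.Pre) r x

/-- The canonical map from `X` to its completion, as an algebra homomorphism. -/
def ofAlgHom : X →ₐ[ℂ] S.Completion where
  toFun x := UniformSpace.Completion.coe' (α := S.Pre) x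
  map_one' := UniformSpace.Completion.coe_one S.Pre
  map_mul' x y := UniformSpace.Completion.coe_mul (α := S.Pre) x y
  map_zero' := UniformSpace.Completion.coe_zero (α := S.Pre)
  map_add' x y := UniformSpace.Completion.coe_add (α := S.Pre) x y
  commutes' _ := rfl

theorem norm_ofAlgHom (x : X) : ‖S.ofAlgHom x‖ = S.seminorm x :=
  UniformSpace.Completion.norm_coe (E := S.Pre) x

theorem denseRange_ofAlgHom : DenseRange S.ofAlgHom :=
  UniformSpace.Completion.denseRange_coe (α := S.Pre)

/-- The involution on the completion. -/
def starFun : S.Completion → S.Completion :=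
  UniformSpace.Completion.map (star : S.Pre → S.Pre)

theorem continuous_starFun : Continuous S.starFun :=
  UniformSpace.Completion.continuous_map

theorem starFun_of (x : X) : S.starFun (S.ofAlgHom x) = S.ofAlgHom (star x) :=
  UniformSpace.Completion.map_coe
    (starNormedAddGroupHom : NormedAddGroupHom S.Pre S.Pre).uniformContinuous x

instance : StarRing S.Completion where
  star := S.starFun
  star_involutive x := by
    refine S.denseRange_ofAlgHom.induction_on x
      (isClosed_eq (S.continuous_starFun.comp S.continuous_starFun) continuous_id) fun x => ?_
    rw [starFun_of, starFun_of, star_star]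
  star_mul x y := by
    change S.starFun (x * y) = S.starFun y * S.starFun x
    have := S.continuous_starFun
    refine S.denseRange_ofAlgHom.induction_on₂ (p := fun x y =>
      S.starFun (x * y) = S.starFun y * S.starFun x)
      (isClosed_eq (by fun_prop) (by fun_prop)) (fun x y => ?_) x y
    rw [← map_mul, starFun_of, starFun_of, starFun_of, star_mul, map_mul]
  star_add x y := by
    change S.starFun (x + y) = S.starFun x + S.starFun y
    have := S.continuous_starFun
    refine S.denseRange_ofAlgHom.induction_on₂ (p := fun x y =>
      S.starFun (x + y) = S.starFun x + S.starFun y)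
      (isClosed_eq (by fun_prop) (by fun_prop)) (fun x y => ?_) x y
    rw [← map_add, starFun_of, starFun_of, starFun_of, star_add, map_add]

variable [StarModule ℂ X]

instance : StarModule ℂ S.Completion where
  star_smul r x := by
    change S.starFun (r • x) = star r • S.starFun x
    refine S.denseRange_ofAlgHom.induction_on (p := fun x =>
      S.starFun (r • x) = star r • S.starFun x) x
      (isClosed_eq (S.continuous_starFun.comp (continuous_const_smul r))
        (S.continuous_starFun.const_smul (star r))) fun x => ?_
    rw [← map_smul, starFun_of, starFun_of, star_smul, map_smul]

instance : CStarRing S.Completion where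
  norm_mul_self_le x := by
    change ‖x‖ * ‖x‖ ≤ ‖S.starFun x * x‖
    have := S.continuous_starFun
    refine S.denseRange_ofAlgHom.induction_on x
      (isClosed_le (by fun_prop) (by fun_prop)) fun x => ?_
    rw [starFun_of, ← map_mul, norm_ofAlgHom, norm_ofAlgHom]
    exact seminorm_sq_le x

/-- The completion is a unital `C*`-algebra. -/
instance : CStarAlgebra S.Completion where

/-- The canonical `*`-homomorphism from `X` to its completion. -/
def of : X →⋆ₐ[ℂ] S.Completion :=
  { S.ofAlgHom with map_star' := fun x => (S.starFun_of x).symm }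

theorem norm_of (x : X) : ‖S.of x‖ = S.seminorm x := S.norm_ofAlgHom x

theorem denseRange_of : DenseRange S.of := S.denseRange_ofAlgHom

variable {S} {B : Type u} [CStarAlgebra B]

/-- The underlying function of the continuous extension of a bounded `*`-homomorphism. -/
def extend (f : X →⋆ₐ[ℂ] B) : S.Completion → B :=
  UniformSpace.Completion.extension (α := S.Pre) (β := B) f

theorem continuous_extend (f : X →⋆ₐ[ℂ] B) : Continuous (extend (S := S) f) :=
  UniformSpace.Completion.continuous_extension

theorem extend_of (f : X →⋆ₐ[ℂ] B) (hf : ∀ x, ‖f x‖ ≤ S.seminorm x) (x : X) :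
    extend f (S.of x) = f x := by
  refine UniformSpace.Completion.extension_coe (α := S.Pre) ?_ x
  let g : S.Pre →ₗ[ℂ] B := f.toAlgHom.toLinearMap
  exact (g.mkContinuous 1 fun x => by rw [one_mul]; exact hf x).uniformContinuous

/-- A `*`-homomorphism into a `C*`-algebra that is bounded by the seminorm extends to the
completion. -/
def lift (f : X →⋆ₐ[ℂ] B) (hf : ∀ x, ‖f x‖ ≤ S.seminorm x) : S.Completion →⋆ₐ[ℂ] B where
  toFun := extend f
  map_one' := by rw [← map_one S.of, extend_of f hf, map_one]
  map_zero' := by rw [← map_zero S.of, extend_of f hf, map_zero]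
  map_mul' x y := by
    have := continuous_extend (S := S) f
    refine S.denseRange_of.induction_on₂ (p := fun x y =>
      extend f (x * y) = extend f x * extend f y)
      (isClosed_eq (by fun_prop) (by fun_prop)) (fun x y => ?_) x y
    rw [← map_mul, extend_of f hf, extend_of f hf, extend_of f hf, map_mul]
  map_add' x y := by
    have := continuous_extend (S := S) f
    refine S.denseRange_of.induction_on₂ (p := fun x y =>
      extend f (x + y) = extend f x + extend f y)
      (isClosed_eq (by fun_prop) (by fun_prop)) (fun x y => ?_) x y
    rw [← map_add, extend_of f hf, extend_of f hf, extend_of f hf, map_add]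
  commutes' r := by
    have h : S.of (algebraMap ℂ X r) = algebraMap ℂ S.Completion r := AlgHomClass.commutes S.of r
    rw [← h, extend_of f hf]
    exact AlgHomClass.commutes f r
  map_star' x := by
    have := continuous_extend (S := S) f
    have h2 : Continuous (star : S.Completion → S.Completion) := continuous_star
    refine S.denseRange_of.induction_on x
      (isClosed_eq (by fun_prop) (by fun_prop)) fun x => ?_
    rw [← map_star, extend_of f hf, extend_of f hf, map_star]

@[simp]
theorem lift_of (f : X →⋆ₐ[ℂ] B) (hf : ∀ x, ‖f x‖ ≤ S.seminorm x) (x : X) :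
    lift f hf (S.of x) = f x := extend_of f hf x

/-- The extension to the completion of a member of the family. -/
def liftRep {π : HilbertRep X} (hπ : π ∈ S.carrier) :
    S.Completion →⋆ₐ[ℂ] (π.space →L[ℂ] π.space) :=
  lift π.hom (le_seminorm hπ)

theorem norm_le_of_liftRep {z : S.Completion} {c : ℝ} (hc : 0 ≤ c)
    (h : ∀ π, ∀ hπ : π ∈ S.carrier, ‖liftRep hπ z‖ ≤ c) : ‖z‖ ≤ c := by
  refine le_of_forall_pos_le_add fun ε hε => ?_
  obtain ⟨x, hx⟩ := S.denseRange_of.exists_dist_lt z (half_pos hε)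
  rw [dist_eq_norm] at hx
  have h1 : S.seminorm x ≤ c + ε / 2 := by
    refine seminorm_le (by positivity) fun π hπ => ?_
    have h2 : π.hom x = liftRep hπ z - liftRep hπ (z - S.of x) := by
      rw [map_sub, sub_sub_cancel]
      exact (lift_of _ _ x).symm
    rw [h2]
    refine (norm_sub_le _ _).trans (add_le_add (h π hπ) ?_)
    exact (NonUnitalStarAlgHom.norm_apply_le (liftRep hπ) _).trans hx.le
  calc ‖z‖ = ‖(z - S.of x) + S.of x‖ := by rw [sub_add_cancel]
    _ ≤ ‖z - S.of x‖ + ‖S.of x‖ := norm_add_le _ _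
    _ ≤ ε / 2 + (c + ε / 2) := add_le_add hx.le (by rw [norm_of]; exact h1)
    _ = c + ε := by ring

theorem continuous_starHom {A B : Type u} [CStarAlgebra A] [CStarAlgebra B] (f : A →⋆ₐ[ℂ] B) :
    Continuous f :=
  AddMonoidHomClass.continuous_of_bound f 1 fun x => by
    rw [one_mul]; exact NonUnitalStarAlgHom.norm_apply_le f x

theorem starHom_ext {f g : S.Completion →⋆ₐ[ℂ] B} (h : ∀ x, f (S.of x) = g (S.of x)) : f = g := by
  ext z
  exact S.denseRange_of.induction_on (p := fun z => f z = g z) z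
    (isClosed_eq (continuous_starHom f) (continuous_starHom g)) h

end RepFamily

end Completion

/-! ### Minimal tensor products of `C*`-algebras -/

section MinTensor

section Families

variable {X Y : Type u} [Ring X] [Algebra ℂ X] [StarRing X] [StarModule ℂ X]
  [Ring Y] [Algebra ℂ Y] [StarRing Y] [StarModule ℂ Y]

/-- Pull back a representation along a `*`-homomorphism. -/
def HilbertRep.comp (π : HilbertRep Y) (f : X →⋆ₐ[ℂ] Y) : HilbertRep X where
  space := π.space
  hom := π.hom.comp f

/-- The tensor product of two representations. -/
def HilbertRep.tensor (π : HilbertRep X) (ρ : HilbertRep Y) : HilbertRep (X ⊗[ℂ] Y) where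
  space := HilbertTensor π.space ρ.space
  hom := tensorHom π.hom ρ.hom

/-- The family of all representations of a `C*`-algebra. -/
def RepFamily.all (A : Type u) [CStarAlgebra A] : RepFamily A where
  carrier := Set.univ
  bdd a := ⟨‖a‖, fun π _ => NonUnitalStarAlgHom.norm_apply_le π.hom a⟩

/-- The family of all tensor products `π ⊗ ρ` with `π ∈ S` and `ρ ∈ T`. -/
def RepFamily.tensor (S : RepFamily X) (T : RepFamily Y) : RepFamily (X ⊗[ℂ] Y) where
  carrier := {τ | ∃ π ∈ S.carrier, ∃ ρ ∈ T.carrier, τ = π.tensor ρ}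
  bdd t := by
    have h : ∃ C : ℝ, ∀ π ∈ S.carrier, ∀ ρ ∈ T.carrier, ‖tensorHom π.hom ρ.hom t‖ ≤ C := by
      induction t using TensorProduct.induction_on with
      | zero => exact ⟨0, fun π _ ρ _ => by simp⟩
      | add s t hs ht =>
        obtain ⟨C, hC⟩ := hs
        obtain ⟨D, hD⟩ := ht
        refine ⟨C + D, fun π hπ ρ hρ => ?_⟩
        rw [map_add]
        exact (norm_add_le _ _).trans (add_le_add (hC π hπ ρ hρ) (hD π hπ ρ hρ))
      | tmul x y =>
        obtain ⟨C, hC⟩ := S.bdd x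
        obtain ⟨D, hD⟩ := T.bdd y
        refine ⟨C * D, fun π hπ ρ hρ => ?_⟩
        rw [tensorHom_tmul]
        exact (opTensor_norm_le _ _).trans (mul_le_mul (hC π hπ) (hD ρ hρ) (norm_nonneg _)
          ((norm_nonneg _).trans (hC π hπ)))
    obtain ⟨C, hC⟩ := h
    exact ⟨C, by rintro _ ⟨π, hπ, ρ, hρ, rfl⟩; exact hC π hπ ρ hρ⟩

theorem RepFamily.le_tensor {S : RepFamily X} {T : RepFamily Y} {π : HilbertRep X}
    {ρ : HilbertRep Y} (hπ : π ∈ S.carrier) (hρ : ρ ∈ T.carrier) (t : X ⊗[ℂ] Y) :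
    ‖tensorHom π.hom ρ.hom t‖ ≤ (S.tensor T).seminorm t :=
  le_seminorm (S := S.tensor T) (π := π.tensor ρ) ⟨π, hπ, ρ, hρ, rfl⟩ t

/-- The `*`-homomorphism `x ⊗ y ↦ f x * g y` given by a commuting pair `f`, `g`. -/
def algLift {D : Type u} [CStarAlgebra D] (f : X →⋆ₐ[ℂ] D) (g : Y →⋆ₐ[ℂ] D)
    (h : ∀ x y, Commute (f x) (g y)) : X ⊗[ℂ] Y →⋆ₐ[ℂ] D :=
  { Algebra.TensorProduct.lift f.toAlgHom g.toAlgHom h with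
    map_star' := fun t => by
      change Algebra.TensorProduct.lift f.toAlgHom g.toAlgHom h (star t) =
        star (Algebra.TensorProduct.lift f.toAlgHom g.toAlgHom h t)
      induction t using TensorProduct.induction_on with
      | zero => simp
      | add x y hx hy => simp only [star_add, map_add, hx, hy]
      | tmul x y =>
        rw [TensorProduct.star_tmul, Algebra.TensorProduct.lift_tmul,
          Algebra.TensorProduct.lift_tmul]
        change f (star x) * g (star y) = star (f x * g y)
        rw [map_star, map_star, star_mul, ← star_mul, ← star_mul, (h x y).eq] }

@[simp]
theorem algLift_tmul {D : Type u} [CStarAlgebra D] (f : X →⋆ₐ[ℂ] D) (g : Y →⋆ₐ[ℂ] D)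
    (h : ∀ x y, Commute (f x) (g y)) (x : X) (y : Y) :
    algLift f g h (x ⊗ₜ y) = f x * g y :=
  Algebra.TensorProduct.lift_tmul f.toAlgHom g.toAlgHom h x y

theorem algHom_ext {D : Type u} [CStarAlgebra D] {f g : X ⊗[ℂ] Y →⋆ₐ[ℂ] D}
    (h : ∀ x y, f (x ⊗ₜ y) = g (x ⊗ₜ y)) : f = g := by
  ext t
  induction t using TensorProduct.induction_on with
  | zero => simp only [map_zero]
  | add x y hx hy => rw [map_add, map_add, hx, hy]
  | tmul x y => exact h x y

/-- A norm inequality between two representations of `S.Completion ⊗ Y` can be checked on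
`X ⊗ Y`. -/
theorem norm_le_of_dense {S : RepFamily X} {D D' : Type u} [CStarAlgebra D] [CStarAlgebra D']
    (P : S.Completion ⊗[ℂ] Y →⋆ₐ[ℂ] D) (Q : S.Completion ⊗[ℂ] Y →⋆ₐ[ℂ] D')
    (h : ∀ t : X ⊗[ℂ] Y, ‖P (algMap S.of (StarAlgHom.id ℂ Y) t)‖ ≤
      ‖Q (algMap S.of (StarAlgHom.id ℂ Y) t)‖) (x : S.Completion ⊗[ℂ] Y) : ‖P x‖ ≤ ‖Q x‖ := by
  let L : X ⊗[ℂ] Y →ₗ[ℂ] D × D' :=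
    (P.toAlgHom.toLinearMap.prod Q.toAlgHom.toLinearMap).comp
      (algMap S.of (StarAlgHom.id ℂ Y)).toAlgHom.toLinearMap
  have hx : (P x, Q x) ∈ (LinearMap.range L).topologicalClosure := by
    induction x using TensorProduct.induction_on with
    | zero => rw [map_zero, map_zero]; exact Submodule.zero_mem _
    | add x y hx hy =>
      rw [map_add, map_add, ← Prod.mk_add_mk]
      exact Submodule.add_mem _ hx hy
    | tmul z y =>
      refine S.denseRange_of.induction_on (p := fun z =>
        (P (z ⊗ₜ y), Q (z ⊗ₜ y)) ∈ (LinearMap.range L).topologicalClosure) z ?_ ?_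
      · have h1 : ∀ z : S.Completion, (z ⊗ₜ[ℂ] y : S.Completion ⊗[ℂ] Y) =
            algLeft z * (1 ⊗ₜ y) := fun z => by simp
        have hP : Continuous fun z : S.Completion => P (z ⊗ₜ y) := by
          have h2 : (fun z : S.Completion => P (z ⊗ₜ y)) =
              fun z => P.comp algLeft z * P (1 ⊗ₜ y) :=
            funext fun z => by rw [h1 z, map_mul]; rfl
          rw [h2]
          exact (RepFamily.continuous_starHom (P.comp algLeft)).mul continuous_const
        have hQ : Continuous fun z : S.Completion => Q (z ⊗ₜ y) := by
          have h2 : (fun z : S.Completion => Q (z ⊗ₜ y)) =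
              fun z => Q.comp algLeft z * Q (1 ⊗ₜ y) :=
            funext fun z => by rw [h1 z, map_mul]; rfl
          rw [h2]
          exact (RepFamily.continuous_starHom (Q.comp algLeft)).mul continuous_const
        exact (Submodule.isClosed_topologicalClosure _).preimage (hP.prodMk hQ)
      · intro x
        exact Submodule.le_topologicalClosure _ ⟨x ⊗ₜ y, rfl⟩
  have hc : IsClosed {p : D × D' | ‖p.1‖ ≤ ‖p.2‖} :=
    isClosed_le continuous_fst.norm continuous_snd.norm
  refine closure_minimal (s := (LinearMap.range L : Set (D × D'))) ?_ hc hx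
  rintro _ ⟨t, rfl⟩
  exact h t

end Families

variable (A B C : Type u) [CStarAlgebra A] [CStarAlgebra B] [CStarAlgebra C]

/-- The minimal (spatial) tensor product `A ⊗ B`: the completion of the algebraic tensor product
with respect to the norm `x ↦ sup ‖(π ⊗ ρ) x‖` over all pairs of representations of `A`
and `B` on Hilbert spaces. -/
abbrev MinTensor : Type u := ((RepFamily.all A).tensor (RepFamily.all B)).Completion

/-- The minimal (spatial) tensor product `A ⊗ B ⊗ C` of three `C*`-algebras. -/
abbrev MinTensor₃ : Type u :=
  ((RepFamily.all A).tensor ((RepFamily.all B).tensor (RepFamily.all C))).Completion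

variable {A B C}
variable {A' B' : Type u} [CStarAlgebra A'] [CStarAlgebra B']

namespace MinTensor

/-- The canonical map from the algebraic to the minimal tensor product. -/
def of : A ⊗[ℂ] B →⋆ₐ[ℂ] MinTensor A B := RepFamily.of _

/-- The elementary tensor `a ⊗ b` in the minimal tensor product. -/
def tmul (a : A) (b : B) : MinTensor A B := of (a ⊗ₜ b)

/-- The embedding `a ↦ a ⊗ 1`. -/
def inclLeft : A →⋆ₐ[ℂ] MinTensor A B := of.comp algLeft

/-- The embedding `b ↦ 1 ⊗ b`. -/
def inclRight : B →⋆ₐ[ℂ] MinTensor A B := of.comp algRight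

/-- The tensor product `f ⊗ g : A ⊗ B → A' ⊗ B'` of two `*`-homomorphisms. -/
def map (f : A →⋆ₐ[ℂ] A') (g : B →⋆ₐ[ℂ] B') : MinTensor A B →⋆ₐ[ℂ] MinTensor A' B' :=
  RepFamily.lift (of.comp (algMap f g)) fun t => by
    refine (RepFamily.norm_of _ _).le.trans
      (RepFamily.seminorm_le (RepFamily.seminorm_nonneg _) ?_)
    rintro _ ⟨π, -, ρ, -, rfl⟩
    change ‖tensorHom π.hom ρ.hom (algMap f g t)‖ ≤ _
    rw [tensorHom_algMap]
    exact RepFamily.le_tensor (S := RepFamily.all _) (T := RepFamily.all _) (π := π.comp f) (ρ := ρ.comp g) trivial trivial t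

theorem map_tmul (f : A →⋆ₐ[ℂ] A') (g : B →⋆ₐ[ℂ] B') (a : A) (b : B) :
    map f g (tmul a b) = tmul (f a) (g b) :=
  RepFamily.lift_of _ _ _

end MinTensor

namespace MinTensor₃

/-- The canonical map from the algebraic to the minimal tensor product. -/
def of : A ⊗[ℂ] (B ⊗[ℂ] C) →⋆ₐ[ℂ] MinTensor₃ A B C := RepFamily.of _

/-- The elementary tensor `a ⊗ b ⊗ c`. -/
def tmul (a : A) (b : B) (c : C) : MinTensor₃ A B C := of (a ⊗ₜ (b ⊗ₜ c))

/-- The embedding `y ↦ 1 ⊗ y` of `B ⊗ C`. -/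
def inclRight : MinTensor B C →⋆ₐ[ℂ] MinTensor₃ A B C :=
  RepFamily.lift (of.comp algRight) fun t => by
    refine (RepFamily.norm_of _ _).le.trans
      (RepFamily.seminorm_le (RepFamily.seminorm_nonneg _) ?_)
    rintro _ ⟨π, -, τ, hτ, rfl⟩
    change ‖tensorHom π.hom τ.hom (algRight t)‖ ≤ _
    rw [algRight_apply, tensorHom_tmul, map_one]
    refine (opTensor_norm_le _ _).trans ?_
    calc ‖(1 : π.space →L[ℂ] π.space)‖ * ‖τ.hom t‖ ≤ 1 * ‖τ.hom t‖ :=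
          mul_le_mul_of_nonneg_right ContinuousLinearMap.norm_id_le (norm_nonneg _)
      _ = ‖τ.hom t‖ := one_mul _
      _ ≤ _ := RepFamily.le_seminorm hτ t

/-- The embedding `y ↦ y ⊗ 1` of `A ⊗ B`. -/
def inclLeft : MinTensor A B →⋆ₐ[ℂ] MinTensor₃ A B C :=
  RepFamily.lift (of.comp (algAssoc.comp algLeft)) fun t => by
    refine (RepFamily.norm_of _ _).le.trans
      (RepFamily.seminorm_le (RepFamily.seminorm_nonneg _) ?_)
    rintro _ ⟨π, -, _, ⟨ρ, -, σ, -, rfl⟩, rfl⟩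
    change ‖tensorHom π.hom (tensorHom ρ.hom σ.hom) (algAssoc (algLeft t))‖ ≤ _
    refine (norm_tensorHom_assoc_le _ _ _ _).trans ?_
    rw [algLeft_apply, tensorHom_tmul, map_one]
    refine (opTensor_norm_le _ _).trans ?_
    calc ‖tensorHom π.hom ρ.hom t‖ * ‖(1 : σ.space →L[ℂ] σ.space)‖
        ≤ ‖tensorHom π.hom ρ.hom t‖ * 1 :=
          mul_le_mul_of_nonneg_left ContinuousLinearMap.norm_id_le (norm_nonneg _)
      _ = ‖tensorHom π.hom ρ.hom t‖ := mul_one _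
      _ ≤ _ := RepFamily.le_tensor (S := RepFamily.all _) (T := RepFamily.all _) (π := π) (ρ := ρ) trivial trivial t

theorem inclRight_of (t : B ⊗[ℂ] C) :
    (inclRight (MinTensor.of t) : MinTensor₃ A B C) = of (1 ⊗ₜ t) :=
  RepFamily.lift_of _ _ _

theorem inclLeft_of (t : A ⊗[ℂ] B) :
    (inclLeft (MinTensor.of t) : MinTensor₃ A B C) = of (algAssoc (t ⊗ₜ 1)) :=
  RepFamily.lift_of _ _ _

/-- The embedding `a ↦ a ⊗ 1 ⊗ 1`. -/
def inclFirst : A →⋆ₐ[ℂ] MinTensor₃ A B C := of.comp algLeft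

/-- The embedding `c ↦ 1 ⊗ 1 ⊗ c`. -/
def inclThird : C →⋆ₐ[ℂ] MinTensor₃ A B C := of.comp (algRight.comp algRight)

theorem inclFirst_apply (a : A) : (inclFirst a : MinTensor₃ A B C) = of (a ⊗ₜ 1) := rfl

theorem inclThird_apply (c : C) : (inclThird c : MinTensor₃ A B C) = of (algAssoc (1 ⊗ₜ c)) := rfl

theorem commute_right (a : A) (z : MinTensor B C) :
    Commute (inclFirst a : MinTensor₃ A B C) (inclRight z) := by
  refine (RepFamily.denseRange_of _).induction_on (p := fun z =>
    Commute (inclFirst a : MinTensor₃ A B C) (inclRight z)) z ?_ fun t => ?_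
  · have h := RepFamily.continuous_starHom (inclRight (A := A) (B := B) (C := C))
    exact isClosed_eq (continuous_const.mul h) (h.mul continuous_const)
  · change Commute _ (inclRight (MinTensor.of t))
    rw [inclRight_of, inclFirst_apply, Commute, SemiconjBy, ← map_mul, ← map_mul]
    simp

theorem commute_left (z : MinTensor A B) (c : C) :
    Commute (inclLeft z : MinTensor₃ A B C) (inclThird c) := by
  refine (RepFamily.denseRange_of _).induction_on (p := fun z =>
    Commute (inclLeft z : MinTensor₃ A B C) (inclThird c)) z ?_ fun t => ?_
  · have h := RepFamily.continuous_starHom (inclLeft (A := A) (B := B) (C := C))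
    exact isClosed_eq (h.mul continuous_const) (continuous_const.mul h)
  · change Commute (inclLeft (MinTensor.of t)) _
    rw [inclLeft_of, inclThird_apply, Commute, SemiconjBy, ← map_mul, ← map_mul, ← map_mul,
      ← map_mul]
    simp

/-- The identification `A ⊗ (B ⊗ C) → A ⊗ B ⊗ C` before the outer completion. -/
def preRight : A ⊗[ℂ] MinTensor B C →⋆ₐ[ℂ] MinTensor₃ A B C :=
  algLift inclFirst inclRight commute_right

theorem preRight_tmul (a : A) (z : MinTensor B C) :
    (preRight (a ⊗ₜ z) : MinTensor₃ A B C) = inclFirst a * inclRight z :=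
  algLift_tmul _ _ _ a z

theorem preRight_of (a : A) (t : B ⊗[ℂ] C) :
    (preRight (a ⊗ₜ MinTensor.of t) : MinTensor₃ A B C) = of (a ⊗ₜ t) := by
  rw [preRight_tmul, inclRight_of, inclFirst_apply, ← map_mul]
  simp

/-- The identification `(A ⊗ B) ⊗ C → A ⊗ B ⊗ C` before the outer completion. -/
def preLeft : MinTensor A B ⊗[ℂ] C →⋆ₐ[ℂ] MinTensor₃ A B C :=
  algLift inclLeft inclThird commute_left

theorem preLeft_tmul (z : MinTensor A B) (c : C) :
    (preLeft (z ⊗ₜ c) : MinTensor₃ A B C) = inclLeft z * inclThird c :=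
  algLift_tmul _ _ _ z c

theorem preLeft_of (t : A ⊗[ℂ] B) (c : C) :
    (preLeft (MinTensor.of t ⊗ₜ c) : MinTensor₃ A B C) = of (algAssoc (t ⊗ₜ c)) := by
  rw [preLeft_tmul, inclLeft_of, inclThird_apply, ← map_mul, ← map_mul]
  simp

/-- The canonical identification `A ⊗ (B ⊗ C) → A ⊗ B ⊗ C`. -/
def assocRight : MinTensor A (MinTensor B C) →⋆ₐ[ℂ] MinTensor₃ A B C :=
  RepFamily.lift preRight fun x => by
    refine RepFamily.norm_le_of_liftRep (RepFamily.seminorm_nonneg _) ?_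
    intro τ hτ
    obtain ⟨π, -, κ, hκ, rfl⟩ := id hτ
    let P : A ⊗[ℂ] MinTensor B C →⋆ₐ[ℂ]
        (HilbertTensor π.space κ.space →L[ℂ] HilbertTensor π.space κ.space) :=
      (RepFamily.liftRep hτ).comp preRight
    let κ' : HilbertRep (MinTensor B C) := ⟨κ.space, RepFamily.liftRep hκ⟩
    have hPt : ∀ t : A ⊗[ℂ] (B ⊗[ℂ] C),
        RepFamily.liftRep hτ (of t) = tensorHom π.hom κ.hom t :=
      fun t => RepFamily.lift_of _ _ _
    have hκ' : ∀ t : B ⊗[ℂ] C, κ'.hom (MinTensor.of t) = κ.hom t :=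
      fun t => RepFamily.lift_of κ.hom (RepFamily.le_seminorm hκ) t
    have h1 : ∀ (a : A) (t : B ⊗[ℂ] C), tensorHom π.hom κ.hom (a ⊗ₜ t) =
        tensorHom π.hom κ'.hom (a ⊗ₜ MinTensor.of t) := fun a t => by
      rw [tensorHom_tmul, tensorHom_tmul, hκ']
    have h2 : ∀ (a : A) (t : B ⊗[ℂ] C), P (a ⊗ₜ MinTensor.of t) =
        tensorHom π.hom κ'.hom (a ⊗ₜ MinTensor.of t) := fun a t =>
      ((congrArg (RepFamily.liftRep hτ) (preRight_of a t)).trans (hPt _)).trans (h1 a t)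
    have hR : P.comp algRight = (tensorHom π.hom κ'.hom).comp algRight :=
      RepFamily.starHom_ext fun t => h2 1 t
    have hL : ∀ a : A, P (a ⊗ₜ 1) = tensorHom π.hom κ'.hom (a ⊗ₜ 1) := fun a => by
      rw [← map_one MinTensor.of]
      exact h2 a 1
    have hP : P = tensorHom π.hom κ'.hom := by
      refine algHom_ext fun a z => ?_
      have h1 : (a ⊗ₜ[ℂ] z : A ⊗[ℂ] MinTensor B C) = (a ⊗ₜ 1) * (1 ⊗ₜ z) := by simp
      rw [h1, map_mul, map_mul, hL]
      congr 1
      exact DFunLike.congr_fun hR z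
    change ‖P x‖ ≤ _
    rw [hP]
    exact RepFamily.le_tensor (S := RepFamily.all _) (T := RepFamily.all _) (π := π) (ρ := κ')
      trivial trivial x

/-- The canonical identification `(A ⊗ B) ⊗ C → A ⊗ B ⊗ C`. -/
def assocLeft : MinTensor (MinTensor A B) C →⋆ₐ[ℂ] MinTensor₃ A B C :=
  RepFamily.lift preLeft fun x => by
    refine RepFamily.norm_le_of_liftRep (RepFamily.seminorm_nonneg _) ?_
    intro τ hτ
    obtain ⟨π, hπ, _, ⟨ρ, hρ, σ, hσ, rfl⟩, rfl⟩ := id hτ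
    have hκ : π.tensor ρ ∈ ((RepFamily.all A).tensor (RepFamily.all B)).carrier :=
      ⟨π, hπ, ρ, hρ, rfl⟩
    let κ : HilbertRep (MinTensor A B) :=
      ⟨HilbertTensor π.space ρ.space, RepFamily.liftRep hκ⟩
    refine le_trans ?_ (RepFamily.le_tensor (S := RepFamily.all _) (T := RepFamily.all _)
      (π := κ) (ρ := σ) trivial trivial x)
    refine norm_le_of_dense ((RepFamily.liftRep hτ).comp preLeft)
      (tensorHom κ.hom σ.hom) (fun t => ?_) x
    have h1 : preLeft.comp (algMap MinTensor.of (StarAlgHom.id ℂ C)) =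
        (of : A ⊗[ℂ] (B ⊗[ℂ] C) →⋆ₐ[ℂ] _).comp algAssoc :=
      algHom_ext fun s c => preLeft_of s c
    have h2 : κ.hom.comp MinTensor.of = tensorHom π.hom ρ.hom :=
      StarAlgHom.ext fun s => RepFamily.lift_of (π.tensor ρ).hom
        (RepFamily.le_seminorm hκ) s
    have h3 : RepFamily.liftRep hτ (of (algAssoc t)) =
        tensorHom π.hom (tensorHom ρ.hom σ.hom) (algAssoc t) := RepFamily.lift_of _ _ _
    have h4 : (RepFamily.liftRep hτ).comp preLeft
          (algMap MinTensor.of (StarAlgHom.id ℂ C) t) =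
        tensorHom π.hom (tensorHom ρ.hom σ.hom) (algAssoc t) :=
      (congrArg (RepFamily.liftRep hτ) (DFunLike.congr_fun h1 t)).trans h3
    have h5 : tensorHom κ.hom σ.hom (algMap MinTensor.of (StarAlgHom.id ℂ C) t) =
        tensorHom (tensorHom π.hom ρ.hom) σ.hom t := by
      rw [tensorHom_algMap, h2]
      rfl
    exact (congrArg norm h4).le.trans
      ((norm_tensorHom_assoc_le _ _ _ _).trans (congrArg norm h5).ge)

theorem assocRight_tmul (a : A) (b : B) (c : C) :
    assocRight (MinTensor.tmul a (MinTensor.tmul b c)) = tmul a b c :=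
  (RepFamily.lift_of _ _ _).trans (preRight_of a (b ⊗ₜ c))

theorem assocLeft_tmul (a : A) (b : B) (c : C) :
    assocLeft (MinTensor.tmul (MinTensor.tmul a b) c) = tmul a b c :=
  (RepFamily.lift_of _ _ _).trans (preLeft_of (a ⊗ₜ b) c)

end MinTensor₃

end MinTensor

/-! ### Compact quantum groups, coactions and the equivariant join -/

section QuantumGroups

open MinTensor MinTensor₃

variable {H A K : Type u} [CStarAlgebra H] [CStarAlgebra A] [CStarAlgebra K]

/-- `(δ ⊗ id) ∘ δ = (id ⊗ Δ) ∘ δ` as maps `A → A ⊗ H ⊗ H`. -/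
def IsCoassociative (Δ : H →⋆ₐ[ℂ] MinTensor H H) (δ : A →⋆ₐ[ℂ] MinTensor A H) : Prop :=
  ∀ a : A, assocLeft (map δ (StarAlgHom.id ℂ H) (δ a)) =
    assocRight (map (StarAlgHom.id ℂ A) Δ (δ a))

/-- `(H, Δ)` is a compact quantum group: `H` is a unital `C*`-algebra and `Δ : H → H ⊗ H` is a
coassociative unital `*`-homomorphism such that the linear spans of `(H ⊗ 1) Δ(H)` and of
`(1 ⊗ H) Δ(H)` are dense in `H ⊗ H`. -/
structure IsCompactQuantumGroup (Δ : H →⋆ₐ[ℂ] MinTensor H H) : Prop where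
  coassoc : IsCoassociative Δ Δ
  dense_left : Dense (Submodule.span ℂ
    {x : MinTensor H H | ∃ h k : H, x = inclLeft h * Δ k} : Set (MinTensor H H))
  dense_right : Dense (Submodule.span ℂ
    {x : MinTensor H H | ∃ h k : H, x = inclRight h * Δ k} : Set (MinTensor H H))

/-- `δ : A → A ⊗ H` is a coaction of `(H, Δ)` on the unital `C*`-algebra `A`: it is a
coassociative unital `*`-homomorphism such that the linear span of `δ(A) (1 ⊗ H)` is dense in
`A ⊗ H`. Injectivity of `δ`, which some authors add, is not required. -/
structure IsCoaction (Δ : H →⋆ₐ[ℂ] MinTensor H H) (δ : A →⋆ₐ[ℂ] MinTensor A H) : Prop where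
  coassoc : IsCoassociative Δ δ
  dense : Dense (Submodule.span ℂ
    {x : MinTensor A H | ∃ (a : A) (h : H), x = δ a * inclRight h} : Set (MinTensor A H))

/-- The coaction `δ` is free: the linear span of `(A ⊗ 1) δ(A)` is dense in `A ⊗ H`. -/
def IsFree (δ : A →⋆ₐ[ℂ] MinTensor A H) : Prop :=
  Dense (Submodule.span ℂ
    {x : MinTensor A H | ∃ a b : A, x = inclLeft a * δ b} : Set (MinTensor A H))

/-- Evaluation at `t` as a `*`-homomorphism on the continuous paths in a `C*`-algebra. -/
def pathEval (B : Type u) [CStarAlgebra B] (t : unitInterval) : C(unitInterval, B) →⋆ₐ[ℂ] B where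
  toFun f := f t
  map_one' := rfl
  map_mul' _ _ := rfl
  map_zero' := rfl
  map_add' _ _ := rfl
  commutes' _ := rfl
  map_star' _ := rfl

/-- The equivariant join `A ⊛_δ H`: the `*`-algebra of all continuous `f : [0, 1] → A ⊗ H` with
`f 0 ∈ ℂ ⊗ H` and `f 1 ∈ δ(A)`. -/
def join (δ : A →⋆ₐ[ℂ] MinTensor A H) : StarSubalgebra ℂ C(unitInterval, MinTensor A H) :=
  (inclRight (A := A) (B := H)).range.comap (pathEval _ 0) ⊓ δ.range.comap (pathEval _ 1)

theorem mem_join {δ : A →⋆ₐ[ℂ] MinTensor A H} {f : C(unitInterval, MinTensor A H)} :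
    f ∈ join δ ↔ (∃ h : H, inclRight h = f 0) ∧ ∃ a : A, δ a = f 1 :=
  Iff.rfl

/-- Evaluation of elements of the join at `t ∈ [0, 1]`. -/
def joinEval (δ : A →⋆ₐ[ℂ] MinTensor A H) (t : unitInterval) : join δ →⋆ₐ[ℂ] MinTensor A H :=
  (pathEval _ t).comp (join δ).subtype

/-- `ψ : H → A ⊛_δ H` is `(Δ, δ_Δ)`-equivariant: `(ψ ⊗ id) ∘ Δ = δ_Δ ∘ ψ`. Here `δ_Δ` is the
coaction of `H` on the join that applies `id ⊗ Δ` at every `t ∈ [0, 1]`, and the identity is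
expressed by evaluating both sides at every `t`. -/
def IsJoinEquivariant (Δ : H →⋆ₐ[ℂ] MinTensor H H) (δ : A →⋆ₐ[ℂ] MinTensor A H)
    (ψ : H →⋆ₐ[ℂ] join δ) : Prop :=
  ∀ (t : unitInterval) (h : H),
    assocLeft (map ((joinEval δ t).comp ψ) (StarAlgHom.id ℂ H) (Δ h)) =
      assocRight (map (StarAlgHom.id ℂ A) Δ (joinEval δ t (ψ h)))

/-- The Type 2 noncommutative Borsuk-Ulam conjecture holds for `(H, Δ)`: whenever `δ` is a free
coaction of `(H, Δ)` on a nonzero unital `C*`-algebra `A`, there is no equivariant unital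
`*`-homomorphism `H → A ⊛_δ H`. -/
def Type2Holds (Δ : H →⋆ₐ[ℂ] MinTensor H H) : Prop :=
  ∀ (A : Type u) [CStarAlgebra A] [Nontrivial A] (δ : A →⋆ₐ[ℂ] MinTensor A H),
    IsCoaction Δ δ → IsFree δ → ¬ ∃ ψ : H →⋆ₐ[ℂ] join δ, IsJoinEquivariant Δ δ ψ

/-- `i : K → H` is an equivariant embedding of compact quantum groups: an injective unital
`*`-homomorphism that intertwines the comultiplications. -/
def IsEquivariantEmbedding (ΔK : K →⋆ₐ[ℂ] MinTensor K K) (ΔH : H →⋆ₐ[ℂ] MinTensor H H)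
    (i : K →⋆ₐ[ℂ] H) : Prop :=
  Function.Injective i ∧ ∀ k : K, ΔH (i k) = map i i (ΔK k)

end QuantumGroups

/-! ### The compact quantum group of continuous functions on a compact group -/

section Groups

open WeakDual

/-- The minimal tensor product of commutative `C*`-algebras is commutative. -/
instance {A B : Type u} [CommCStarAlgebra A] [CommCStarAlgebra B] :
    CommCStarAlgebra (MinTensor A B) where
  mul_comm x y := by
    refine (RepFamily.denseRange_of _).induction_on₂ (p := fun x y : MinTensor A B =>
      x * y = y * x) (isClosed_eq (continuous_fst.mul continuous_snd)
      (continuous_snd.mul continuous_fst)) (fun s t => ?_) x y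
    rw [← map_mul, ← map_mul, mul_comm]

variable (G : Type u) [TopologicalSpace G] [CompactSpace G] [T2Space G]

/-- The points `(x, y)` of `G × G` defined by a character `χ` of `C(G) ⊗ C(G)`: it satisfies
`χ (f ⊗ g) = f x * g y`. -/
def characterPoint :
    C(characterSpace ℂ (MinTensor C(G, ℂ) C(G, ℂ)), G × G) :=
  (((CharacterSpace.homeoEval G ℂ).symm : C(characterSpace ℂ C(G, ℂ), G)).comp
    (CharacterSpace.compContinuousMap MinTensor.inclLeft)).prodMk
  (((CharacterSpace.homeoEval G ℂ).symm : C(characterSpace ℂ C(G, ℂ), G)).comp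
    (CharacterSpace.compContinuousMap MinTensor.inclRight))

variable [Group G] [IsTopologicalGroup G]

/-- The comultiplication of `C(G)`, which is dual to the multiplication of `G`. -/
def groupComul : C(G, ℂ) →⋆ₐ[ℂ] MinTensor C(G, ℂ) C(G, ℂ) :=
  ((gelfandStarTransform (MinTensor C(G, ℂ) C(G, ℂ))).symm :
    C(characterSpace ℂ (MinTensor C(G, ℂ) C(G, ℂ)), ℂ) →⋆ₐ[ℂ] MinTensor C(G, ℂ) C(G, ℂ)).comp
  (ContinuousMap.compStarAlgHom' ℂ ℂ
    ((⟨fun p : G × G => p.1 * p.2, continuous_mul⟩ : C(G × G, G)).comp (characterPoint G)))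

variable {G}

theorem character_tmul (χ : characterSpace ℂ (MinTensor C(G, ℂ) C(G, ℂ))) (f g : C(G, ℂ)) :
    χ (MinTensor.tmul f g) = f (characterPoint G χ).1 * g (characterPoint G χ).2 := by
  have key : ∀ (φ : characterSpace ℂ C(G, ℂ)) (f : C(G, ℂ)),
      f ((CharacterSpace.homeoEval G ℂ).symm φ) = φ f := fun φ f => by
    conv_rhs => rw [← (CharacterSpace.homeoEval G ℂ).apply_symm_apply φ]
    rfl
  have h : MinTensor.tmul f g = MinTensor.inclLeft f * MinTensor.inclRight g := by
    change MinTensor.of _ = MinTensor.of _ * MinTensor.of _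
    rw [← map_mul]
    simp
  rw [h, map_mul]
  congr 1
  · exact (key (CharacterSpace.compContinuousMap MinTensor.inclLeft χ) f).symm
  · exact (key (CharacterSpace.compContinuousMap MinTensor.inclRight χ) g).symm

/-- Under the identification of characters of `C(G) ⊗ C(G)` with points of `G × G`, the
comultiplication of `f` is the function `(x, y) ↦ f (x * y)`. -/
theorem character_groupComul (χ : characterSpace ℂ (MinTensor C(G, ℂ) C(G, ℂ))) (f : C(G, ℂ)) :
    χ (groupComul G f) = f ((characterPoint G χ).1 * (characterPoint G χ).2) := by
  have h : gelfandStarTransform (MinTensor C(G, ℂ) C(G, ℂ)) (groupComul G f) =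
      ContinuousMap.compStarAlgHom' ℂ ℂ
        ((⟨fun p : G × G => p.1 * p.2, continuous_mul⟩ : C(G × G, G)).comp
          (characterPoint G)) f :=
    (gelfandStarTransform (MinTensor C(G, ℂ) C(G, ℂ))).apply_symm_apply _
  exact DFunLike.congr_fun h χ

end Groups

end QuantumJoin

end

/-! An equivariant `ψ : H → A ⊛_δ H`, restricted along `i : K → H` and evaluated at `t`, gives a
norm-continuous path of unital `*`-homomorphisms `φ_t : K → A ⊗ H` with `(φ_t ⊗ i) Δ_K = (id ⊗ Δ_H)
φ_t`, where `φ_0` takes values in `1 ⊗ H` and `φ_1` in `δ(A)`. The path turns out to be constant, so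
a single equivariant map has values in both `1 ⊗ H` and `δ(A)`, and this forces `dim K ≤ 1`.

Constancy (`equivariant_path_eq`). Compare `φ_t` with `k ↦ 1 ⊗ i k`. In Sweedler notation put
`θ_t(k) = (1 ⊗ i(S⁻¹ k₂)) φ_t(k₁)`. The antipode is not needed: with `T(x ⊗ y) = (1 ⊗ x) Δ_K(y)`,
bijective because `K` is finite-dimensional, `S⁻¹ k₂ ⊗ k₁` is `T⁻¹(k ⊗ 1)`. As `T` intertwines the
diagonal coaction on `K ⊗ K` with `id ⊗ Δ_K`, this tensor is coinvariant; hence `(id ⊗ Δ_H) θ_t(k) =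
θ_t(k) ⊗ 1`, and `θ_t(k) ∈ A ⊗ 1` by ergodicity of `Δ_H`. Elements of `A ⊗ 1` commute with `1 ⊗ H`,
which makes `θ_t` multiplicative. At `t = 0` its values lie in `(A ⊗ 1) ∩ (1 ⊗ H) = ℂ`. An
idempotent `e` of `K` thus yields a continuous path of idempotents `θ_t(e)` starting at `0` or `1`.
Nonzero idempotents have norm at least `1`, so the path is constant. Idempotents span `K`, and `φ_t`
can be recovered from `θ_t`, so `φ_t` is constant as well.

Triviality (`finrank_le_one_of_equivariant`). Let `φ` have values in `1 ⊗ H` and in `δ(A)`. Writing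
`φ k = δ a = 1 ⊗ h`, coassociativity of `δ` gives `(φ ⊗ i) Δ_K k = (δ ⊗ id) δ a = 1 ⊗ 1 ⊗ h`. Since
`(1 ⊗ K) Δ_K(K)` spans `K ⊗ K`, also `φ k ⊗ 1 ∈ 1 ⊗ 1 ⊗ H`, so `φ k` is a scalar. Then `φ ⊗ i` is
scalar on `(K ⊗ 1) Δ_K(K)`, which spans `K ⊗ K` too, so each `i k` is a scalar, and `i` is
injective.

Ergodicity (`IsCompactQuantumGroup.exists_smul_one`): `Δ z = z ⊗ 1` forces `z` to be a scalar. For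
two states `e`, `f`, Cesàro means of the convolution powers of `(e + f)/2` have a limit state `h`,
and positivity gives `e * h = h = f * h`. Therefore `e z = h z = f z`: all states agree on `z`.

For groups, take `K = C(G/N)` embedded in `H = C(G)`. That these are compact quantum groups is
checked on characters, with Stone–Weierstrass for the density conditions. -/

noncomputable section

namespace QuantumJoin

/-! ### States, GNS vectors, and separation of elements by states -/

section States

open scoped ComplexOrder

variable {A : Type u} [CStarAlgebra A]

/-- A linear functional on a `C*`-algebra that is nonnegative on all `star x * x` is given by a
vector in a representation. -/
theorem exists_rep_of_nonneg (f : A →ₗ[ℂ] ℂ) (hf : ∀ x, 0 ≤ f (star x * x)) :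
    ∃ (π : HilbertRep A) (ξ : π.space), ∀ x, f x = ⟪ξ, π.hom x ξ⟫_ℂ := by
  let _ := CStarAlgebra.spectralOrder A
  let _ := CStarAlgebra.spectralOrderedRing A
  let g : A →ₚ[ℂ] ℂ := PositiveLinearMap.mk₀ f fun x hx => by
    obtain ⟨y, rfl⟩ := CStarAlgebra.nonneg_iff_eq_star_mul_self.1 hx
    exact hf y
  -- The vector is the class of `1` in the GNS space.
  refine ⟨⟨g.GNS, g.gnsStarAlgHom⟩, ((g.toPreGNS 1 : g.PreGNS) : g.GNS), fun x => ?_⟩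
  have h : g.gnsStarAlgHom x ((g.toPreGNS 1 : g.PreGNS) : g.GNS) =
      ((g.leftMulMapPreGNS x (g.toPreGNS 1) : g.PreGNS) : g.GNS) :=
    g.gnsNonUnitalStarAlgHom_apply_coe
  change _ = ⟪((g.toPreGNS 1 : g.PreGNS) : g.GNS),
    g.gnsStarAlgHom x ((g.toPreGNS 1 : g.PreGNS) : g.GNS)⟫_ℂ
  rw [h, UniformSpace.Completion.inner_coe, PositiveLinearMap.preGNS_inner_def]
  simp
  rfl

/-- A state of a unital `C*`-algebra. -/
structure IsState (f : A →L[ℂ] ℂ) : Prop where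
  map_one : f 1 = 1
  nonneg : ∀ x, 0 ≤ f (star x * x)

theorem HilbertRep.norm_hom_le (π : HilbertRep A) (x : A) : ‖π.hom x‖ ≤ ‖x‖ :=
  NonUnitalStarAlgHom.norm_apply_le π.hom x

theorem HilbertRep.norm_inner_le (π : HilbertRep A) (ξ : π.space) (x : A) :
    ‖⟪ξ, π.hom x ξ⟫_ℂ‖ ≤ ‖ξ‖ * ‖ξ‖ * ‖x‖ :=
  calc ‖⟪ξ, π.hom x ξ⟫_ℂ‖ ≤ ‖ξ‖ * ‖π.hom x ξ‖ := norm_inner_le_norm _ _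
    _ ≤ ‖ξ‖ * (‖x‖ * ‖ξ‖) := mul_le_mul_of_nonneg_left
        ((π.hom x).le_of_opNorm_le (π.norm_hom_le x) ξ) (norm_nonneg _)
    _ = ‖ξ‖ * ‖ξ‖ * ‖x‖ := by ring

/-- The functional `x ↦ ⟪ξ, π x ξ⟫`. -/
def vecFunctional (π : HilbertRep A) (ξ : π.space) : A →L[ℂ] ℂ :=
  LinearMap.mkContinuous
    ((innerSL ℂ ξ).toLinearMap.comp
      ((ContinuousLinearMap.apply ℂ π.space ξ).toLinearMap.comp π.hom.toAlgHom.toLinearMap))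
    (‖ξ‖ * ‖ξ‖) (π.norm_inner_le ξ)

theorem vecFunctional_apply (π : HilbertRep A) (ξ : π.space) (x : A) :
    vecFunctional π ξ x = ⟪ξ, π.hom x ξ⟫_ℂ := rfl

theorem vecFunctional_star_mul (π : HilbertRep A) (ξ : π.space) (x y : A) :
    vecFunctional π ξ (star x * y) = ⟪π.hom x ξ, π.hom y ξ⟫_ℂ := by
  rw [vecFunctional_apply, map_mul π.hom, map_star π.hom, ContinuousLinearMap.star_eq_adjoint]
  exact ContinuousLinearMap.adjoint_inner_right (π.hom x) ξ (π.hom y ξ)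

theorem isState_vecFunctional (π : HilbertRep A) {ξ : π.space} (hξ : ‖ξ‖ = 1) :
    IsState (vecFunctional π ξ) where
  map_one := by
    rw [vecFunctional_apply, map_one]
    change ⟪ξ, ξ⟫_ℂ = 1
    rw [inner_self_eq_norm_sq_to_K, hξ]
    simp
  nonneg x := by
    rw [vecFunctional_star_mul, inner_self_eq_norm_sq_to_K]
    exact pow_nonneg (RCLike.ofReal_nonneg.2 (norm_nonneg _)) 2

theorem IsState.exists_rep {f : A →L[ℂ] ℂ} (hf : IsState f) :
    ∃ (π : HilbertRep A) (ξ : π.space), ‖ξ‖ = 1 ∧ f = vecFunctional π ξ := by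
  obtain ⟨π, ξ, h⟩ := exists_rep_of_nonneg f.toLinearMap hf.nonneg
  refine ⟨π, ξ, ?_, ContinuousLinearMap.ext h⟩
  have h1 : f 1 = ⟪ξ, π.hom 1 ξ⟫_ℂ := h 1
  rw [_root_.map_one π.hom] at h1
  change f 1 = ⟪ξ, ξ⟫_ℂ at h1
  rw [hf.map_one, inner_self_eq_norm_sq_to_K] at h1
  have h2 := congrArg norm h1
  rw [norm_one, norm_pow, RCLike.norm_ofReal, abs_norm] at h2
  exact (pow_eq_one_iff_of_nonneg (norm_nonneg ξ) two_ne_zero).1 h2.symm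

theorem IsState.norm_apply_le {f : A →L[ℂ] ℂ} (hf : IsState f) (x : A) : ‖f x‖ ≤ ‖x‖ := by
  obtain ⟨π, ξ, hξ, rfl⟩ := hf.exists_rep
  have h := π.norm_inner_le ξ x
  rwa [hξ, one_mul, one_mul] at h

/-- If `f (star d * d) = 0` for a state `f`, then `f (x * d) = 0` for all `x`. -/
theorem IsState.map_mul_eq_zero {f : A →L[ℂ] ℂ} (hf : IsState f) {d : A}
    (hd : f (star d * d) = 0) (x : A) : f (x * d) = 0 := by
  obtain ⟨π, ξ, -, rfl⟩ := hf.exists_rep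
  rw [vecFunctional_star_mul, inner_self_eq_zero] at hd
  rw [← star_star x, vecFunctional_star_mul, hd, inner_zero_right]

/-- Every nonzero element of a `C*`-algebra is seen by a representation. -/
theorem exists_rep_ne_zero {a : A} (ha : a ≠ 0) : ∃ π : HilbertRep A, π.hom a ≠ 0 := by
  let _ := CStarAlgebra.spectralOrder A
  let _ := CStarAlgebra.spectralOrderedRing A
  have hb : ¬ (0 ≤ -(star a * a)) := fun h => by
    have h1 : star a * a = 0 := le_antisymm (neg_nonneg.1 h) (star_mul_self_nonneg a)
    exact ha (CStarRing.star_mul_self_eq_zero_iff a |>.1 h1)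
  have hconv : Convex ℝ {x : A | 0 ≤ x} := fun x (hx : 0 ≤ x) y (hy : 0 ≤ y) s t hs ht _ =>
    show 0 ≤ s • x + t • y from add_nonneg (smul_nonneg hs hx) (smul_nonneg ht hy)
  -- Hahn–Banach separates `-(star a * a)` from the closed positive cone. A cone is stable under
  -- scaling, so a functional bounded below on it is nonnegative there.
  obtain ⟨g, c, h1, h2⟩ := geometric_hahn_banach_point_closed (E := A) hconv
    CStarAlgebra.isClosed_nonneg hb
  have hc : c < 0 := by simpa using h2 0 (le_refl (0 : A))
  have hg : ∀ x : A, 0 ≤ x → 0 ≤ g x := fun x hx => by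
    by_contra! hlt
    have h3 := h2 ((c / g x) • x) (smul_nonneg (div_pos_of_neg_of_neg hc hlt).le hx)
    rw [map_smul, smul_eq_mul, div_mul_cancel₀ _ hlt.ne] at h3
    exact lt_irrefl _ h3
  -- The real functional `g ∘ Re` is complexified; the result `f` agrees with `g` on self-adjoint
  -- elements, hence is nonnegative on every `star x * x`.
  let r : A →ₗ[ℝ] ℝ := g.toLinearMap.comp
    ((selfAdjoint.submodule ℝ A).subtype.comp (realPart : A →ₗ[ℝ] selfAdjoint A))
  let f : A →ₗ[ℂ] ℂ := Module.Dual.extendRCLike r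
  have hr : ∀ x : A, IsSelfAdjoint x → f x = (g x : ℂ) := fun x hx => by
    have h3 : ((realPart x : selfAdjoint A) : A) = x := hx.coe_realPart
    have h4 : (realPart ((Complex.I : ℂ) • x) : selfAdjoint A) = 0 := by
      rw [realPart_I_smul, hx.imaginaryPart, neg_zero]
    rw [Module.Dual.extendRCLike_apply]
    change ((g ((realPart x : selfAdjoint A) : A) : ℝ) : ℂ) -
      Complex.I * ((g ((realPart ((Complex.I : ℂ) • x) : selfAdjoint A) : A) : ℝ) : ℂ) = _
    rw [h3, h4]
    simp
  obtain ⟨π, ξ, h⟩ := exists_rep_of_nonneg f fun x => by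
    rw [hr _ (IsSelfAdjoint.star_mul_self x)]
    exact_mod_cast hg _ (star_mul_self_nonneg x)
  refine ⟨π, fun h0 => ?_⟩
  have h5 := h (star a * a)
  rw [hr _ (IsSelfAdjoint.star_mul_self a), map_mul π.hom, h0, mul_zero] at h5
  have h6 : g (star a * a) = 0 := by
    have : ((g (star a * a) : ℝ) : ℂ) = 0 := by simpa using h5
    exact_mod_cast this
  rw [map_neg, h6, neg_zero] at h1
  exact lt_asymm h1 hc

/-- The norm of a `C*`-algebra is the supremum over all representations. -/
theorem seminorm_all (a : A) : (RepFamily.all A).seminorm a = ‖a‖ := by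
  rw [← RepFamily.norm_of]
  refine NonUnitalStarAlgHom.norm_map (RepFamily.of (RepFamily.all A)) ?_ a
  refine (injective_iff_map_eq_zero _).2 fun a ha => ?_
  by_contra h
  obtain ⟨π, hπ⟩ := exists_rep_ne_zero h
  refine hπ (norm_le_zero_iff.1 ?_)
  refine (RepFamily.le_seminorm (S := RepFamily.all A) (π := π) trivial a).trans ?_
  rw [← RepFamily.norm_of, ha, norm_zero]

/-- A bounded operator with vanishing quadratic form on unit vectors is zero. -/
theorem op_eq_zero_of_inner_unit {E : Type u} [NormedAddCommGroup E] [InnerProductSpace ℂ E]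
    {T : E →L[ℂ] E} (h : ∀ ξ : E, ‖ξ‖ = 1 → ⟪ξ, T ξ⟫_ℂ = 0) : T = 0 := by
  have h0 : ∀ ξ : E, ⟪T ξ, ξ⟫_ℂ = 0 := fun ξ => by
    rcases eq_or_ne ξ 0 with rfl | hξ
    · simp
    have h1 := h (((‖ξ‖ : ℂ)⁻¹) • ξ) (by
      rw [norm_smul]
      simp [hξ])
    rw [map_smul, inner_smul_left, inner_smul_right] at h1
    have h2 : ⟪ξ, T ξ⟫_ℂ = 0 := by simpa [hξ] using h1
    rw [← inner_conj_symm, h2, map_zero]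
  exact ContinuousLinearMap.ext fun ξ => congrArg (fun S : E →ₗ[ℂ] E => S ξ)
    ((inner_map_self_eq_zero T.toLinearMap).1 h0)

/-- Over `ℂ` the quadratic form determines an operator, so the vector states of one representation
that does not kill `a` already detect `a`. -/
theorem eq_zero_of_states {a : A} (h : ∀ f : A →L[ℂ] ℂ, IsState f → f a = 0) : a = 0 := by
  by_contra ha
  obtain ⟨π, hπ⟩ := exists_rep_ne_zero ha
  exact hπ (op_eq_zero_of_inner_unit fun ξ hξ => h _ (isState_vecFunctional π hξ))

theorem eq_of_states {a b : A} (h : ∀ f : A →L[ℂ] ℂ, IsState f → f a = f b) : a = b :=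
  sub_eq_zero.1 (eq_zero_of_states fun f hf => by rw [map_sub, h f hf, sub_self])

theorem exists_isState [Nontrivial A] : ∃ f : A →L[ℂ] ℂ, IsState f := by
  by_contra! h
  exact one_ne_zero (eq_zero_of_states (a := (1 : A)) fun f hf => absurd hf (h f))

theorem isState_average {f g : A →L[ℂ] ℂ} (hf : IsState f) (hg : IsState g) :
    IsState ((2⁻¹ : ℂ) • (f + g)) where
  map_one := by
    change (2⁻¹ : ℂ) * (f 1 + g 1) = 1
    rw [hf.map_one, hg.map_one]
    norm_num
  nonneg x := by
    change 0 ≤ (2⁻¹ : ℂ) * (f _ + g _)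
    exact mul_nonneg (by positivity) (add_nonneg (hf.nonneg x) (hg.nonneg x))

end States

/-! ### Slice maps by states -/

section Slices

variable {X Y : Type u} [Ring X] [Algebra ℂ X] [StarRing X] [StarModule ℂ X]
  [Ring Y] [Algebra ℂ Y] [StarRing Y] [StarModule ℂ Y]
  {D : Type*} [NormedAddCommGroup D] [NormedSpace ℂ D] [CompleteSpace D]

/-- A linear map bounded by the seminorm extends to the completion. -/
theorem RepFamily.exists_extend (S : RepFamily X) (L : X →ₗ[ℂ] D)
    (hL : ∀ x, ‖L x‖ ≤ S.seminorm x) :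
    ∃ F : S.Completion →L[ℂ] D, ∀ x, F (S.of x) = L x := by
  let L' : S.Pre →L[ℂ] D := LinearMap.mkContinuous (E := S.Pre) L 1 fun x => by
    rw [one_mul]; exact hL x
  let e : S.Pre →L[ℂ] UniformSpace.Completion S.Pre := UniformSpace.Completion.toComplL
  let F : UniformSpace.Completion S.Pre →L[ℂ] D := L'.extend e
  refine ⟨F, fun x => ?_⟩
  have h : F (e x) = L' x := ContinuousLinearMap.extend_eq L'
    (UniformSpace.Completion.denseRange_coe (α := S.Pre))
    (UniformSpace.Completion.isUniformInducing_coe S.Pre) x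
  exact h

/-- The algebraic slice `x ⊗ y ↦ f x • y`. -/
def algSliceLeft (f : X →ₗ[ℂ] ℂ) : X ⊗[ℂ] Y →ₗ[ℂ] Y :=
  (TensorProduct.lid ℂ Y).toLinearMap ∘ₗ f.rTensor Y

@[simp]
theorem algSliceLeft_tmul (f : X →ₗ[ℂ] ℂ) (x : X) (y : Y) :
    algSliceLeft f (x ⊗ₜ[ℂ] y) = f x • y := by
  simp [algSliceLeft]

/-- The algebraic slice `x ⊗ y ↦ g y • x`. -/
def algSliceRight (g : Y →ₗ[ℂ] ℂ) : X ⊗[ℂ] Y →ₗ[ℂ] X :=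
  (TensorProduct.rid ℂ X).toLinearMap ∘ₗ g.lTensor X

@[simp]
theorem algSliceRight_tmul (g : Y →ₗ[ℂ] ℂ) (x : X) (y : Y) :
    algSliceRight g (x ⊗ₜ[ℂ] y) = g y • x := by
  simp [algSliceRight]

theorem opNorm_le_of_inner {E : Type u} [NormedAddCommGroup E] [InnerProductSpace ℂ E]
    {T : E →L[ℂ] E} {c : ℝ} (hc : 0 ≤ c) (h : ∀ v w : E, ‖⟪v, T w⟫_ℂ‖ ≤ c * ‖v‖ * ‖w‖) :
    ‖T‖ ≤ c := by
  refine ContinuousLinearMap.opNorm_le_bound _ hc fun w => ?_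
  have h1 := h (T w) w
  rw [inner_self_eq_norm_sq_to_K, norm_pow, RCLike.norm_ofReal, abs_norm] at h1
  rcases (norm_nonneg (T w)).eq_or_lt with h0 | h0
  · rw [← h0]; positivity
  · nlinarith

/-- The map `v ↦ ξ ⊗ v` is isometric, and compressing `(π ⊗ ρ) t` by it gives `ρ` of the slice of
`t` by the vector functional of `ξ`. -/
theorem norm_algSliceLeft_le {π : HilbertRep X} {ρ : HilbertRep Y} {ξ : π.space} (hξ : ‖ξ‖ = 1)
    {f : X →ₗ[ℂ] ℂ} (hf : ∀ x, f x = ⟪ξ, π.hom x ξ⟫_ℂ) (t : X ⊗[ℂ] Y) :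
    ‖ρ.hom (algSliceLeft f t)‖ ≤ ‖tensorHom π.hom ρ.hom t‖ := by
  refine opNorm_le_of_inner (norm_nonneg _) fun v w => ?_
  have key : ⟪v, ρ.hom (algSliceLeft f t) w⟫_ℂ =
      ⟪toHilbert (ξ ⊗ₜ[ℂ] v), tensorHom π.hom ρ.hom t (toHilbert (ξ ⊗ₜ[ℂ] w))⟫_ℂ := by
    induction t using TensorProduct.induction_on with
    | zero => simp
    | add s t hs ht =>
      rw [map_add, map_add, map_add, _root_.add_apply, _root_.add_apply, inner_add_right,
        inner_add_right, hs, ht]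
    | tmul x y =>
      rw [algSliceLeft_tmul, tensorHom_tmul, opTensor_toHilbert, LinearIsometry.inner_map_map,
        map_smul]
      simp [hf, TensorProduct.inner_tmul]
  rw [key]
  have h2 : ∀ v : ρ.space, ‖toHilbert (ξ ⊗ₜ[ℂ] v)‖ = ‖v‖ := fun v => by
    rw [LinearIsometry.norm_map, TensorProduct.norm_tmul, hξ, one_mul]
  have h3 := (norm_inner_le_norm (𝕜 := ℂ) (toHilbert (ξ ⊗ₜ[ℂ] v))
    (tensorHom π.hom ρ.hom t (toHilbert (ξ ⊗ₜ[ℂ] w)))).trans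
    (mul_le_mul_of_nonneg_left ((tensorHom π.hom ρ.hom t).le_opNorm _) (norm_nonneg _))
  rw [h2, h2] at h3
  exact h3.trans_eq (by ring)

theorem norm_algSliceRight_le {π : HilbertRep X} {ρ : HilbertRep Y} {ξ : ρ.space} (hξ : ‖ξ‖ = 1)
    {f : Y →ₗ[ℂ] ℂ} (hf : ∀ x, f x = ⟪ξ, ρ.hom x ξ⟫_ℂ) (t : X ⊗[ℂ] Y) :
    ‖π.hom (algSliceRight f t)‖ ≤ ‖tensorHom π.hom ρ.hom t‖ := by
  refine opNorm_le_of_inner (norm_nonneg _) fun v w => ?_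
  have key : ⟪v, π.hom (algSliceRight f t) w⟫_ℂ =
      ⟪toHilbert (v ⊗ₜ[ℂ] ξ), tensorHom π.hom ρ.hom t (toHilbert (w ⊗ₜ[ℂ] ξ))⟫_ℂ := by
    induction t using TensorProduct.induction_on with
    | zero => simp
    | add s t hs ht =>
      rw [map_add, map_add, map_add, _root_.add_apply, _root_.add_apply, inner_add_right,
        inner_add_right, hs, ht]
    | tmul x y =>
      rw [algSliceRight_tmul, tensorHom_tmul, opTensor_toHilbert, LinearIsometry.inner_map_map,
        map_smul]
      simp [hf, TensorProduct.inner_tmul, mul_comm]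
  rw [key]
  have h2 : ∀ v : π.space, ‖toHilbert (v ⊗ₜ[ℂ] ξ)‖ = ‖v‖ := fun v => by
    rw [LinearIsometry.norm_map, TensorProduct.norm_tmul, hξ, mul_one]
  have h3 := (norm_inner_le_norm (𝕜 := ℂ) (toHilbert (v ⊗ₜ[ℂ] ξ))
    (tensorHom π.hom ρ.hom t (toHilbert (w ⊗ₜ[ℂ] ξ)))).trans
    (mul_le_mul_of_nonneg_left ((tensorHom π.hom ρ.hom t).le_opNorm _) (norm_nonneg _))
  rw [h2, h2] at h3
  exact h3.trans_eq (by ring)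

variable {A B C : Type u} [CStarAlgebra A] [CStarAlgebra B] [CStarAlgebra C]

/-- The second factor carries an arbitrary family `T`, so one estimate yields the slices `f ⊗ id` on
`A ⊗ B` and `f ⊗ id ⊗ id` on `A ⊗ B ⊗ C`. -/
theorem IsState.seminorm_algSliceLeft_le {f : A →L[ℂ] ℂ} (hf : IsState f) (T : RepFamily Y)
    (t : A ⊗[ℂ] Y) :
    T.seminorm (algSliceLeft f.toLinearMap t) ≤ ((RepFamily.all A).tensor T).seminorm t := by
  obtain ⟨π, ξ, hξ, rfl⟩ := hf.exists_rep
  refine RepFamily.seminorm_le (RepFamily.seminorm_nonneg _) fun ρ hρ => ?_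
  exact (norm_algSliceLeft_le hξ (fun _ => rfl) t).trans
    (RepFamily.le_tensor (S := RepFamily.all A) (π := π) trivial hρ t)

theorem IsState.norm_algSliceRight_le {g : B →L[ℂ] ℂ} (hg : IsState g) (t : A ⊗[ℂ] B) :
    ‖algSliceRight g.toLinearMap t‖ ≤
      ((RepFamily.all A).tensor (RepFamily.all B)).seminorm t := by
  obtain ⟨ρ, ξ, hξ, rfl⟩ := hg.exists_rep
  rw [← seminorm_all]
  refine RepFamily.seminorm_le (RepFamily.seminorm_nonneg _) fun π _ => ?_
  exact (QuantumJoin.norm_algSliceRight_le hξ (fun _ => rfl) t).trans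
    (RepFamily.le_tensor (S := RepFamily.all A) (T := RepFamily.all B) (π := π) (ρ := ρ)
      trivial trivial t)

/-- The slice map `f ⊗ id`. -/
def IsState.sliceLeft {f : A →L[ℂ] ℂ} (hf : IsState f) : MinTensor A B →L[ℂ] B :=
  (RepFamily.exists_extend _ (algSliceLeft f.toLinearMap) fun t => by
    rw [← seminorm_all]; exact hf.seminorm_algSliceLeft_le _ t).choose

theorem IsState.sliceLeft_of {f : A →L[ℂ] ℂ} (hf : IsState f) (t : A ⊗[ℂ] B) :
    hf.sliceLeft (MinTensor.of t) = algSliceLeft f.toLinearMap t :=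
  (RepFamily.exists_extend ((RepFamily.all A).tensor (RepFamily.all B))
    (algSliceLeft f.toLinearMap) fun t => by
      rw [← seminorm_all]; exact hf.seminorm_algSliceLeft_le _ t).choose_spec t

@[simp]
theorem IsState.sliceLeft_tmul {f : A →L[ℂ] ℂ} (hf : IsState f) (a : A) (b : B) :
    hf.sliceLeft (MinTensor.tmul a b) = f a • b :=
  (hf.sliceLeft_of _).trans (algSliceLeft_tmul _ _ _)

/-- The slice map `id ⊗ g`. -/
def IsState.sliceRight {g : B →L[ℂ] ℂ} (hg : IsState g) : MinTensor A B →L[ℂ] A :=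
  (RepFamily.exists_extend _ (algSliceRight g.toLinearMap) hg.norm_algSliceRight_le).choose

@[simp]
theorem IsState.sliceRight_tmul {g : B →L[ℂ] ℂ} (hg : IsState g) (a : A) (b : B) :
    hg.sliceRight (MinTensor.tmul a b) = g b • a :=
  ((RepFamily.exists_extend ((RepFamily.all A).tensor (RepFamily.all B)) (algSliceRight g.toLinearMap)
    hg.norm_algSliceRight_le).choose_spec (a ⊗ₜ b)).trans (algSliceRight_tmul _ _ _)

/-- The slice map `f ⊗ id ⊗ id`. -/
def IsState.sliceLeft₃ {f : A →L[ℂ] ℂ} (hf : IsState f) :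
    MinTensor₃ A B C →L[ℂ] MinTensor B C :=
  (RepFamily.exists_extend ((RepFamily.all A).tensor ((RepFamily.all B).tensor (RepFamily.all C)))
    ((MinTensor.of (A := B) (B := C)).toAlgHom.toLinearMap ∘ₗ algSliceLeft f.toLinearMap) fun t =>
      (RepFamily.norm_of _ _).trans_le (hf.seminorm_algSliceLeft_le _ t)).choose

theorem IsState.sliceLeft₃_of {f : A →L[ℂ] ℂ} (hf : IsState f) (t : A ⊗[ℂ] (B ⊗[ℂ] C)) :
    hf.sliceLeft₃ (MinTensor₃.of t) = MinTensor.of (algSliceLeft f.toLinearMap t) :=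
  (RepFamily.exists_extend ((RepFamily.all A).tensor ((RepFamily.all B).tensor (RepFamily.all C)))
    ((MinTensor.of (A := B) (B := C)).toAlgHom.toLinearMap ∘ₗ algSliceLeft f.toLinearMap) fun t =>
      (RepFamily.norm_of _ _).trans_le (hf.seminorm_algSliceLeft_le _ t)).choose_spec t

@[simp]
theorem IsState.sliceLeft₃_tmul {f : A →L[ℂ] ℂ} (hf : IsState f) (a : A) (b : B) (c : C) :
    hf.sliceLeft₃ (MinTensor₃.tmul a b c) = f a • MinTensor.tmul b c := by
  rw [MinTensor₃.tmul, hf.sliceLeft₃_of, algSliceLeft_tmul, map_smul]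
  rfl

end Slices

/-! ### Density of elementary tensors -/

section Extensionality

variable {A B C : Type u} [CStarAlgebra A] [CStarAlgebra B] [CStarAlgebra C]
  {D : Type*} [NormedAddCommGroup D] [NormedSpace ℂ D]

theorem MinTensor.tmul_eq (a : A) (b : B) :
    MinTensor.tmul a b = MinTensor.inclLeft a * MinTensor.inclRight b := by
  change MinTensor.of _ = MinTensor.of _ * MinTensor.of _
  rw [← map_mul]
  simp

theorem MinTensor.inclLeft_apply (a : A) : (MinTensor.inclLeft a : MinTensor A B) = tmul a 1 := rfl

theorem MinTensor.inclRight_apply (b : B) : (MinTensor.inclRight b : MinTensor A B) = tmul 1 b :=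
  rfl

theorem MinTensor.tmul_mul (a a' : A) (b b' : B) :
    tmul a b * tmul a' b' = tmul (a * a') (b * b') := by
  change MinTensor.of _ * MinTensor.of _ = MinTensor.of _
  rw [← map_mul, Algebra.TensorProduct.tmul_mul_tmul]

theorem MinTensor.tmul_one_one : (tmul 1 1 : MinTensor A B) = 1 := map_one MinTensor.of

theorem MinTensor.star_tmul (a : A) (b : B) : star (tmul a b) = tmul (star a) (star b) := by
  change star (MinTensor.of _) = MinTensor.of _
  rw [← map_star, TensorProduct.star_tmul]

/-- Continuous linear maps on `A ⊗ B` are determined by their values on elementary tensors. -/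
theorem MinTensor.clm_ext {F G : MinTensor A B →L[ℂ] D}
    (h : ∀ a b, F (tmul a b) = G (tmul a b)) : F = G := by
  ext z
  refine (RepFamily.denseRange_of _).induction_on (p := fun z => F z = G z) z
    (isClosed_eq F.continuous G.continuous) fun t => ?_
  induction t using TensorProduct.induction_on with
  | zero => rw [map_zero, map_zero, map_zero]
  | add s t hs ht => rw [map_add, map_add, map_add, hs, ht]
  | tmul a b => exact h a b

theorem MinTensor.continuous_tmul_left (b : B) : Continuous fun a : A => tmul a b := by
  simp_rw [tmul_eq]
  exact (RepFamily.continuous_starHom _).mul continuous_const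

theorem MinTensor.continuous_tmul_right (a : A) : Continuous fun b : B => tmul a b := by
  simp_rw [tmul_eq]
  exact continuous_const.mul (RepFamily.continuous_starHom _)

theorem MinTensor.add_tmul (a a' : A) (b : B) : tmul (a + a') b = tmul a b + tmul a' b := by
  rw [tmul, TensorProduct.add_tmul, map_add]; rfl

theorem MinTensor.tmul_add (a : A) (b b' : B) : tmul a (b + b') = tmul a b + tmul a b' := by
  rw [tmul, TensorProduct.tmul_add, map_add]; rfl

/-- Induction for a closed additive property of the elements of `A ⊗ B`. -/
theorem MinTensor.induction {p : MinTensor A B → Prop} (hp : IsClosed {z | p z})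
    (zero : p 0) (add : ∀ x y, p x → p y → p (x + y)) (tmul : ∀ a b, p (tmul a b))
    (z : MinTensor A B) : p z := by
  refine (RepFamily.denseRange_of _).induction_on (p := p) z hp fun t => ?_
  induction t using TensorProduct.induction_on with
  | zero => rw [map_zero]; exact zero
  | add s t hs ht => rw [map_add]; exact add _ _ hs ht
  | tmul a b => exact tmul a b

theorem MinTensor.clm_ext_left {F G : MinTensor (MinTensor A B) C →L[ℂ] D}
    (h : ∀ a b c, F (tmul (tmul a b) c) = G (tmul (tmul a b) c)) : F = G := by
  refine clm_ext fun z c => ?_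
  induction z using MinTensor.induction with
  | hp => exact isClosed_eq (F.continuous.comp (continuous_tmul_left c)) (G.continuous.comp (continuous_tmul_left c))
  | zero =>
    have h0 : tmul (0 : MinTensor A B) c = 0 := by rw [tmul, TensorProduct.zero_tmul, map_zero]
    rw [h0, map_zero, map_zero]
  | add x y hx hy => rw [add_tmul, map_add, map_add, hx, hy]
  | tmul a b => exact h a b c

theorem MinTensor.clm_ext_right {F G : MinTensor A (MinTensor B C) →L[ℂ] D}
    (h : ∀ a b c, F (tmul a (tmul b c)) = G (tmul a (tmul b c))) : F = G := by
  refine clm_ext fun a z => ?_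
  induction z using MinTensor.induction with
  | hp => exact isClosed_eq (F.continuous.comp (continuous_tmul_right a)) (G.continuous.comp (continuous_tmul_right a))
  | zero =>
    have h0 : tmul a (0 : MinTensor B C) = 0 := by rw [tmul, TensorProduct.tmul_zero, map_zero]
    rw [h0, map_zero, map_zero]
  | add x y hx hy => rw [tmul_add, map_add, map_add, hx, hy]
  | tmul b c => exact h a b c

/-- A `*`-homomorphism of `C*`-algebras as a continuous linear map. -/
def homCLM (f : A →⋆ₐ[ℂ] B) : A →L[ℂ] B :=
  ⟨f.toAlgHom.toLinearMap, RepFamily.continuous_starHom f⟩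

@[simp]
theorem homCLM_apply (f : A →⋆ₐ[ℂ] B) (a : A) : homCLM f a = f a := rfl

end Extensionality

/-! ### Product states; slices separate points -/

section ProductStates

open scoped ComplexOrder

variable {A B C : Type u} [CStarAlgebra A] [CStarAlgebra B] [CStarAlgebra C]

/-- `f ((id ⊗ g) z) = g ((f ⊗ id) z)`. -/
theorem IsState.fubini {f : A →L[ℂ] ℂ} (hf : IsState f) {g : B →L[ℂ] ℂ} (hg : IsState g)
    (z : MinTensor A B) : f (hg.sliceRight z) = g (hf.sliceLeft z) := by
  have h : f.comp hg.sliceRight = g.comp (hf.sliceLeft (B := B)) :=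
    MinTensor.clm_ext fun a b => by simp [mul_comm]
  exact DFunLike.congr_fun h z

/-- The product of two states is a state. -/
theorem IsState.tensor {f : A →L[ℂ] ℂ} (hf : IsState f) {g : B →L[ℂ] ℂ} (hg : IsState g) :
    IsState (f.comp (hg.sliceRight (A := A))) where
  map_one := by
    rw [← MinTensor.tmul_one_one]
    simp [hf.map_one, hg.map_one]
  nonneg := by
    obtain ⟨π, ξ, hξ, rfl⟩ := id hf |>.exists_rep
    obtain ⟨ρ, η, hη, rfl⟩ := id hg |>.exists_rep
    have hmem : π.tensor ρ ∈ ((RepFamily.all A).tensor (RepFamily.all B)).carrier :=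
      ⟨π, trivial, ρ, trivial, rfl⟩
    let κ : HilbertRep (MinTensor A B) :=
      ⟨HilbertTensor π.space ρ.space, RepFamily.liftRep hmem⟩
    have h : (vecFunctional π ξ).comp (hg.sliceRight (A := A)) =
        vecFunctional κ (toHilbert (ξ ⊗ₜ[ℂ] η)) := MinTensor.clm_ext fun a b => by
      have h1 : κ.hom (MinTensor.tmul a b) = opTensor (π.hom a) (ρ.hom b) :=
        (RepFamily.lift_of (π.tensor ρ).hom (RepFamily.le_seminorm hmem) (a ⊗ₜ b)).trans
          (tensorHom_tmul _ _ _ _)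
      rw [vecFunctional_apply, h1]
      change (vecFunctional π ξ) (hg.sliceRight (MinTensor.tmul a b)) = _
      rw [hg.sliceRight_tmul, map_smul]
      change _ = ⟪toHilbert (ξ ⊗ₜ[ℂ] η), opTensor (π.hom a) (ρ.hom b)
        (toHilbert (ξ ⊗ₜ[ℂ] η))⟫_ℂ
      rw [opTensor_toHilbert, LinearIsometry.inner_map_map, vecFunctional_apply,
        vecFunctional_apply]
      simp [TensorProduct.inner_tmul, mul_comm]
    rw [h]
    refine (isState_vecFunctional κ ?_).nonneg
    change ‖toHilbert (ξ ⊗ₜ[ℂ] η)‖ = 1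
    rw [LinearIsometry.norm_map, TensorProduct.norm_tmul, hξ, hη, one_mul]

/-- The slice maps by states separate the elements of `A ⊗ B`. -/
theorem MinTensor.eq_zero_of_slices {z : MinTensor A B}
    (h : ∀ (f : A →L[ℂ] ℂ) (hf : IsState f), hf.sliceLeft z = 0) : z = 0 := by
  refine norm_le_zero_iff.1 (RepFamily.norm_le_of_liftRep le_rfl ?_)
  rintro _ hτ
  obtain ⟨π, -, ρ, -, rfl⟩ := id hτ
  obtain ⟨P, hP, hPz⟩ : ∃ P : MinTensor A B →⋆ₐ[ℂ]
      (HilbertTensor π.space ρ.space →L[ℂ] HilbertTensor π.space ρ.space),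
      (∀ a b, P (tmul a b) = opTensor (π.hom a) (ρ.hom b)) ∧
        (P z = 0 → RepFamily.liftRep hτ z = 0) :=
    ⟨RepFamily.liftRep hτ, fun a b =>
      (RepFamily.lift_of (π.tensor ρ).hom (RepFamily.le_seminorm hτ) (a ⊗ₜ b)).trans
        (tensorHom_tmul _ _ _ _), id⟩
  refine (norm_eq_zero.2 (hPz ?_)).le
  have key : ∀ (ξ η : π.space) (v w : ρ.space),
      ⟪toHilbert (ξ ⊗ₜ[ℂ] v), P z (toHilbert (η ⊗ₜ[ℂ] w))⟫_ℂ = 0 := by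
    intro ξ η v w
    -- With `M w : η ↦ η ⊗ w`, the operator `L = (M v)* P(z) (M w)` carries all the coefficients
    -- with `v` and `w` fixed. It vanishes once its quadratic form does, and that form involves only
    -- slices by vector states.
    let M : ρ.space → π.space →L[ℂ] HilbertTensor π.space ρ.space := fun w =>
      toHilbert.toContinuousLinearMap.comp (((TensorProduct.mkL ℂ π.space ρ.space).flip) w)
    have hM : ∀ w η, M w η = toHilbert (η ⊗ₜ[ℂ] w) := fun _ _ => rfl
    let L : π.space →L[ℂ] π.space :=
      (ContinuousLinearMap.adjoint (M v)).comp ((P z).comp (M w))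
    have hL : ∀ ξ η : π.space, ⟪ξ, L η⟫_ℂ =
        ⟪toHilbert (ξ ⊗ₜ[ℂ] v), P z (toHilbert (η ⊗ₜ[ℂ] w))⟫_ℂ := fun ξ η => by
      rw [← hM, ← hM]
      exact ContinuousLinearMap.adjoint_inner_right (M v) ξ (P z (M w η))
    have hL0 : L = 0 := op_eq_zero_of_inner_unit fun ξ hξ => by
      have h1 := h _ (isState_vecFunctional π hξ)
      rw [hL]
      have h2 : ∀ z : MinTensor A B,
          ⟪toHilbert (ξ ⊗ₜ[ℂ] v), P z (toHilbert (ξ ⊗ₜ[ℂ] w))⟫_ℂ =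
          ⟪v, ρ.hom ((isState_vecFunctional π hξ).sliceLeft z) w⟫_ℂ := fun z => by
        induction z using MinTensor.induction with
        | hp =>
          refine isClosed_eq ?_ ?_
          · exact continuous_const.inner
              ((RepFamily.continuous_starHom P).clm_apply continuous_const)
          · exact continuous_const.inner (((RepFamily.continuous_starHom ρ.hom).comp
              (isState_vecFunctional π hξ).sliceLeft.continuous).clm_apply continuous_const)
        | zero => simp
        | add x y hx hy =>
          rw [map_add, map_add, map_add, _root_.add_apply, _root_.add_apply, inner_add_right,
            inner_add_right, hx, hy]
        | tmul a b =>
          rw [hP, opTensor_toHilbert, LinearIsometry.inner_map_map, IsState.sliceLeft_tmul,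
            map_smul, vecFunctional_apply]
          simp [TensorProduct.inner_tmul]
      rw [h2, h1, map_zero]
      simp
    rw [← hL, hL0]
    simp
  refine op_ext fun e f => ?_
  rw [_root_.zero_apply]
  refine ext_inner_left ℂ fun u => ?_
  rw [inner_zero_right]
  induction u using denseRange_toHilbert.induction_on with
  | hp => exact isClosed_eq (continuous_id.inner continuous_const) continuous_const
  | ih u =>
    induction u using TensorProduct.induction_on with
    | zero => simp
    | add x y hx hy => rw [map_add, inner_add_left, hx, hy, add_zero]
    | tmul e' f' => exact key e' e f' f

end ProductStates

/-! ### Convolution of states, invariant states, and ergodicity of the comultiplication -/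

section Convolution

open scoped ComplexOrder
open MinTensor

variable {A B C H : Type u} [CStarAlgebra A] [CStarAlgebra B] [CStarAlgebra C] [CStarAlgebra H]

theorem IsState.comp_hom {f : B →L[ℂ] ℂ} (hf : IsState f) (φ : A →⋆ₐ[ℂ] B) :
    IsState (f.comp (homCLM φ)) where
  map_one := by simp [hf.map_one]
  nonneg x := by
    change 0 ≤ f (φ (star x * x))
    rw [map_mul, map_star]
    exact hf.nonneg _

theorem IsState.sliceLeft₃_assocRight {f : A →L[ℂ] ℂ} (hf : IsState f)
    (w : MinTensor A (MinTensor B C)) :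
    hf.sliceLeft₃ (MinTensor₃.assocRight w) = hf.sliceLeft w := by
  have h : hf.sliceLeft₃.comp (homCLM (MinTensor₃.assocRight (A := A) (B := B) (C := C))) =
      hf.sliceLeft := clm_ext_right fun a b c => by
    simp [MinTensor₃.assocRight_tmul]
  exact DFunLike.congr_fun h w

/-- The counterpart of `IsState.sliceLeft₃_assocRight` for the other bracketing. Applying both to
the two sides of coassociativity removes the triple tensor product and leaves identities between
one-variable maps. -/
theorem IsState.slice_assocLeft {f : A →L[ℂ] ℂ} (hf : IsState f) {g : C →L[ℂ] ℂ}
    (hg : IsState g) (w : MinTensor (MinTensor A B) C) :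
    hg.sliceRight (hf.sliceLeft₃ (MinTensor₃.assocLeft w)) =
      hf.sliceLeft (hg.sliceRight w) := by
  have h : (hg.sliceRight.comp hf.sliceLeft₃).comp
      (homCLM (MinTensor₃.assocLeft (A := A) (B := B) (C := C))) =
      hf.sliceLeft.comp hg.sliceRight := clm_ext_left fun a b c => by
    change hg.sliceRight (hf.sliceLeft₃ (MinTensor₃.assocLeft (tmul (tmul a b) c))) =
      hf.sliceLeft (hg.sliceRight (tmul (tmul a b) c))
    rw [MinTensor₃.assocLeft_tmul, hf.sliceLeft₃_tmul, map_smul, hg.sliceRight_tmul,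
      hg.sliceRight_tmul, map_smul, hf.sliceLeft_tmul, smul_comm]
  exact DFunLike.congr_fun h w

theorem IsState.sliceLeft_map {f : A →L[ℂ] ℂ} (hf : IsState f) (φ : B →⋆ₐ[ℂ] C)
    (z : MinTensor A B) : hf.sliceLeft (map (StarAlgHom.id ℂ A) φ z) = φ (hf.sliceLeft z) := by
  have h : hf.sliceLeft.comp (homCLM (map (StarAlgHom.id ℂ A) φ)) =
      (homCLM φ).comp hf.sliceLeft := clm_ext fun a b => by
    simp [map_tmul]
  exact DFunLike.congr_fun h z

theorem IsState.sliceRight_map {g : C →L[ℂ] ℂ} (hg : IsState g) (φ : A →⋆ₐ[ℂ] B)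
    (z : MinTensor A C) : hg.sliceRight (map φ (StarAlgHom.id ℂ C) z) = φ (hg.sliceRight z) := by
  have h : hg.sliceRight.comp (homCLM (map φ (StarAlgHom.id ℂ C))) =
      (homCLM φ).comp hg.sliceRight := clm_ext fun a b => by
    simp [map_tmul]
  exact DFunLike.congr_fun h z

theorem IsState.sliceRight_inclLeft_mul {g : B →L[ℂ] ℂ} (hg : IsState g) (a : A)
    (z : MinTensor A B) : hg.sliceRight (inclLeft a * z) = a * hg.sliceRight z := by
  have h : hg.sliceRight.comp (ContinuousLinearMap.mul ℂ (MinTensor A B) (inclLeft a)) =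
      (ContinuousLinearMap.mul ℂ A a).comp hg.sliceRight := clm_ext fun a' b => by
    change hg.sliceRight (tmul a 1 * tmul a' b) = a * hg.sliceRight (tmul a' b)
    rw [tmul_mul]
    simp
  exact DFunLike.congr_fun h z

theorem IsState.sliceRight_mul_inclLeft {g : B →L[ℂ] ℂ} (hg : IsState g) (a : A)
    (z : MinTensor A B) : hg.sliceRight (z * inclLeft a) = hg.sliceRight z * a := by
  have h : hg.sliceRight.comp ((ContinuousLinearMap.mul ℂ (MinTensor A B)).flip (inclLeft a)) =
      ((ContinuousLinearMap.mul ℂ A).flip a).comp hg.sliceRight := clm_ext fun a' b => by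
    change hg.sliceRight (tmul a' b * tmul a 1) = hg.sliceRight (tmul a' b) * a
    rw [tmul_mul]
    simp
  exact DFunLike.congr_fun h z

theorem IsState.map_star {f : A →L[ℂ] ℂ} (hf : IsState f) (a : A) : f (star a) = star (f a) := by
  obtain ⟨π, ξ, -, rfl⟩ := hf.exists_rep
  have h := vecFunctional_star_mul π ξ a 1
  rw [mul_one, _root_.map_one] at h
  rw [h, vecFunctional_apply]
  exact (inner_conj_symm _ _).symm

theorem IsState.sliceRight_star {g : B →L[ℂ] ℂ} (hg : IsState g) (z : MinTensor A B) :
    hg.sliceRight (star z) = star (hg.sliceRight z) := by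
  induction z using MinTensor.induction with
  | hp =>
    have h : Continuous (star : MinTensor A B → MinTensor A B) := continuous_star
    exact isClosed_eq (hg.sliceRight.continuous.comp h) hg.sliceRight.continuous.star
  | zero => simp
  | add x y hx hy => rw [star_add, map_add, map_add, star_add, hx, hy]
  | tmul a b =>
    rw [star_tmul, hg.sliceRight_tmul, hg.sliceRight_tmul, hg.map_star, star_smul]

theorem IsState.sliceRight_inclLeft {g : B →L[ℂ] ℂ} (hg : IsState g) (a : A) :
    hg.sliceRight (inclLeft a) = a := by
  rw [inclLeft_apply, hg.sliceRight_tmul, hg.map_one, one_smul]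

theorem IsState.sliceLeft_inclRight {f : A →L[ℂ] ℂ} (hf : IsState f) (b : B) :
    hf.sliceLeft (inclRight b) = b := by
  rw [inclRight_apply, hf.sliceLeft_tmul, hf.map_one, one_smul]

/-- The Cesàro means of a sequence of states have a cluster point, and it does not distinguish
elements related by the shift of the sequence. -/
theorem exists_cesaro_limit (s : ℕ → A →L[ℂ] ℂ) (hs : ∀ n, IsState (s n)) :
    ∃ h : A →L[ℂ] ℂ, IsState h ∧ ∀ x y, (∀ n, s n y = s (n + 1) x) → h y = h x := by
  -- The limit is taken pointwise along a nonprincipal ultrafilter; it exists because the values at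
  -- `x` stay in the disc of radius `‖x‖`.
  let U : Ultrafilter ℕ := Filter.hyperfilter ℕ
  let c : ℕ → A →L[ℂ] ℂ := fun n => ((n + 1 : ℂ)⁻¹) • ∑ k ∈ Finset.range (n + 1), s k
  have hpos : ∀ n : ℕ, (n + 1 : ℂ) ≠ 0 := fun n => by exact_mod_cast n.succ_ne_zero
  have hc : ∀ n x, c n x = (n + 1 : ℂ)⁻¹ * ∑ k ∈ Finset.range (n + 1), s k x := fun n x => by
    simp [c]
  have hcs : ∀ n, IsState (c n) := fun n =>
    ⟨by
      rw [hc, Finset.sum_congr rfl fun k _ => (hs k).map_one]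
      simp [hpos n], fun x => by
      rw [hc]
      refine mul_nonneg ?_ (Finset.sum_nonneg fun k _ => (hs k).nonneg x)
      rw [inv_nonneg]
      exact_mod_cast (n + 1).zero_le⟩
  have hlim : ∀ x, ∃ l : ℂ, Filter.Tendsto (fun n => c n x) U (nhds l) := fun x => by
    obtain ⟨l, -, hl⟩ := (isCompact_closedBall (0 : ℂ) ‖x‖).ultrafilter_le_nhds
      (U.map fun n => c n x) (by
        refine Filter.le_principal_iff.2 (Ultrafilter.mem_map.2 (Filter.univ_mem' fun n => ?_))
        simpa using (hcs n).norm_apply_le x)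
    exact ⟨l, hl⟩
  choose l hl using hlim
  let h₀ : A →ₗ[ℂ] ℂ :=
    { toFun := l
      map_add' := fun x y => tendsto_nhds_unique (hl (x + y)) (by
        simpa only [map_add] using (hl x).add (hl y))
      map_smul' := fun r x => tendsto_nhds_unique (hl (r • x)) (by
        simpa only [map_smul, RingHom.id_apply] using (hl x).const_smul r) }
  let h : A →L[ℂ] ℂ := h₀.mkContinuous 1 fun x => by
    rw [one_mul]
    exact le_of_tendsto (hl x).norm
      (Filter.Eventually.of_forall fun n : ℕ => (hcs n).norm_apply_le x)
  have hh : ∀ x, Filter.Tendsto (fun n => c n x) U (nhds (h x)) := hl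
  refine ⟨h, ⟨?_, fun x => ?_⟩, fun x y hxy => ?_⟩
  · refine tendsto_nhds_unique (hh 1) ?_
    simp only [(hcs _).map_one]
    exact tendsto_const_nhds
  · exact ge_of_tendsto (hh _) (Filter.Eventually.of_forall fun n => (hcs n).nonneg x)
  -- Since `s k y = s (k + 1) x`, the two Cesàro sums differ only in their end terms, which
  -- contribute at most `2 ‖x‖ / (n + 1)` in norm.
  · have h1 : ∀ n, c n y = c n x + (n + 1 : ℂ)⁻¹ * (s (n + 1) x - s 0 x) := fun n => by
      rw [hc, hc, ← mul_add, Finset.sum_congr rfl fun k _ => hxy k]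
      congr 1
      have h2 := Finset.sum_range_succ (fun k => s k x) (n + 1)
      rw [Finset.sum_range_succ'] at h2
      linear_combination h2
    have h3 : Filter.Tendsto (fun n : ℕ => (n + 1 : ℂ)⁻¹ * (s (n + 1) x - s 0 x))
        Filter.atTop (nhds 0) := by
      refine squeeze_zero_norm (a := fun n : ℕ => (2 * ‖x‖) * (1 / ((n : ℝ) + 1))) (fun n => ?_) ?_
      · have h4 : ‖(n + 1 : ℂ)⁻¹‖ = 1 / ((n : ℝ) + 1) := by
          rw [norm_inv, one_div]
          congr 1
          exact_mod_cast Complex.norm_natCast (n + 1)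
        rw [norm_mul, h4, mul_comm]
        refine mul_le_mul_of_nonneg_right ?_ (by positivity)
        calc ‖s (n + 1) x - s 0 x‖ ≤ ‖s (n + 1) x‖ + ‖s 0 x‖ := norm_sub_le _ _
          _ ≤ ‖x‖ + ‖x‖ := add_le_add ((hs _).norm_apply_le x) ((hs _).norm_apply_le x)
          _ = 2 * ‖x‖ := by ring
      · simpa using tendsto_one_div_add_atTop_nhds_zero_nat.const_mul (2 * ‖x‖)
    have h5 := (hh x).add (h3.mono_left (show (U : Filter ℕ) ≤ Filter.atTop from
      Nat.hyperfilter_le_atTop))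
    rw [add_zero] at h5
    refine tendsto_nhds_unique (hh y) ?_
    simpa only [h1] using h5

variable {Δ : H →⋆ₐ[ℂ] MinTensor H H}

/-- `x ↦ (id ⊗ g) (Δ x)`. -/
def IsState.convRight {g : H →L[ℂ] ℂ} (hg : IsState g) (Δ : H →⋆ₐ[ℂ] MinTensor H H) :
    H →L[ℂ] H := hg.sliceRight.comp (homCLM Δ)

/-- `x ↦ (f ⊗ id) (Δ x)`. -/
def IsState.convLeft {f : H →L[ℂ] ℂ} (hf : IsState f) (Δ : H →⋆ₐ[ℂ] MinTensor H H) :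
    H →L[ℂ] H := hf.sliceLeft.comp (homCLM Δ)

theorem IsState.conv {f g : H →L[ℂ] ℂ} (hf : IsState f) (hg : IsState g) :
    IsState (f.comp (hg.convRight Δ)) :=
  (hf.tensor hg).comp_hom Δ

/-- Both sides are `(f ⊗ g)(Δ x)`, the convolution `f * g` at `x`. Thus `h (hf.convRight Δ x)` is
`(h * f) x` and `h (hf.convLeft Δ x)` is `(f * h) x`. -/
theorem IsState.conv_comm {f g : H →L[ℂ] ℂ} (hf : IsState f) (hg : IsState g) (x : H) :
    f (hg.convRight Δ x) = g (hf.convLeft Δ x) :=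
  hf.fubini hg (Δ x)

/-- Coassociativity with the first leg sliced by `f` and the third by `g`. -/
theorem IsState.convLeft_convRight (hΔ : IsCoassociative Δ Δ) {f g : H →L[ℂ] ℂ}
    (hf : IsState f) (hg : IsState g) (x : H) :
    hf.convLeft Δ (hg.convRight Δ x) = hg.convRight Δ (hf.convLeft Δ x) := by
  have h := congrArg (fun w => hg.sliceRight (hf.sliceLeft₃ w)) (hΔ x)
  simp only [hf.slice_assocLeft, hf.sliceLeft₃_assocRight, hg.sliceRight_map,
    hf.sliceLeft_map] at h
  exact h

/-- Associativity of convolution, obtained by pairing with an arbitrary state `e` and moving `e` to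
the left, where it commutes with convolution on the right. -/
theorem IsState.convRight_convRight (hΔ : IsCoassociative Δ Δ) {f g : H →L[ℂ] ℂ}
    (hf : IsState f) (hg : IsState g) (x : H) :
    hf.convRight Δ (hg.convRight Δ x) = (hf.conv hg (Δ := Δ)).convRight Δ x :=
  eq_of_states fun e he => by
    rw [he.conv_comm, he.conv_comm, he.convLeft_convRight hΔ]
    rfl

/-- Every state has an invariant state for the convolution with it from both sides. -/
theorem IsState.exists_invariant (hΔ : IsCoassociative Δ Δ) {f : H →L[ℂ] ℂ} (hf : IsState f) :
    ∃ h : H →L[ℂ] ℂ, IsState h ∧ (∀ x, h (hf.convRight Δ x) = h x) ∧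
      ∀ x, h (hf.convLeft Δ x) = h x := by
  -- `s n` is the convolution power of `f` with `n + 1` factors. It can be lengthened from either
  -- end, so one limit is invariant on both sides.
  let s : ℕ → H →L[ℂ] ℂ := fun n => n.rec f fun _ g => g.comp (hf.convRight Δ)
  have hs : ∀ n, IsState (s n) := fun n => by
    induction n with
    | zero => exact hf
    | succ n ih => exact ih.conv hf
  obtain ⟨h, hh, hinv⟩ := exists_cesaro_limit s hs
  refine ⟨h, hh, fun x => hinv _ _ fun n => rfl, fun x => hinv _ _ fun n => ?_⟩
  induction n generalizing x with
  | zero => exact (hf.conv_comm hf x).symm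
  | succ n ih =>
    change s n (hf.convRight Δ (hf.convLeft Δ x)) = s (n + 1) (hf.convRight Δ x)
    rw [← hf.convLeft_convRight hΔ, ih]

/-- If `h` is invariant under the average of the states `f` and `g`, then `f * h = h`. -/
theorem IsCompactQuantumGroup.conv_eq_of_average (hΔ : IsCompactQuantumGroup Δ)
    {f g h ω : H →L[ℂ] ℂ} (hf : IsState f) (hg : IsState g) (hh : IsState h) (hω : IsState ω)
    (hav : ω = (2⁻¹ : ℂ) • (f + g)) (h1 : ∀ x, h (hω.convRight Δ x) = h x)
    (h2 : ∀ x, h (hω.convLeft Δ x) = h x) (x : H) :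
    f (hh.convRight Δ x) = h x := by
  -- This is `ω * h = h` read on elements: convolving on the right with `h` and then with `ω` is the
  -- same as convolving with `h`.
  have hfix : ∀ b, hω.convRight Δ (hh.convRight Δ b) = hh.convRight Δ b := fun b =>
    eq_of_states fun e he => by
      rw [he.conv_comm, he.convLeft_convRight hΔ.coassoc, hω.conv_comm, h2, ← he.conv_comm]
  -- For `y = (id ⊗ h)(Δ b)` and `d = Δ y - y ⊗ 1`, the identity `(id ⊗ ω)(Δ y) = y` turns `(id ⊗
  -- ω)(star d * d)` into `(id ⊗ ω)(Δ (star y * y)) - star y * y`, which `h` kills since `h * ω =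
  -- h`.
  have hzero : ∀ b, h (hω.sliceRight
      (star (Δ (hh.convRight Δ b) - inclLeft (hh.convRight Δ b)) *
        (Δ (hh.convRight Δ b) - inclLeft (hh.convRight Δ b)))) = 0 := fun b => by
    set y := hh.convRight Δ b with hy
    have h3 : star (Δ y - inclLeft y) * (Δ y - inclLeft y) =
        Δ (star y * y) - inclLeft (star y) * Δ y - Δ (star y) * inclLeft y +
          inclLeft (star y * y) := by
      rw [star_sub, map_mul, map_mul, map_star, map_star]
      noncomm_ring
    have h4 : hω.sliceRight (Δ y) = y := hfix b
    have h5 : hω.sliceRight (Δ (star y)) = star y := by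
      rw [map_star, hω.sliceRight_star, h4]
    rw [h3, map_add, map_sub, map_sub, hω.sliceRight_inclLeft_mul, hω.sliceRight_mul_inclLeft,
      hω.sliceRight_inclLeft, h4, h5, sub_add_cancel, map_sub, sub_eq_zero]
    exact h1 _
  have hsplit : ∀ z : MinTensor H H, hω.sliceRight z =
      (2⁻¹ : ℂ) • (hf.sliceRight z + hg.sliceRight z) := fun z => by
    have h3 : hω.sliceRight = (2⁻¹ : ℂ) • (hf.sliceRight (A := H) + hg.sliceRight) :=
      clm_ext fun a b => by
        simp [hav, add_smul, smul_smul]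
    exact DFunLike.congr_fun h3 z
  -- The value `(h ⊗ ω)(star d * d) = 0` is the average of two nonnegative numbers, so the `f` part
  -- vanishes. Then `(h ⊗ f)((a ⊗ 1) d) = 0` by Cauchy–Schwarz for the state `h ⊗ f`.
  have hmul : ∀ a b, h (a * hf.convRight Δ (hh.convRight Δ b)) = h (a * hh.convRight Δ b) :=
    fun a b => by
    set d := Δ (hh.convRight Δ b) - inclLeft (hh.convRight Δ b) with hd
    have h3 : h (hf.sliceRight (star d * d)) = 0 := by
      have h4 := hzero b
      rw [hsplit, map_smul, map_add, smul_eq_mul] at h4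
      have h5 : h (hf.sliceRight (star d * d)) + h (hg.sliceRight (star d * d)) = 0 :=
        (mul_eq_zero.1 h4).resolve_left (by norm_num)
      exact ((add_eq_zero_iff_of_nonneg ((hh.tensor hf).nonneg d)
        ((hh.tensor hg).nonneg d)).1 h5).1
    have h6 : h (hf.sliceRight (inclLeft a * d)) = 0 :=
      (hh.tensor hf).map_mul_eq_zero h3 (inclLeft a)
    rw [hf.sliceRight_inclLeft_mul, hd, map_sub, hf.sliceRight_inclLeft, mul_sub, map_sub,
      sub_eq_zero] at h6
    exact h6
  -- `hmul` says that `h ⊗ (f * h)` and `h ⊗ h` agree on `(a ⊗ 1) Δ b`. These products span a dense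
  -- subspace, so the functionals coincide; evaluation at `1 ⊗ x` then gives the claim.
  have heq : h.comp (hf.conv hh (Δ := Δ)).sliceRight = h.comp (hh.sliceRight (A := H)) := by
    refine ContinuousLinearMap.ext_on hΔ.dense_left ?_
    rintro _ ⟨a, b, rfl⟩
    change h ((hf.conv hh (Δ := Δ)).sliceRight _) = h (hh.sliceRight _)
    rw [(hf.conv hh (Δ := Δ)).sliceRight_inclLeft_mul, hh.sliceRight_inclLeft_mul]
    have h7 := hmul a b
    rwa [hf.convRight_convRight hΔ.coassoc] at h7
  have h8 := DFunLike.congr_fun heq (tmul 1 x)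
  change h ((hf.conv hh (Δ := Δ)).sliceRight _) = h (hh.sliceRight _) at h8
  rw [IsState.sliceRight_tmul, IsState.sliceRight_tmul, map_smul, map_smul, hh.map_one] at h8
  simpa using h8

/-- The comultiplication of a compact quantum group is ergodic. -/
theorem IsCompactQuantumGroup.exists_smul_one (hΔ : IsCompactQuantumGroup Δ) {z : H}
    (hz : Δ z = inclLeft z) : ∃ r : ℂ, z = r • 1 := by
  rcases subsingleton_or_nontrivial H with hH | hH
  · exact ⟨0, Subsingleton.elim _ _⟩
  obtain ⟨e, he⟩ := exists_isState (A := H)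
  refine ⟨e z, eq_of_states fun f hf => ?_⟩
  -- Averaging `e` with `f` gives one invariant state `h` that absorbs both, so that `e z = h z = f
  -- z`.
  have hω := isState_average he hf
  obtain ⟨h, hh, h1, h2⟩ := hω.exists_invariant hΔ.coassoc
  have h3 : hh.convRight Δ z = z := by
    change hh.sliceRight (Δ z) = z
    rw [hz, hh.sliceRight_inclLeft]
  have h4 := hΔ.conv_eq_of_average he hf hh hω rfl h1 h2 z
  have h5 := hΔ.conv_eq_of_average hf he hh hω (by rw [add_comm]) h1 h2 z
  rw [h3] at h4 h5
  rw [map_smul, hf.map_one, smul_eq_mul, mul_one, h4, h5]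

theorem IsState.sliceLeft₃_inclLeft {f : A →L[ℂ] ℂ} (hf : IsState f) (z : MinTensor A B) :
    hf.sliceLeft₃ (MinTensor₃.inclLeft z : MinTensor₃ A B C) = inclLeft (hf.sliceLeft z) := by
  have h : hf.sliceLeft₃.comp (homCLM (MinTensor₃.inclLeft (A := A) (B := B) (C := C))) =
      (homCLM inclLeft).comp hf.sliceLeft := clm_ext fun a b => by
    have h1 : (MinTensor₃.inclLeft (tmul a b) : MinTensor₃ A B C) = MinTensor₃.tmul a b 1 :=
      MinTensor₃.inclLeft_of _
    simp [h1, inclLeft_apply]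
  exact DFunLike.congr_fun h z

/-- An element `z` of `A ⊗ H` with `(id ⊗ Δ) z = z ⊗ 1` belongs to `A ⊗ 1`. -/
theorem IsCompactQuantumGroup.exists_inclLeft (hΔ : IsCompactQuantumGroup Δ) {z : MinTensor A H}
    (hz : MinTensor₃.assocRight (map (StarAlgHom.id ℂ A) Δ z) = MinTensor₃.inclLeft z) :
    ∃ a : A, inclLeft a = z := by
  rcases subsingleton_or_nontrivial H with hH | hH
  · have h1 : (1 : MinTensor A H) = 0 := by
      rw [← tmul_one_one, Subsingleton.elim (1 : H) 0, tmul, TensorProduct.tmul_zero, map_zero]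
    have := subsingleton_of_zero_eq_one h1.symm
    exact ⟨0, Subsingleton.elim _ _⟩
  obtain ⟨e, he⟩ := exists_isState (A := H)
  -- The slice of `z` by any state `f` is a fixed element of `Δ`, hence a scalar `r`. The candidate
  -- `a = (id ⊗ e) z` has `f a = r` by Fubini, so `a ⊗ 1` and `z` have the same slices.
  refine ⟨he.sliceRight z, sub_eq_zero.1 (eq_zero_of_slices fun f hf => ?_)⟩
  obtain ⟨r, hr⟩ := hΔ.exists_smul_one (z := hf.sliceLeft z) (by
    rw [← hf.sliceLeft_map, ← hf.sliceLeft₃_inclLeft (C := H), ← hz, hf.sliceLeft₃_assocRight])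
  rw [map_sub, inclLeft_apply, hf.sliceLeft_tmul, hf.fubini, hr, map_smul, he.map_one]
  simp

end Convolution

/-! ### Idempotents in finite-dimensional algebras and rigidity of idempotent paths -/

section Idempotents

variable {K B : Type u} [CStarAlgebra K] [CStarAlgebra B]

/-- An element of a finite-dimensional algebra has finite spectrum. -/
theorem finite_spectrum_of_finiteDimensional [FiniteDimensional ℂ K] (a : K) :
    (spectrum ℂ a).Finite := by
  have hint : IsIntegral ℂ a := Algebra.IsIntegral.isIntegral a
  refine ((minpoly ℂ a).roots.toFinset.finite_toSet).subset fun r hr => ?_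
  -- Spectral mapping for the minimal polynomial: its value at `r` lies in the spectrum of `0`, so
  -- `r` is one of its finitely many roots.
  have h1 := spectrum.subset_polynomial_aeval a (minpoly ℂ a) ⟨r, hr, rfl⟩
  rw [minpoly.aeval] at h1
  have h2 : (minpoly ℂ a).eval r = 0 := by
    by_contra h
    refine h1 ?_
    change IsUnit (algebraMap ℂ K ((minpoly ℂ a).eval r) - 0)
    rw [sub_zero]
    exact (IsUnit.mk0 _ h).map (algebraMap ℂ K)
  simpa [minpoly.ne_zero hint] using h2

/-- A finite-dimensional `C*`-algebra is spanned by its idempotents. -/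
theorem span_isIdempotentElem [FiniteDimensional ℂ K] :
    Submodule.span ℂ {e : K | IsIdempotentElem e} = ⊤ := by
  have hsa : ∀ a : K, IsSelfAdjoint a → a ∈ Submodule.span ℂ {e : K | IsIdempotentElem e} := by
    intro a ha
    have hn : IsStarNormal a := ha.isStarNormal
    have hfin := finite_spectrum_of_finiteDimensional a
    -- On a finite spectrum every function is continuous. The indicators of the spectral points
    -- therefore have images under the functional calculus, and `a` is a combination of these
    -- idempotents.
    have hcont : ∀ g : ℂ → ℂ, ContinuousOn g (spectrum ℂ a) := fun g => hfin.continuousOn g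
    classical
    let ind : ℂ → ℂ → ℂ := fun r x => if x = r then 1 else 0
    have h1 : a = ∑ r ∈ hfin.toFinset, r • cfc (ind r) a := by
      calc a = cfc id a := (cfc_id ℂ a).symm
        _ = cfc (fun x => ∑ r ∈ hfin.toFinset, r * ind r x) a := by
            refine cfc_congr fun x hx => ?_
            simp only [ind, mul_ite, mul_one, mul_zero, id]
            rw [Finset.sum_ite_eq, if_pos (hfin.mem_toFinset.2 hx)]
        _ = ∑ r ∈ hfin.toFinset, cfc (fun x => r * ind r x) a := by
            have := cfc_sum (fun r x => r * ind r x) a hfin.toFinset (fun r _ => hcont _)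
            convert this using 2
            ext x
            simp
        _ = ∑ r ∈ hfin.toFinset, r • cfc (ind r) a :=
            Finset.sum_congr rfl fun r _ => cfc_const_mul r (ind r) a (hcont _)
    rw [h1]
    refine Submodule.sum_mem _ fun r _ => Submodule.smul_mem _ _ (Submodule.subset_span ?_)
    change cfc (ind r) a * cfc (ind r) a = cfc (ind r) a
    rw [← cfc_mul _ _ a (hcont _) (hcont _)]
    congr 1
    ext x
    simp [ind]
  refine eq_top_iff.2 fun k _ => ?_
  rw [← realPart_add_I_smul_imaginaryPart k]
  exact Submodule.add_mem _ (hsa _ (realPart k).2)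
    (Submodule.smul_mem _ _ (hsa _ (imaginaryPart k).2))

/-- A path of idempotents that starts at `0` is constant. -/
theorem eq_zero_of_idempotent_path {e : unitInterval → B} (hc : Continuous e)
    (he : ∀ t, IsIdempotentElem (e t)) (h0 : e 0 = 0) (t : unitInterval) : e t = 0 := by
  -- A nonzero idempotent has norm at least `1`, so vanishing is an open condition along the path as
  -- well as a closed one.
  have h1 : {t | e t = 0} = {t | ‖e t‖ < 1} := by
    ext t
    refine ⟨fun h => ?_, fun h => ?_⟩
    · change ‖e t‖ < 1
      rw [show e t = 0 from h, norm_zero]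
      exact one_pos
    · by_contra hne
      have h2 : ‖e t‖ ≤ ‖e t‖ * ‖e t‖ := by
        conv_lhs => rw [← (he t).eq]
        exact norm_mul_le _ _
      have h3 : 0 < ‖e t‖ := norm_pos_iff.2 hne
      have h4 : ‖e t‖ < 1 := h
      nlinarith
  have hclopen : IsClopen {t | e t = 0} :=
    ⟨isClosed_eq hc continuous_const, h1 ▸ isOpen_lt hc.norm continuous_const⟩
  have h5 := hclopen.eq_univ ⟨0, h0⟩
  exact (Set.eq_univ_iff_forall.1 h5) t

/-- A path of idempotents that starts at a scalar is constant. -/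
theorem idempotent_path_eq {e : unitInterval → B} (hc : Continuous e)
    (he : ∀ t, IsIdempotentElem (e t)) {r : ℂ} (h0 : e 0 = r • 1) (t : unitInterval) :
    e t = e 0 := by
  rcases subsingleton_or_nontrivial B with hB | hB
  · exact Subsingleton.elim _ _
  have h1 : r * r = r := by
    have h := (he 0).eq
    rw [h0, smul_mul_smul_comm, one_mul] at h
    exact smul_left_injective ℂ (one_ne_zero (α := B)) h
  rcases IsIdempotentElem.iff_eq_zero_or_one.1 h1 with rfl | rfl
  · rw [zero_smul] at h0
    rw [h0, eq_zero_of_idempotent_path hc he h0]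
  · rw [one_smul] at h0
    -- A path starting at `1` is reduced to one starting at `0` by passing to the complementary
    -- idempotents.
    have h2 := eq_zero_of_idempotent_path (e := fun t => 1 - e t) (continuous_const.sub hc)
      (fun t => (he t).one_sub) (by simp [h0]) t
    rw [h0]
    exact (sub_eq_zero.1 h2).symm

end Idempotents

/-! ### The Galois map of a finite-dimensional quantum group, replacing the antipode -/

section Galois

variable {K : Type u} [Ring K] [Algebra ℂ K]

/-- The linear map `x ⊗ y ↦ (1 ⊗ x) D(y)`. -/
def galois (D : K →ₐ[ℂ] K ⊗[ℂ] K) : K ⊗[ℂ] K →ₗ[ℂ] K ⊗[ℂ] K :=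
  LinearMap.mul' ℂ (K ⊗[ℂ] K) ∘ₗ TensorProduct.map
    (Algebra.TensorProduct.includeRight : K →ₐ[ℂ] K ⊗[ℂ] K).toLinearMap D.toLinearMap

variable (D : K →ₐ[ℂ] K ⊗[ℂ] K)

@[simp]
theorem galois_tmul (x y : K) : galois D (x ⊗ₜ y) = (1 ⊗ₜ[ℂ] x) * D y := by
  simp [galois]

/-- With `galois_mul_tmul`, this makes `galois D` a bimodule map. The formulas for its inverse below
are verified by applying `galois D` to both sides and using these two rules. -/
theorem galois_tmul_mul (b : K) (r : K ⊗[ℂ] K) :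
    galois D ((b ⊗ₜ 1) * r) = (1 ⊗ₜ b) * galois D r := by
  induction r using TensorProduct.induction_on with
  | zero => simp
  | add r s hr hs => rw [mul_add, map_add, map_add, mul_add, hr, hs]
  | tmul x y =>
    rw [Algebra.TensorProduct.tmul_mul_tmul, galois_tmul, galois_tmul, ← mul_assoc,
      Algebra.TensorProduct.tmul_mul_tmul, one_mul, one_mul]

theorem galois_mul_tmul (r : K ⊗[ℂ] K) (y : K) :
    galois D (r * (1 ⊗ₜ y)) = galois D r * D y := by
  induction r using TensorProduct.induction_on with
  | zero => simp
  | add r s hr hs => rw [add_mul, map_add, map_add, add_mul, hr, hs]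
  | tmul x y =>
    rw [Algebra.TensorProduct.tmul_mul_tmul, galois_tmul, galois_tmul, map_mul, mul_one,
      mul_assoc]

/-- `(a ⊗ b) ⊗ (c ⊗ d) ↦ (a ⊗ c) ⊗ b d`. -/
def mulLast : (K ⊗[ℂ] K) ⊗[ℂ] (K ⊗[ℂ] K) →ₗ[ℂ] (K ⊗[ℂ] K) ⊗[ℂ] K :=
  (LinearMap.mul' ℂ K).lTensor (K ⊗[ℂ] K) ∘ₗ
    (TensorProduct.tensorTensorTensorComm ℂ K K K K).toLinearMap

@[simp]
theorem mulLast_tmul (a b c d : K) :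
    mulLast ((a ⊗ₜ b) ⊗ₜ[ℂ] (c ⊗ₜ d)) = (a ⊗ₜ c) ⊗ₜ[ℂ] (b * d) := by
  simp [mulLast]

theorem galois_rTensor_mulLast (p q : K ⊗[ℂ] K) :
    (galois D).rTensor K (mulLast (p ⊗ₜ q)) =
      (Algebra.TensorProduct.assoc ℂ ℂ ℂ K K K).symm (1 ⊗ₜ p) *
        Algebra.TensorProduct.map D (AlgHom.id ℂ K) q := by
  induction p using TensorProduct.induction_on with
  | zero => simp
  | add p p' hp hp' =>
    rw [TensorProduct.add_tmul, map_add, map_add, hp, hp', TensorProduct.tmul_add, map_add,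
      add_mul]
  | tmul a b =>
    induction q using TensorProduct.induction_on with
    | zero => simp
    | add q q' hq hq' =>
      rw [TensorProduct.tmul_add, map_add, map_add, hq, hq', map_add, mul_add]
    | tmul c d => simp [Algebra.TensorProduct.assoc_symm_tmul]

/-- Coassociativity of an algebra homomorphism `K → K ⊗ K`. -/
def AlgCoassoc : Prop := ∀ k, Algebra.TensorProduct.assoc ℂ ℂ ℂ K K K
  (Algebra.TensorProduct.map D (AlgHom.id ℂ K) (D k)) =
    Algebra.TensorProduct.map (AlgHom.id ℂ K) D (D k)

variable {D}

/-- The Galois map `T` intertwines the diagonal coaction `x ⊗ y ↦ x₁ ⊗ y₁ ⊗ x₂ y₂` with `id ⊗ D`: on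
`x ⊗ y` both sides are `(1 ⊗ D x) (id ⊗ D)(D y)` up to rebracketing, by coassociativity. -/
theorem galois_rTensor_mulLast_map (hD : AlgCoassoc D) (t : K ⊗[ℂ] K) :
    (galois D).rTensor K (mulLast (TensorProduct.map D.toLinearMap D.toLinearMap t)) =
      (Algebra.TensorProduct.assoc ℂ ℂ ℂ K K K).symm
        (Algebra.TensorProduct.map (AlgHom.id ℂ K) D (galois D t)) := by
  induction t using TensorProduct.induction_on with
  | zero => simp
  | add s t hs ht => simp only [map_add, hs, ht]
  | tmul x y =>
    rw [TensorProduct.map_tmul, AlgHom.toLinearMap_apply, AlgHom.toLinearMap_apply,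
      galois_rTensor_mulLast, galois_tmul, map_mul, map_mul, ← hD, AlgEquiv.symm_apply_apply,
      Algebra.TensorProduct.map_tmul, map_one]

variable (hT : Function.Bijective (galois D))

/-- The inverse of the Galois map. -/
def galoisInv : K ⊗[ℂ] K →ₗ[ℂ] K ⊗[ℂ] K := (LinearEquiv.ofBijective (galois D) hT).symm

theorem galois_galoisInv (t : K ⊗[ℂ] K) : galois D (galoisInv hT t) = t :=
  (LinearEquiv.ofBijective (galois D) hT).apply_symm_apply t

/-- Coinvariance of `T⁻¹(k ⊗ 1)` under the diagonal coaction. It transports the evident coinvariance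
of `k ⊗ 1` under `id ⊗ D` through the intertwining property; `T ⊗ id` is injective by flatness. -/
theorem mulLast_galoisInv (hD : AlgCoassoc D) (hT : Function.Bijective (galois D)) (k : K) :
    mulLast (TensorProduct.map D.toLinearMap D.toLinearMap (galoisInv hT (k ⊗ₜ 1))) =
      (galoisInv hT (k ⊗ₜ 1)) ⊗ₜ[ℂ] (1 : K) := by
  have hinj : Function.Injective ((galois D).rTensor K) :=
    Module.Flat.rTensor_preserves_injective_linearMap _ hT.1
  apply hinj
  rw [galois_rTensor_mulLast_map hD, LinearMap.rTensor_tmul, galois_galoisInv]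
  simp [Algebra.TensorProduct.one_def]

theorem galoisInv_tmul (a b : K) :
    galoisInv hT (a ⊗ₜ b) = (b ⊗ₜ 1) * galoisInv hT (a ⊗ₜ 1) := by
  apply hT.1
  rw [galois_tmul_mul, galois_galoisInv, galois_galoisInv]
  simp

theorem galoisInv_comul (k : K) : galoisInv hT (D k) = 1 ⊗ₜ k := by
  apply hT.1
  rw [galois_galoisInv, galois_tmul, ← Algebra.TensorProduct.one_def, one_mul]

/-- For a tensor `r` with `galois r = k ⊗ 1`, the map
`x ⊗ y ↦ (x ⊗ 1) r (1 ⊗ y)` corresponds to the left multiplication by `k ⊗ 1`. -/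
def sandwich (r : K ⊗[ℂ] K) : K ⊗[ℂ] K →ₗ[ℂ] K ⊗[ℂ] K :=
  TensorProduct.lift (LinearMap.mk₂ ℂ (fun x y => (x ⊗ₜ[ℂ] (1 : K)) * r * ((1 : K) ⊗ₜ[ℂ] y))
    (fun x x' y => by rw [TensorProduct.add_tmul, add_mul, add_mul])
    (fun c x y => by rw [← TensorProduct.smul_tmul', smul_mul_assoc, smul_mul_assoc])
    (fun x y y' => by rw [TensorProduct.tmul_add, mul_add])
    (fun c x y => by rw [TensorProduct.tmul_smul, mul_smul_comm]))

@[simp]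
theorem sandwich_tmul (r : K ⊗[ℂ] K) (x y : K) :
    sandwich r (x ⊗ₜ y) = (x ⊗ₜ[ℂ] (1 : K)) * r * ((1 : K) ⊗ₜ[ℂ] y) := rfl

/-- The outer factors `x ⊗ 1` and `1 ⊗ y` leave `T` as `1 ⊗ x` on the left and `D y` on the right,
and `1 ⊗ x` commutes with the remaining `k ⊗ 1`. -/
theorem galois_sandwich (k : K) (s : K ⊗[ℂ] K) :
    galois D (sandwich (galoisInv hT (k ⊗ₜ 1)) s) = (k ⊗ₜ 1) * galois D s := by
  induction s using TensorProduct.induction_on with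
  | zero => simp
  | add s t hs ht => rw [map_add, map_add, map_add, mul_add, hs, ht]
  | tmul x y =>
    rw [sandwich_tmul, galois_mul_tmul, galois_tmul_mul, galois_galoisInv, galois_tmul,
      ← mul_assoc]
    simp

theorem galoisInv_mul (k l : K) :
    galoisInv hT ((k * l) ⊗ₜ 1) = sandwich (galoisInv hT (k ⊗ₜ 1)) (galoisInv hT (l ⊗ₜ 1)) := by
  apply hT.1
  rw [galois_sandwich, galois_galoisInv, galois_galoisInv]
  simp

end Galois

/-! ### From minimal to algebraic tensor products in finite dimension -/

section FiniteDimensional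

open MinTensor

variable {A B C K : Type u} [CStarAlgebra A] [CStarAlgebra B] [CStarAlgebra C] [CStarAlgebra K]

/-- States separate the elements of an algebraic tensor product. -/
theorem tensor_eq_zero_of_slices {Y : Type u} [Ring Y] [Algebra ℂ Y] [StarRing Y]
    [StarModule ℂ Y] {t : A ⊗[ℂ] Y}
    (h : ∀ f : A →L[ℂ] ℂ, IsState f → algSliceLeft f.toLinearMap t = 0) : t = 0 := by
  -- Expanding `t` in a basis of `Y` gives coefficients in `A`. Applying `f` to a coefficient is
  -- taking a coordinate of the slice, so every state kills every coefficient.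
  let b := Module.Free.chooseBasis ℂ Y
  refine (TensorProduct.equivFinsuppOfBasisRight b).map_eq_zero_iff.1 (Finsupp.ext fun i => ?_)
  refine eq_zero_of_states fun f hf => ?_
  have key : ∀ t : A ⊗[ℂ] Y, f (TensorProduct.equivFinsuppOfBasisRight b t i) =
      b.repr (algSliceLeft f.toLinearMap t) i := fun t => by
    induction t using TensorProduct.induction_on with
    | zero => simp
    | add s t hs ht => simp only [map_add, Finsupp.add_apply, hs, ht]
    | tmul x y =>
      rw [TensorProduct.equivFinsuppOfBasisRight_apply_tmul_apply]
      simp [mul_comm]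
  rw [key, h f hf]
  simp

/-- Slice maps extend to the completion, so a tensor that vanishes there has all slices zero. -/
theorem MinTensor.of_injective : Function.Injective (of : A ⊗[ℂ] B → MinTensor A B) :=
  (injective_iff_map_eq_zero (of : A ⊗[ℂ] B →⋆ₐ[ℂ] MinTensor A B)).2 fun t ht =>
    tensor_eq_zero_of_slices fun f hf => by rw [← hf.sliceLeft_of, ht, map_zero]

theorem MinTensor₃.of_injective :
    Function.Injective (of : A ⊗[ℂ] (B ⊗[ℂ] C) → MinTensor₃ A B C) :=
  (injective_iff_map_eq_zero (of : A ⊗[ℂ] (B ⊗[ℂ] C) →⋆ₐ[ℂ] MinTensor₃ A B C)).2 fun t ht =>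
    tensor_eq_zero_of_slices fun f hf => MinTensor.of_injective (by
      rw [← hf.sliceLeft₃_of, ht, map_zero, map_zero])

/-- A linear map from a finite-dimensional space whose range contains a set with dense span is
surjective. -/
theorem surjective_of_dense_span {V W : Type*} [AddCommGroup V] [Module ℂ V]
    [FiniteDimensional ℂ V] [NormedAddCommGroup W] [NormedSpace ℂ W] (L : V →ₗ[ℂ] W) {s : Set W}
    (hs : Dense (Submodule.span ℂ s : Set W)) (h : s ⊆ LinearMap.range L) :
    Function.Surjective L := by
  have hc : IsClosed (LinearMap.range L : Set W) := Submodule.closed_of_finiteDimensional _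
  have h1 : (Submodule.span ℂ s : Set W) ⊆ LinearMap.range L := Submodule.span_le.2 h
  intro w
  have h2 : w ∈ closure (Submodule.span ℂ s : Set W) := hs w
  exact closure_minimal h1 hc h2

variable [FiniteDimensional ℂ K]

theorem MinTensor.of_surjective : Function.Surjective (of : K ⊗[ℂ] K → MinTensor K K) := by
  refine surjective_of_dense_span (MinTensor.of (A := K) (B := K)).toAlgHom.toLinearMap
    (s := Set.range (of : K ⊗[ℂ] K → MinTensor K K)) ?_ fun x hx => hx
  exact (RepFamily.denseRange_of _).mono Submodule.subset_span

/-- The algebraic and the minimal tensor square of a finite-dimensional `C*`-algebra agree. -/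
def ofEquiv : K ⊗[ℂ] K ≃ₐ[ℂ] MinTensor K K :=
  AlgEquiv.ofBijective (MinTensor.of (A := K) (B := K)).toAlgHom
    ⟨MinTensor.of_injective, MinTensor.of_surjective⟩

/-- The comultiplication of a finite-dimensional compact quantum group, with values in the
algebraic tensor product. -/
def algComul (ΔK : K →⋆ₐ[ℂ] MinTensor K K) : K →ₐ[ℂ] K ⊗[ℂ] K :=
  (ofEquiv (K := K)).symm.toAlgHom.comp ΔK.toAlgHom

theorem of_algComul (ΔK : K →⋆ₐ[ℂ] MinTensor K K) (k : K) : of (algComul ΔK k) = ΔK k :=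
  (ofEquiv (K := K)).apply_symm_apply (ΔK k)

theorem assocLeft_of (t : A ⊗[ℂ] B) (c : C) :
    MinTensor₃.assocLeft (of (of t ⊗ₜ c)) = MinTensor₃.of (algAssoc (t ⊗ₜ c)) :=
  (RepFamily.lift_of _ _ _).trans (MinTensor₃.preLeft_of t c)

theorem assocRight_of (a : A) (t : B ⊗[ℂ] C) :
    MinTensor₃.assocRight (of (a ⊗ₜ of t)) = MinTensor₃.of (a ⊗ₜ t) :=
  (RepFamily.lift_of _ _ _).trans (MinTensor₃.preRight_of a t)

variable {ΔK : K →⋆ₐ[ℂ] MinTensor K K}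

theorem algCoassoc_algComul (h : IsCoassociative ΔK ΔK) : AlgCoassoc (algComul ΔK) := by
  intro k
  apply MinTensor₃.of_injective
  have hl : ∀ t : K ⊗[ℂ] K, MinTensor₃.assocLeft (map ΔK (StarAlgHom.id ℂ K) (of t)) =
      MinTensor₃.of (Algebra.TensorProduct.assoc ℂ ℂ ℂ K K K
        (Algebra.TensorProduct.map (algComul ΔK) (AlgHom.id ℂ K) t)) := fun t => by
    induction t using TensorProduct.induction_on with
    | zero => simp only [map_zero]
    | add s t hs ht => simp only [map_add, hs, ht]
    | tmul a b =>
      change MinTensor₃.assocLeft (map ΔK (StarAlgHom.id ℂ K) (tmul a b)) = _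
      rw [map_tmul, ← of_algComul]
      exact assocLeft_of _ _
  have hr : ∀ t : K ⊗[ℂ] K, MinTensor₃.assocRight (map (StarAlgHom.id ℂ K) ΔK (of t)) =
      MinTensor₃.of (Algebra.TensorProduct.map (AlgHom.id ℂ K) (algComul ΔK) t) := fun t => by
    induction t using TensorProduct.induction_on with
    | zero => simp only [map_zero]
    | add s t hs ht => simp only [map_add, hs, ht]
    | tmul a b =>
      change MinTensor₃.assocRight (map (StarAlgHom.id ℂ K) ΔK (tmul a b)) = _
      rw [map_tmul, ← of_algComul]
      exact assocRight_of _ _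
  rw [← hl, ← hr, of_algComul]
  exact h k

/-- The range of the Galois map corresponds to the span of `(1 ⊗ K) Δ_K(K)`, which is dense, and in
finite dimension that means everything. A surjective endomorphism of a finite-dimensional space is
injective. -/
theorem galois_bijective (h : IsCompactQuantumGroup ΔK) :
    Function.Bijective (galois (algComul ΔK)) := by
  have hs : Function.Surjective ((MinTensor.of (A := K) (B := K)).toAlgHom.toLinearMap ∘ₗ
      galois (algComul ΔK)) := by
    refine surjective_of_dense_span _ h.dense_right ?_
    rintro _ ⟨x, y, rfl⟩
    refine ⟨x ⊗ₜ y, ?_⟩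
    change MinTensor.of (galois (algComul ΔK) (x ⊗ₜ y)) = _
    rw [galois_tmul, map_mul, of_algComul]
    rfl
  have hs' : Function.Surjective (galois (algComul ΔK)) := fun t => by
    obtain ⟨r, hr⟩ := hs (MinTensor.of t)
    exact ⟨r, MinTensor.of_injective hr⟩
  exact ⟨LinearMap.injective_iff_surjective.2 hs', hs'⟩

/-- `span (K ⊗ 1) Δ(K)` is all of `K ⊗ K`. -/
theorem mem_span_mul_algComul (h : IsCompactQuantumGroup ΔK) (t : K ⊗[ℂ] K) :
    t ∈ Submodule.span ℂ {s | ∃ x y, s = (x ⊗ₜ[ℂ] (1 : K)) * algComul ΔK y} := by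
  set N := Submodule.span ℂ {s | ∃ x y, s = (x ⊗ₜ[ℂ] (1 : K)) * algComul ΔK y}
  have hs : Function.Surjective ((MinTensor.of (A := K) (B := K)).toAlgHom.toLinearMap ∘ₗ
      N.subtype) := by
    refine surjective_of_dense_span _ h.dense_left ?_
    rintro _ ⟨x, y, rfl⟩
    refine ⟨⟨(x ⊗ₜ[ℂ] (1 : K)) * algComul ΔK y, Submodule.subset_span ⟨x, y, rfl⟩⟩, ?_⟩
    change MinTensor.of ((x ⊗ₜ[ℂ] (1 : K)) * algComul ΔK y) = _
    rw [map_mul, of_algComul]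
    rfl
  obtain ⟨r, hr⟩ := hs (MinTensor.of t)
  rw [← MinTensor.of_injective hr]
  exact r.2

end FiniteDimensional

/-! ### Equivariant maps into `A ⊗ H`: constancy and triviality -/

section Equivariant

open MinTensor

variable {A H K : Type u} [CStarAlgebra A] [CStarAlgebra H] [CStarAlgebra K]

theorem MinTensor₃.inclLeft_tmul (a : A) (b : H) :
    (MinTensor₃.inclLeft (MinTensor.tmul a b) : MinTensor₃ A H K) = MinTensor₃.tmul a b 1 :=
  MinTensor₃.inclLeft_of _

theorem MinTensor₃.inclThird_apply' (c : K) :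
    (MinTensor₃.inclThird c : MinTensor₃ A H K) = MinTensor₃.tmul 1 1 c := rfl

theorem MinTensor₃.tmul_eq (a : A) (b : H) (c : K) :
    MinTensor₃.tmul a b c = MinTensor₃.inclLeft (MinTensor.tmul a b) * MinTensor₃.inclThird c := by
  rw [inclLeft_tmul, inclThird_apply', MinTensor₃.tmul, MinTensor₃.tmul, MinTensor₃.tmul,
    ← map_mul]
  simp

theorem MinTensor₃.assocLeft_tmul' (z : MinTensor A H) (c : K) :
    MinTensor₃.assocLeft (MinTensor.tmul z c) =
      MinTensor₃.inclLeft z * MinTensor₃.inclThird c :=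
  (RepFamily.lift_of _ _ _).trans (MinTensor₃.preLeft_tmul z c)

theorem MinTensor₃.assocRight_tmul_one (z : MinTensor H K) :
    MinTensor₃.assocRight (MinTensor.tmul (1 : A) z) = MinTensor₃.inclRight z := by
  refine (RepFamily.lift_of _ _ _).trans ((MinTensor₃.preRight_tmul 1 z).trans ?_)
  rw [map_one, one_mul]

variable (i : K →⋆ₐ[ℂ] H) (φ : K →⋆ₐ[ℂ] MinTensor A H)

/-- The linear map `x ⊗ y ↦ (1 ⊗ i x) φ(y)`. -/
def inclMul : K ⊗[ℂ] K →ₗ[ℂ] MinTensor A H :=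
  LinearMap.mul' ℂ (MinTensor A H) ∘ₗ
    TensorProduct.map (inclRight.comp i).toAlgHom.toLinearMap φ.toAlgHom.toLinearMap

@[simp]
theorem inclMul_tmul (x y : K) : inclMul i φ (x ⊗ₜ y) = inclRight (i x) * φ y := rfl

theorem inclMul_tmul_mul (b : K) (r : K ⊗[ℂ] K) :
    inclMul i φ ((b ⊗ₜ 1) * r) = inclRight (i b) * inclMul i φ r := by
  induction r using TensorProduct.induction_on with
  | zero => simp
  | add r s hr hs => rw [mul_add, map_add, map_add, mul_add, hr, hs]
  | tmul x y =>
    rw [Algebra.TensorProduct.tmul_mul_tmul, inclMul_tmul, inclMul_tmul, one_mul, map_mul,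
      map_mul, mul_assoc]

theorem inclMul_mul_tmul (r : K ⊗[ℂ] K) (y : K) :
    inclMul i φ (r * (1 ⊗ₜ y)) = inclMul i φ r * φ y := by
  induction r using TensorProduct.induction_on with
  | zero => simp
  | add r s hr hs => rw [add_mul, map_add, map_add, add_mul, hr, hs]
  | tmul x y =>
    rw [Algebra.TensorProduct.tmul_mul_tmul, inclMul_tmul, inclMul_tmul, mul_one, map_mul,
      mul_assoc]

/-- The linear map `t ⊗ c ↦ inclMul t ⊗ i c`. -/
def inclMul₃ : (K ⊗[ℂ] K) ⊗[ℂ] K →ₗ[ℂ] MinTensor₃ A H H :=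
  LinearMap.mul' ℂ (MinTensor₃ A H H) ∘ₗ TensorProduct.map
    ((MinTensor₃.inclLeft (A := A) (B := H) (C := H)).toAlgHom.toLinearMap ∘ₗ inclMul i φ)
    ((MinTensor₃.inclThird (A := A) (B := H) (C := H)).comp i).toAlgHom.toLinearMap

@[simp]
theorem inclMul₃_tmul (t : K ⊗[ℂ] K) (c : K) : inclMul₃ i φ (t ⊗ₜ c) =
    MinTensor₃.inclLeft (inclMul i φ t) * MinTensor₃.inclThird (i c) := rfl

/-- The commutation of `φ(c) ⊗ 1` with `1 ⊗ 1 ⊗ i b` allows the product of last legs made by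
`mulLast` to be split into a factor from `p` and a factor from `q`. -/
theorem inclMul₃_mulLast (p q : K ⊗[ℂ] K) : inclMul₃ i φ (mulLast (p ⊗ₜ q)) =
    MinTensor₃.inclRight (map i i (of p)) * MinTensor₃.assocLeft (map φ i (of q)) := by
  induction p using TensorProduct.induction_on with
  | zero => simp
  | add p p' hp hp' =>
    rw [TensorProduct.add_tmul, map_add, map_add, hp, hp', map_add, map_add, map_add, add_mul]
  | tmul a b =>
    induction q using TensorProduct.induction_on with
    | zero => simp
    | add q q' hq hq' =>
      rw [TensorProduct.tmul_add, map_add, map_add, hq, hq', map_add, map_add, map_add, mul_add]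
    | tmul c d =>
      change _ = MinTensor₃.inclRight (map i i (tmul a b)) *
        MinTensor₃.assocLeft (map φ i (tmul c d))
      have h1 : (MinTensor₃.inclRight (tmul (i a) (i b)) : MinTensor₃ A H H) =
          MinTensor₃.inclLeft (inclRight (i a)) * MinTensor₃.inclThird (i b) := by
        rw [inclRight_apply, ← MinTensor₃.tmul_eq]
        exact MinTensor₃.inclRight_of _
      rw [mulLast_tmul, inclMul₃_tmul, inclMul_tmul, map_tmul, map_tmul,
        MinTensor₃.assocLeft_tmul', h1, map_mul, map_mul, map_mul, mul_assoc, mul_assoc,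
        ← mul_assoc (MinTensor₃.inclThird (i b)), ← (MinTensor₃.commute_left (φ c) (i b)).eq,
        mul_assoc]

variable [FiniteDimensional ℂ K] {ΔH : H →⋆ₐ[ℂ] MinTensor H H} {ΔK : K →⋆ₐ[ℂ] MinTensor K K}
  {i φ}

/-- `inclMul` carries the diagonal coaction on `K ⊗ K` to `id ⊗ Δ_H`, because both `k ↦ 1 ⊗ i k` and
`φ` are equivariant. Coinvariant tensors are thus sent to fixed elements. -/
theorem coact_inclMul (hi : ∀ k, ΔH (i k) = map i i (ΔK k))
    (hφ : ∀ k, MinTensor₃.assocLeft (map φ i (ΔK k)) =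
      MinTensor₃.assocRight (map (StarAlgHom.id ℂ A) ΔH (φ k))) (t : K ⊗[ℂ] K) :
    MinTensor₃.assocRight (map (StarAlgHom.id ℂ A) ΔH (inclMul i φ t)) =
      inclMul₃ i φ (mulLast (TensorProduct.map (algComul ΔK).toLinearMap
        (algComul ΔK).toLinearMap t)) := by
  induction t using TensorProduct.induction_on with
  | zero => simp
  | add s t hs ht => simp only [map_add, hs, ht]
  | tmul x y =>
    rw [TensorProduct.map_tmul, AlgHom.toLinearMap_apply, AlgHom.toLinearMap_apply,
      inclMul₃_mulLast, of_algComul, of_algComul, hφ, inclMul_tmul, map_mul, map_mul,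
      inclRight_apply, map_tmul, map_one, hi, MinTensor₃.assocRight_tmul_one]

/-- For an equivariant `φ : K → A ⊗ H`, the element `inclMul (galoisInv (k ⊗ 1))` lies in
`A ⊗ 1`. -/
theorem exists_inclLeft_eq (hH : IsCompactQuantumGroup ΔH) (hK : IsCompactQuantumGroup ΔK)
    (hi : ∀ k, ΔH (i k) = map i i (ΔK k))
    (hφ : ∀ k, MinTensor₃.assocLeft (map φ i (ΔK k)) =
      MinTensor₃.assocRight (map (StarAlgHom.id ℂ A) ΔH (φ k))) (k : K) :
    ∃ a : A, inclLeft a = inclMul i φ (galoisInv (galois_bijective hK) (k ⊗ₜ 1)) := by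
  refine hH.exists_inclLeft ?_
  rw [coact_inclMul hi hφ, mulLast_galoisInv (algCoassoc_algComul hK.coassoc), inclMul₃_tmul,
    map_one, map_one, mul_one]

theorem commute_inclLeft_inclRight (a : A) (b : H) :
    Commute (inclLeft a : MinTensor A H) (inclRight b) := by
  rw [Commute, SemiconjBy, inclLeft_apply, inclRight_apply, tmul_mul, tmul_mul]
  simp

/-- Multiplicativity of `θ(k) = inclMul (T⁻¹(k ⊗ 1))`. As `θ(k)` lies in `A ⊗ 1`, it can be moved
past `1 ⊗ i x`, and so `inclMul` turns `sandwich` into left multiplication by `θ(k)`. -/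
theorem inclMul_galoisInv_mul (hH : IsCompactQuantumGroup ΔH) (hK : IsCompactQuantumGroup ΔK)
    (hi : ∀ k, ΔH (i k) = map i i (ΔK k))
    (hφ : ∀ k, MinTensor₃.assocLeft (map φ i (ΔK k)) =
      MinTensor₃.assocRight (map (StarAlgHom.id ℂ A) ΔH (φ k))) (k l : K) :
    inclMul i φ (galoisInv (galois_bijective hK) ((k * l) ⊗ₜ 1)) =
      inclMul i φ (galoisInv (galois_bijective hK) (k ⊗ₜ 1)) *
        inclMul i φ (galoisInv (galois_bijective hK) (l ⊗ₜ 1)) := by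
  obtain ⟨a, ha⟩ := exists_inclLeft_eq hH hK hi hφ k
  have key : ∀ s, inclMul i φ (sandwich (galoisInv (galois_bijective hK) (k ⊗ₜ 1)) s) =
      inclMul i φ (galoisInv (galois_bijective hK) (k ⊗ₜ 1)) * inclMul i φ s := fun s => by
    induction s using TensorProduct.induction_on with
    | zero => simp
    | add s t hs ht => rw [map_add, map_add, hs, ht, map_add, mul_add]
    | tmul x y =>
      rw [sandwich_tmul, inclMul_mul_tmul, inclMul_tmul_mul, ← ha, inclMul_tmul, ← mul_assoc,
        (commute_inclLeft_inclRight a (i x)).eq]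
  rw [galoisInv_mul, key]

/-- Recovers `φ` from the composite of `inclMul` with the inverse Galois map, so that constancy of
the latter passes to `φ`. -/
theorem inclMul_galoisInv_comul (hK : IsCompactQuantumGroup ΔK) (k : K) :
    inclMul i φ (galoisInv (galois_bijective hK) (algComul ΔK k)) = φ k := by
  rw [galoisInv_comul, inclMul_tmul, map_one, map_one, one_mul]

/-- A path of equivariant maps `K → A ⊗ H` that starts in `1 ⊗ H` is constant. -/
theorem equivariant_path_eq [Nontrivial A] (hH : IsCompactQuantumGroup ΔH)
    (hK : IsCompactQuantumGroup ΔK) (hi : ∀ k, ΔH (i k) = map i i (ΔK k))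
    (φ : unitInterval → K →⋆ₐ[ℂ] MinTensor A H) (hc : ∀ k, Continuous fun t => φ t k)
    (hφ : ∀ t k, MinTensor₃.assocLeft (map (φ t) i (ΔK k)) =
      MinTensor₃.assocRight (map (StarAlgHom.id ℂ A) ΔH (φ t k)))
    (h0 : ∀ k, ∃ h, inclRight h = φ 0 k) (t : unitInterval) (k : K) : φ t k = φ 0 k := by
  have hT := galois_bijective hK
  have hcont : ∀ s, Continuous fun t => inclMul i (φ t) s := fun s => by
    induction s using TensorProduct.induction_on with
    | zero => simpa using continuous_const
    | add s t hs ht =>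
      simp only [map_add]
      exact hs.add ht
    | tmul x y =>
      simp only [inclMul_tmul]
      exact continuous_const.mul (hc y)
  have hrange : ∀ s, ∃ h, inclRight h = inclMul i (φ 0) s := fun s => by
    induction s using TensorProduct.induction_on with
    | zero => exact ⟨0, by simp⟩
    | add s t hs ht =>
      obtain ⟨x, hx⟩ := hs
      obtain ⟨y, hy⟩ := ht
      exact ⟨x + y, by rw [map_add, map_add, hx, hy]⟩
    | tmul x y =>
      obtain ⟨h, hh⟩ := h0 y
      exact ⟨i x * h, by rw [map_mul, hh, inclMul_tmul]⟩
  obtain ⟨f, hf⟩ := exists_isState (A := A)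
  -- At `t = 0` the value lies both in `A ⊗ 1` and in `1 ⊗ H`; slicing `a ⊗ 1 = 1 ⊗ h` by the state
  -- `f` shows that `h` is the scalar `f a`.
  have hscalar : ∀ k, ∃ r : ℂ, inclMul i (φ 0) (galoisInv hT (k ⊗ₜ 1)) = r • 1 := fun k => by
    obtain ⟨h, hh⟩ := hrange (galoisInv hT (k ⊗ₜ 1))
    obtain ⟨a, ha⟩ := exists_inclLeft_eq hH hK hi (hφ 0) k
    refine ⟨f a, ?_⟩
    have h1 : h = f a • 1 := by
      rw [← hf.sliceLeft_inclRight h, hh, ← ha, inclLeft_apply, hf.sliceLeft_tmul]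
    rw [← hh, h1, map_smul, map_one]
  have hz : ∀ k t, inclMul i (φ t) (galoisInv hT (k ⊗ₜ 1)) =
      inclMul i (φ 0) (galoisInv hT (k ⊗ₜ 1)) := by
    intro k t
    have hk : k ∈ Submodule.span ℂ {e : K | IsIdempotentElem e} := by
      rw [span_isIdempotentElem]; trivial
    induction hk using Submodule.span_induction with
    | mem e he =>
      obtain ⟨r, hr⟩ := hscalar e
      refine idempotent_path_eq (e := fun t => inclMul i (φ t) (galoisInv hT (e ⊗ₜ 1)))
        (hcont _) (fun t => ?_) hr t
      have h2 := inclMul_galoisInv_mul hH hK hi (hφ t) e e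
      rw [he.eq] at h2
      exact h2.symm
    | zero => simp
    | add x y _ _ hx hy => simp only [TensorProduct.add_tmul, map_add, hx, hy]
    | smul c x _ hx => simp only [← TensorProduct.smul_tmul', map_smul, hx]
  -- `T⁻¹(a ⊗ b)` is `(b ⊗ 1) T⁻¹(a ⊗ 1)`, and the factor `b` contributes `1 ⊗ i b`, which does not
  -- depend on `t`.
  have hall : ∀ s, inclMul i (φ t) (galoisInv hT s) = inclMul i (φ 0) (galoisInv hT s) := by
    intro s
    induction s using TensorProduct.induction_on with
    | zero => simp
    | add s t hs ht => simp only [map_add, hs, ht]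
    | tmul a b => rw [galoisInv_tmul, inclMul_tmul_mul, inclMul_tmul_mul, hz]
  rw [← inclMul_galoisInv_comul (i := i) (φ := φ t) hK, hall, inclMul_galoisInv_comul hK]

/-- An equivariant map `K → A ⊗ H` with values in `1 ⊗ H` and in `δ(A)` exists only if `K` is
trivial. -/
theorem finrank_le_one_of_equivariant [Nontrivial A] {δ : A →⋆ₐ[ℂ] MinTensor A H}
    (hδ : IsCoassociative ΔH δ) (hK : IsCompactQuantumGroup ΔK) (hinj : Function.Injective i)
    (hφ : ∀ k, MinTensor₃.assocLeft (map φ i (ΔK k)) =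
      MinTensor₃.assocRight (map (StarAlgHom.id ℂ A) ΔH (φ k)))
    (h0 : ∀ k, ∃ h, inclRight h = φ k) (h1 : ∀ k, ∃ a, δ a = φ k) :
    Module.finrank ℂ K ≤ 1 := by
  obtain ⟨f, hf⟩ := exists_isState (A := A)
  rcases subsingleton_or_nontrivial H with hH | hH
  · have : Subsingleton K := hinj.subsingleton
    rw [Module.finrank_zero_of_subsingleton]
    exact zero_le_one
  obtain ⟨g, hg⟩ := exists_isState (A := H)
  let J : K ⊗[ℂ] K →⋆ₐ[ℂ] MinTensor₃ A H H := (MinTensor₃.assocLeft.comp (map φ i)).comp of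
  have hJ : ∀ x y, J (x ⊗ₜ y) = MinTensor₃.inclLeft (φ x) * MinTensor₃.inclThird (i y) :=
    fun x y => by
      change MinTensor₃.assocLeft (map φ i (tmul x y)) = _
      rw [map_tmul, MinTensor₃.assocLeft_tmul']
  -- With `φ k = δ a = 1 ⊗ h`: `(φ ⊗ i) Δ_K k = (id ⊗ Δ_H) δ a = (δ ⊗ id) δ a = (δ ⊗ id)(1 ⊗ h) = 1
  -- ⊗ 1 ⊗ h`.
  have hJD : ∀ k, ∃ h, MinTensor₃.inclThird h = J (algComul ΔK k) := fun k => by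
    obtain ⟨h, hh⟩ := h0 k
    obtain ⟨a, ha⟩ := h1 k
    refine ⟨h, ?_⟩
    change _ = MinTensor₃.assocLeft (map φ i (of (algComul ΔK k)))
    rw [of_algComul, hφ, ← ha, ← hδ a, ha, ← hh, inclRight_apply, map_tmul, map_one,
      MinTensor₃.assocLeft_tmul', map_one, one_mul]
    rfl
  have hJall : ∀ s, ∃ h, MinTensor₃.inclThird h = J (galois (algComul ΔK) s) := fun s => by
    induction s using TensorProduct.induction_on with
    | zero => exact ⟨0, by simp⟩
    | add s t hs ht =>
      obtain ⟨x, hx⟩ := hs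
      obtain ⟨y, hy⟩ := ht
      exact ⟨x + y, by rw [map_add, map_add, map_add, hx, hy]⟩
    | tmul x y =>
      obtain ⟨h, hh⟩ := hJD y
      exact ⟨i x * h, by rw [galois_tmul, map_mul, map_mul, hh, hJ, map_one, map_one, one_mul]⟩
  -- By surjectivity of the Galois map, `J (k ⊗ 1) = φ k ⊗ 1` is of the form `1 ⊗ 1 ⊗ h'`, while it
  -- also equals `1 ⊗ h ⊗ 1`. Slicing the first leg by `f` and the last by `g` gives `h = g h' • 1`.
  have hscalar : ∀ k, ∃ r : ℂ, φ k = r • 1 := fun k => by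
    obtain ⟨s, hs⟩ := (galois_bijective hK).2 (k ⊗ₜ 1)
    obtain ⟨h', hh'⟩ := hJall s
    obtain ⟨h, hh⟩ := h0 k
    rw [hs, hJ, map_one, map_one, mul_one, ← hh, inclRight_apply, MinTensor₃.inclLeft_tmul,
      MinTensor₃.inclThird_apply'] at hh'
    have h2 := congrArg (fun w => hg.sliceRight (hf.sliceLeft₃ w)) hh'
    simp only [hf.sliceLeft₃_tmul, hf.map_one, one_smul, hg.sliceRight_tmul, hg.map_one] at h2
    exact ⟨g h', by rw [← hh, ← h2, map_smul, map_one]⟩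
  -- Now `J (x ⊗ 1) = φ x ⊗ 1` and `J (Δ_K y) = (id ⊗ Δ_H)(φ y)` are scalars, and the products `(x ⊗
  -- 1) Δ_K y` span `K ⊗ K`.
  have hJone : ∀ s, ∃ r : ℂ, J s = r • 1 := fun s => by
    have hs := mem_span_mul_algComul hK s
    induction hs using Submodule.span_induction with
    | mem s hs =>
      obtain ⟨x, y, rfl⟩ := hs
      obtain ⟨r, hr⟩ := hscalar x
      obtain ⟨r', hr'⟩ := hscalar y
      have h2 : J (algComul ΔK y) = r' • 1 := by
        change MinTensor₃.assocLeft (map φ i (of (algComul ΔK y))) = _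
        rw [of_algComul, hφ, hr', map_smul, map_smul, map_one, map_one]
      exact ⟨r * r', by
        rw [map_mul, hJ, map_one, map_one, mul_one, hr, h2, map_smul, map_one,
          smul_mul_smul_comm, one_mul]⟩
    | zero => exact ⟨0, by simp⟩
    | add x y _ _ hx hy =>
      obtain ⟨r, hr⟩ := hx
      obtain ⟨r', hr'⟩ := hy
      exact ⟨r + r', by rw [map_add, hr, hr', add_smul]⟩
    | smul c x _ hx =>
      obtain ⟨r, hr⟩ := hx
      exact ⟨c * r, by rw [map_smul, hr, mul_smul]⟩
  refine finrank_le_one (1 : K) fun k => ?_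
  -- `J (1 ⊗ k) = 1 ⊗ 1 ⊗ i k` being a scalar, slicing the first two legs shows that `i k` is a
  -- scalar.
  obtain ⟨r, hr⟩ := hJone (1 ⊗ₜ k)
  refine ⟨r, hinj ?_⟩
  rw [hJ, map_one, map_one, one_mul, MinTensor₃.inclThird_apply'] at hr
  have h2 := congrArg (fun w => hg.sliceLeft (hf.sliceLeft₃ w)) hr
  have h3 : (1 : MinTensor₃ A H H) = MinTensor₃.tmul 1 1 1 := (map_one MinTensor₃.of).symm
  simp only [h3, map_smul, hf.sliceLeft₃_tmul, hf.map_one, one_smul, hg.sliceLeft_tmul,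
    hg.map_one] at h2
  rw [map_smul, map_one, h2]

/-- A compact quantum group with a nontrivial finite-dimensional quantum quotient satisfies the
Type 2 conjecture. -/
theorem type2Holds_of_embedding (hH : IsCompactQuantumGroup ΔH) (hK : IsCompactQuantumGroup ΔK)
    (hdim : 1 < Module.finrank ℂ K) (hi : IsEquivariantEmbedding ΔK ΔH i) : Type2Holds ΔH := by
  rintro A _ _ δ hδ - ⟨ψ, hψ⟩
  let φ : unitInterval → K →⋆ₐ[ℂ] MinTensor A H := fun t => ((joinEval δ t).comp ψ).comp i
  have hφ : ∀ t k, MinTensor₃.assocLeft (map (φ t) i (ΔK k)) =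
      MinTensor₃.assocRight (map (StarAlgHom.id ℂ A) ΔH (φ t k)) := fun t k => by
    have h := hψ t (i k)
    rw [hi.2] at h
    refine Eq.trans ?_ h
    congr 1
    have h2 : ((map ((joinEval δ t).comp ψ) (StarAlgHom.id ℂ H)).comp (map i i)) =
        map (φ t) i := RepFamily.starHom_ext fun x => by
      induction x using TensorProduct.induction_on with
      | zero => simp only [map_zero]
      | add x y hx hy => simp only [map_add, hx, hy]
      | tmul x y =>
        change map _ _ (map i i (tmul x y)) = map (φ t) i (tmul x y)
        rw [map_tmul, map_tmul, map_tmul]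
        rfl
    exact (DFunLike.congr_fun h2 (ΔK k)).symm
  have h0 : ∀ k, ∃ h, inclRight h = φ 0 k := fun k => (mem_join.1 (ψ (i k)).2).1
  have hconst := equivariant_path_eq hH hK hi.2 φ (fun k => (ψ (i k)).1.continuous) hφ h0 1
  -- The end `φ 1` lies in `δ(A)` by the boundary condition of the join at `1`, and in `1 ⊗ H`
  -- because it equals `φ 0`.
  refine absurd (finrank_le_one_of_equivariant (φ := φ 1) hδ.coassoc hK hi.1 (hφ 1) (fun k => ?_)
    fun k => (mem_join.1 (ψ (i k)).2).2) (not_le.2 hdim)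
  rw [hconst]
  exact h0 k

end Equivariant

/-! ### Characters and Stone–Weierstrass density in commutative algebras -/

section CommutativeAlgebras

open WeakDual MinTensor

/-- The threefold minimal tensor product of commutative `C*`-algebras is commutative. -/
instance {A B C : Type u} [CommCStarAlgebra A] [CommCStarAlgebra B] [CommCStarAlgebra C] :
    CommCStarAlgebra (MinTensor₃ A B C) where
  mul_comm x y := by
    refine (RepFamily.denseRange_of _).induction_on₂ (p := fun x y : MinTensor₃ A B C =>
      x * y = y * x) (isClosed_eq (continuous_fst.mul continuous_snd)
      (continuous_snd.mul continuous_fst)) (fun s t => ?_) x y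
    rw [← map_mul, ← map_mul]
    exact congrArg _ (mul_comm (G := A ⊗[ℂ] (B ⊗[ℂ] C)) s t)

theorem MinTensor₃.inclRight_tmul {A B C : Type u} [CStarAlgebra A] [CStarAlgebra B]
    [CStarAlgebra C] (b : B) (c : C) :
    (MinTensor₃.inclRight (MinTensor.tmul b c) : MinTensor₃ A B C) = MinTensor₃.tmul 1 b c :=
  MinTensor₃.inclRight_of _

theorem MinTensor₃.assocRight_tmul_one_right {A B C : Type u} [CStarAlgebra A] [CStarAlgebra B]
    [CStarAlgebra C] (a : A) :
    (MinTensor₃.assocRight (MinTensor.tmul a 1) : MinTensor₃ A B C) =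
      MinTensor₃.inclLeft (MinTensor.inclLeft a) := by
  rw [← MinTensor.tmul_one_one, MinTensor₃.assocRight_tmul, MinTensor.inclLeft_apply,
    MinTensor₃.inclLeft_tmul]

theorem eq_of_characters {B : Type u} [CommCStarAlgebra B] {x y : B}
    (h : ∀ Φ : B →ₐ[ℂ] ℂ, Φ x = Φ y) : x = y :=
  (gelfandStarTransform B).injective (ContinuousMap.ext fun χ => h (CharacterSpace.toAlgHom χ))

theorem exists_point {X : Type u} [TopologicalSpace X] [CompactSpace X] [T2Space X]
    (Φ : C(X, ℂ) →ₐ[ℂ] ℂ) : ∃ x, ∀ f, Φ f = f x := by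
  obtain ⟨x, hx⟩ := (CharacterSpace.homeoEval X ℂ).surjective (CharacterSpace.equivAlgHom.symm Φ)
  refine ⟨x, fun f => ?_⟩
  have h := DFunLike.congr_fun hx f
  exact h.symm

theorem point_ext {X : Type u} [TopologicalSpace X] [CompactSpace X] [T2Space X] {x y : X}
    (h : ∀ f : C(X, ℂ), f x = f y) : x = y :=
  (CharacterSpace.homeoEval X ℂ).injective (CharacterSpace.ext h)

/-- A Stone–Weierstrass theorem for `*`-homomorphisms into commutative `C*`-algebras. -/
theorem denseRange_of_separates {B X : Type u} [CommCStarAlgebra B] [Ring X] [Algebra ℂ X]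
    [StarRing X] (P : X →⋆ₐ[ℂ] B)
    (h : ∀ Φ Ψ : B →ₐ[ℂ] ℂ, (∀ x, Φ (P x) = Ψ (P x)) → Φ = Ψ) : DenseRange P := by
  let Γ : B →⋆ₐ[ℂ] C(characterSpace ℂ B, ℂ) := (gelfandStarTransform B : B →⋆ₐ[ℂ] _)
  let S : StarSubalgebra ℂ C(characterSpace ℂ B, ℂ) := (Γ.comp P).range
  -- Two characters not separated by the range of `P` agree on it, hence are equal by `h`.
  have hsep : S.SeparatesPoints := fun χ χ' hne => by
    by_contra! hcon
    refine hne (CharacterSpace.ext fun b => ?_)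
    have h1 := h (CharacterSpace.toAlgHom χ) (CharacterSpace.toAlgHom χ') fun x =>
      hcon _ ⟨Γ (P x), ⟨x, rfl⟩, rfl⟩
    exact DFunLike.congr_fun h1 b
  have htop := ContinuousMap.starSubalgebra_topologicalClosure_eq_top_of_separatesPoints S hsep
  intro b
  have h2 : Γ b ∈ S.topologicalClosure := htop ▸ StarSubalgebra.mem_top
  have h3 : Γ b ∈ closure (S : Set C(characterSpace ℂ B, ℂ)) := h2
  have hiso : Isometry Γ := gelfandTransform_isometry B
  rw [Metric.mem_closure_iff] at h3 ⊢
  intro ε hε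
  obtain ⟨_, ⟨x, rfl⟩, hx⟩ := h3 ε hε
  exact ⟨P x, ⟨x, rfl⟩, by rw [← hiso.dist_eq]; exact hx⟩

theorem algHom_ext_of_incl {A B : Type u} [CStarAlgebra A] [CStarAlgebra B]
    {Φ Ψ : MinTensor A B →ₐ[ℂ] ℂ} (hl : ∀ a, Φ (inclLeft a) = Ψ (inclLeft a))
    (hr : ∀ b, Φ (inclRight b) = Ψ (inclRight b)) : Φ = Ψ := by
  have hc : ∀ Φ : MinTensor A B →ₐ[ℂ] ℂ, Continuous Φ := fun Φ =>
    map_continuous (CharacterSpace.equivAlgHom.symm Φ)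
  ext z
  induction z using MinTensor.induction with
  | hp => exact isClosed_eq (hc Φ) (hc Ψ)
  | zero => rw [map_zero, map_zero]
  | add x y hx hy => rw [map_add, map_add, hx, hy]
  | tmul a b => rw [tmul_eq, map_mul, map_mul, hl, hr]

end CommutativeAlgebras

/-! ### The quantum group `C(G)` and its finite quotients -/

section Groups

open WeakDual MinTensor

variable {G : Type u} [TopologicalSpace G] [CompactSpace G] [T2Space G] [Group G]
  [IsTopologicalGroup G]

theorem algHom_groupComul {Φ : MinTensor C(G, ℂ) C(G, ℂ) →ₐ[ℂ] ℂ} {p q : G}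
    (hp : ∀ f, Φ (inclLeft f) = f p) (hq : ∀ f, Φ (inclRight f) = f q) (f : C(G, ℂ)) :
    Φ (groupComul G f) = f (p * q) := by
  let χ : characterSpace ℂ (MinTensor C(G, ℂ) C(G, ℂ)) := CharacterSpace.equivAlgHom.symm Φ
  have h1 : (characterPoint G χ).1 = p := point_ext fun f => by
    have h := character_tmul χ f 1
    rw [ContinuousMap.one_apply, mul_one] at h
    exact h.symm.trans (hp f)
  have h2 : (characterPoint G χ).2 = q := point_ext fun f => by
    have h := character_tmul χ 1 f
    rw [ContinuousMap.one_apply, one_mul] at h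
    exact h.symm.trans (hq f)
  have h := character_groupComul χ f
  rw [h1, h2] at h
  exact h

-- A character of the triple tensor product is a triple of points `(p₁, p₂, p₃)`. It takes the two
-- sides to `f (p₁ * p₂ * p₃)` and `f (p₁ * (p₂ * p₃))`, so coassociativity is associativity in `G`.
set_option maxHeartbeats 800000 in
theorem isCoassociative_groupComul : IsCoassociative (groupComul G) (groupComul G) := by
  intro f
  refine eq_of_characters fun Ω => ?_
  obtain ⟨p₁, h₁⟩ := exists_point (Ω.comp (MinTensor₃.inclLeft.comp inclLeft).toAlgHom)
  obtain ⟨p₂, h₂⟩ := exists_point (Ω.comp (MinTensor₃.inclLeft.comp inclRight).toAlgHom)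
  obtain ⟨p₃, h₃⟩ := exists_point (Ω.comp MinTensor₃.inclThird.toAlgHom)
  have e₁ : ∀ g : C(G, ℂ), Ω (MinTensor₃.inclLeft (inclLeft g)) = g p₁ := h₁
  have e₂ : ∀ g : C(G, ℂ), Ω (MinTensor₃.inclLeft (inclRight g)) = g p₂ := h₂
  have e₃ : ∀ g : C(G, ℂ), Ω (MinTensor₃.inclThird g) = g p₃ := h₃
  have hl : Ω (MinTensor₃.assocLeft (map (groupComul G) (StarAlgHom.id ℂ C(G, ℂ))
      (groupComul G f))) = f (p₁ * p₂ * p₃) := by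
    refine algHom_groupComul (Φ := Ω.comp (MinTensor₃.assocLeft.comp
      (map (groupComul G) (StarAlgHom.id ℂ C(G, ℂ)))).toAlgHom) (fun g => ?_) (fun g => ?_) f
    · change Ω (MinTensor₃.assocLeft (map (groupComul G) (StarAlgHom.id ℂ C(G, ℂ))
        (tmul g 1))) = _
      rw [map_tmul, map_one, MinTensor₃.assocLeft_tmul', map_one, mul_one]
      exact algHom_groupComul (Φ := Ω.comp MinTensor₃.inclLeft.toAlgHom) e₁ e₂ g
    · change Ω (MinTensor₃.assocLeft (map (groupComul G) (StarAlgHom.id ℂ C(G, ℂ))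
        (tmul 1 g))) = _
      rw [map_tmul, map_one, MinTensor₃.assocLeft_tmul', map_one, one_mul]
      exact e₃ g
  have hr : Ω (MinTensor₃.assocRight (map (StarAlgHom.id ℂ C(G, ℂ)) (groupComul G)
      (groupComul G f))) = f (p₁ * (p₂ * p₃)) := by
    refine algHom_groupComul (Φ := Ω.comp (MinTensor₃.assocRight.comp
      (map (StarAlgHom.id ℂ C(G, ℂ)) (groupComul G))).toAlgHom) (fun g => ?_) (fun g => ?_) f
    · change Ω (MinTensor₃.assocRight (map (StarAlgHom.id ℂ C(G, ℂ)) (groupComul G)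
        (tmul g 1))) = _
      rw [map_tmul, map_one, MinTensor₃.assocRight_tmul_one_right]
      exact e₁ g
    · change Ω (MinTensor₃.assocRight (map (StarAlgHom.id ℂ C(G, ℂ)) (groupComul G)
        (tmul 1 g))) = _
      rw [map_tmul, map_one, MinTensor₃.assocRight_tmul_one]
      refine algHom_groupComul (Φ := Ω.comp MinTensor₃.inclRight.toAlgHom) (fun g => ?_)
        (fun g => ?_) g
      · change Ω (MinTensor₃.inclRight (tmul g 1)) = _
        rw [MinTensor₃.inclRight_tmul, ← MinTensor₃.inclLeft_tmul]
        exact e₂ g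
      · change Ω (MinTensor₃.inclRight (tmul 1 g)) = _
        rw [MinTensor₃.inclRight_tmul, ← MinTensor₃.inclThird_apply']
        exact e₃ g
  rw [hl, hr, mul_assoc]

/-- If `j` and the comultiplication separate characters, the span of the products of their values
is dense. -/
theorem dense_span_mul_groupComul
    (j : C(G, ℂ) →⋆ₐ[ℂ] MinTensor C(G, ℂ) C(G, ℂ))
    (h : ∀ Φ Ψ : MinTensor C(G, ℂ) C(G, ℂ) →ₐ[ℂ] ℂ, (∀ f, Φ (j f) = Ψ (j f)) →
      (∀ f, Φ (groupComul G f) = Ψ (groupComul G f)) → Φ = Ψ) :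
    Dense (Submodule.span ℂ {x | ∃ f g, x = j f * groupComul G g} :
      Set (MinTensor C(G, ℂ) C(G, ℂ))) := by
  let P := algLift j (groupComul G) fun f g => mul_comm _ _
  have hP : DenseRange P := denseRange_of_separates P fun Φ Ψ hΦ => by
    refine h Φ Ψ (fun f => ?_) (fun f => ?_)
    · have hf : P (f ⊗ₜ 1) = j f :=
        (algLift_tmul _ _ _ _ _).trans (by rw [map_one, mul_one])
      rw [← hf]
      exact hΦ _
    · have hf : P (1 ⊗ₜ f) = groupComul G f :=
        (algLift_tmul _ _ _ _ _).trans (by rw [map_one, one_mul])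
      rw [← hf]
      exact hΦ _
  refine hP.mono ?_
  rintro _ ⟨t, rfl⟩
  induction t using TensorProduct.induction_on with
  | zero => rw [map_zero]; exact Submodule.zero_mem _
  | add s t hs ht => rw [map_add]; exact Submodule.add_mem _ hs ht
  | tmul f g => exact Submodule.subset_span ⟨f, g, algLift_tmul _ _ _ _ _⟩

/-- `C(G)` is a compact quantum group. -/
theorem isCompactQuantumGroup_groupComul : IsCompactQuantumGroup (groupComul G) := by
  have hpts : ∀ Φ : MinTensor C(G, ℂ) C(G, ℂ) →ₐ[ℂ] ℂ, ∃ p q : G,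
      (∀ f, Φ (inclLeft f) = f p) ∧ ∀ f, Φ (inclRight f) = f q := fun Φ => by
    obtain ⟨p, hp⟩ := exists_point (Φ.comp inclLeft.toAlgHom)
    obtain ⟨q, hq⟩ := exists_point (Φ.comp inclRight.toAlgHom)
    exact ⟨p, q, hp, hq⟩
  refine ⟨isCoassociative_groupComul, dense_span_mul_groupComul _ fun Φ Ψ h1 h2 => ?_,
    dense_span_mul_groupComul _ fun Φ Ψ h1 h2 => ?_⟩ <;>
  · obtain ⟨p, q, hp, hq⟩ := hpts Φ
    obtain ⟨p', q', hp', hq'⟩ := hpts Ψ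
    have hmul : p * q = p' * q' := point_ext fun f => by
      rw [← algHom_groupComul hp hq, h2, algHom_groupComul hp' hq']
    have hpq : p = p' ∧ q = q' := by
      -- The two density conditions say that `(p, p * q)`, respectively `(q, p * q)`, determines
      -- `(p, q)`: this is left, respectively right, cancellation in `G`. The alternatives serve the
      -- two conditions.
      first
      | have hpp : p = p' := point_ext fun f => by rw [← hp, h1, hp']
        exact ⟨hpp, mul_left_cancel (hpp ▸ hmul)⟩
      | have hqq : q = q' := point_ext fun f => by rw [← hq, h1, hq']
        exact ⟨mul_right_cancel (hqq ▸ hmul), hqq⟩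
    refine algHom_ext_of_incl (fun f => ?_) fun f => ?_
    · rw [hp, hp', hpq.1]
    · rw [hq, hq', hpq.2]

/-- A surjective continuous homomorphism of compact groups induces an equivariant embedding. -/
theorem isEquivariantEmbedding_comp {Q : Type u} [TopologicalSpace Q] [CompactSpace Q]
    [T2Space Q] [Group Q] [IsTopologicalGroup Q] (π : G →* Q) (hc : Continuous π)
    (hs : Function.Surjective π) : IsEquivariantEmbedding (groupComul Q) (groupComul G)
      (ContinuousMap.compStarAlgHom' ℂ ℂ (⟨π, hc⟩ : C(G, Q))) := by
  refine ⟨fun f g hfg => ContinuousMap.ext fun x => ?_, fun f => eq_of_characters fun Φ => ?_⟩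
  · obtain ⟨y, rfl⟩ := hs x
    exact DFunLike.congr_fun hfg y
  · obtain ⟨p, hp⟩ := exists_point (Φ.comp inclLeft.toAlgHom)
    obtain ⟨q, hq⟩ := exists_point (Φ.comp inclRight.toAlgHom)
    rw [algHom_groupComul (Φ := Φ) hp hq]
    set i := ContinuousMap.compStarAlgHom' ℂ ℂ (⟨π, hc⟩ : C(G, Q))
    have h := algHom_groupComul (Φ := Φ.comp (map i i).toAlgHom) (p := π p) (q := π q)
      (fun g => ?_) (fun g => ?_) f
    · refine Eq.trans ?_ h.symm
      change f (π (p * q)) = _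
      rw [map_mul]
    · change Φ (map i i (tmul g 1)) = _
      rw [map_tmul, map_one]
      exact hp (i g)
    · change Φ (map i i (tmul 1 g)) = _
      rw [map_tmul, map_one]
      exact hq (i g)

/-- In dimension at most one all functions are multiples of a single `v`. As `1` is such a multiple,
`v` is constant, and then no function separates points. -/
theorem one_lt_finrank_continuousMap {X : Type u} [TopologicalSpace X] [CompactSpace X]
    [T2Space X] [FiniteDimensional ℂ C(X, ℂ)] [Nontrivial X] : 1 < Module.finrank ℂ C(X, ℂ) := by
  by_contra! h
  obtain ⟨v, hv⟩ := finrank_le_one_iff.1 h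
  obtain ⟨x, y, hxy⟩ := exists_pair_ne X
  obtain ⟨c, hc⟩ := hv 1
  have h1 : ∀ x, c * v x = 1 := fun x => DFunLike.congr_fun hc x
  have h2 : v x = v y :=
    mul_left_cancel₀ (left_ne_zero_of_mul_eq_one (h1 x)) ((h1 x).trans (h1 y).symm)
  refine hxy (point_ext fun f => ?_)
  obtain ⟨d, rfl⟩ := hv f
  change d * v x = d * v y
  rw [h2]

theorem type2Holds_groupComul (N : Subgroup G) [N.Normal] (hN : IsClosed (N : Set G))
    [Finite (G ⧸ N)] [Nontrivial (G ⧸ N)] : Type2Holds (groupComul G) := by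
  -- As an instance, closedness of `N` makes `G ⧸ N` Hausdorff.
  have := hN
  have : FiniteDimensional ℂ C(G ⧸ N, ℂ) :=
    FiniteDimensional.of_injective
      (⟨⟨fun f => ⇑f, fun _ _ => rfl⟩, fun _ _ => rfl⟩ : C(G ⧸ N, ℂ) →ₗ[ℂ] (G ⧸ N → ℂ))
      DFunLike.coe_injective
  exact type2Holds_of_embedding isCompactQuantumGroup_groupComul
    isCompactQuantumGroup_groupComul one_lt_finrank_continuousMap
    (isEquivariantEmbedding_comp (QuotientGroup.mk' N) QuotientGroup.continuous_mk
      (QuotientGroup.mk'_surjective N))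

end Groups

end QuantumJoin

end

theorem mainTheorem3 :
    (∀ (H K : Type u) [CStarAlgebra H] [CStarAlgebra K]
      (ΔH : H →⋆ₐ[ℂ] QuantumJoin.MinTensor H H) (ΔK : K →⋆ₐ[ℂ] QuantumJoin.MinTensor K K),
      QuantumJoin.IsCompactQuantumGroup ΔH →
      QuantumJoin.IsCompactQuantumGroup ΔK →
      FiniteDimensional ℂ K → 1 < Module.finrank ℂ K →
      (∃ i : K →⋆ₐ[ℂ] H, QuantumJoin.IsEquivariantEmbedding ΔK ΔH i) →
      QuantumJoin.Type2Holds ΔH) ∧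
    (∀ (G : Type u) [TopologicalSpace G] [CompactSpace G] [T2Space G] [Group G]
      [IsTopologicalGroup G] (N : Subgroup G) [N.Normal],
      IsClosed (N : Set G) → Finite (G ⧸ N) → Nontrivial (G ⧸ N) →
      QuantumJoin.Type2Holds (QuantumJoin.groupComul G)) := by
  refine ⟨?_, ?_⟩
  · rintro H K _ _ ΔH ΔK hH hK _ hdim ⟨i, hi⟩
    exact QuantumJoin.type2Holds_of_embedding hH hK hdim hi
  · intro G _ _ _ _ _ N _ hN _ _
    exact QuantumJoin.type2Holds_groupComul N hN
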